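/- **Setting.** Let $X$ be a stationary, isotropic Gaussian random field on $\mathbb R^2$ (constant mean, $\operatorname{Cov}\{X(\mathbf x),X(\mathbf y)\}$ depending only on $\|\mathbf x-\mathbf y\|$) whose covariance function satisfies, for all $\mathbf x,\mathbf y\in\mathbb R^2$, $$K(\mathbf x,\mathbf y)=\sum_{j=0}^{\lfloor\nu\rfloor}\beta_j\|\mathbf x-\mathbf y\|^{2j}+\beta_\nu^*\,G_\nu(\|\mathbf x-\mathbf y\|)+r(\mathbf x,\mathbf y),$$ where $\nu>0$, $\beta_0,\dots,\beta_{\lfloor\nu\rfloor}$ and $\beta_\nu^*\neq0$ are constants, $r(\mathbf x,\mathbf y)=O(\|\mathbf x-\mathbf y\|^{2\nu+\tau})$ as $\|\mathbf x-\mathbf y\|\to0$ for some $\tau>0$ (in particular $r(\mathbf x,\mathbf x)=0$), $G_\nu(0)=0$ and, for $s>0$, $G_\nu(s)=s^{2\nu}$ if $\nu\notin\mathbb Z$ and $G_\nu(s)=s^{2\nu}\log s$ if $\nu\in\mathbb Z$. Write $\tilde K(\mathbf x-\mathbf y)=K(\mathbf x,\mathbf y)$ and $\tilde K^{(a_1,a_2)}(\mathbf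 x)=\partial^{a_1+a_2}\tilde K(\mathbf x)/\partial x_1^{a_1}\partial x_2^{a_2}$. Let $\varepsilon,L>0$ and let $\gamma:(-\varepsilon,L+\varepsilon)\to\mathbb R^2$ be a $C^2$ curve with $\|\gamma^{(1)}(t)\|=1$ for all $t$, such that for some $C_3>0$, $\|\gamma(t^*)-\gamma(t)\|\ge C_3|t^*-t|$ for all $t,t^*\in[0,L]$. Let $\varphi:\mathbb R\to\mathbb R$ be $C^2$ with $\varphi(0)=0$, $\varphi(L)=L$ and $\min_{0\le s\le L}\varphi^{(1)}(s)>0$. For $n\ge2$ and $1\le i,j\le n$ put $t_i=t_{n,i}=\varphi(L(i-1)/(n-1))$, $X_i=X(\gamma(t_i))$, $d_{i,j}=\|\gamma(t_i)-\gamma(t_j)\|$. For $\theta,\ell\in\{1,2\}$ define $$b_{\theta,\ell;i,k}=\frac{\ell}{\prod_{0\le j\le\ell,\,j\ne k}(d_{i,i+\theta k}-d_{i,i+\theta j})},\qquad \tilde V_{\theta,\ell}=\sum_{i=1}^{n-\theta\ell}\Bigl(\sum_{k=0}^{\ell}b_{\theta,\ell;i,k}X_{i+\theta k}\Bigr)^2,$$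 $$\tilde f_{\theta,\ell}(\nu)=2\beta_\nu^*\sum_{i=1}^{n-\theta\ell}\ \sum_{0\le k_1<k_2\le\ell}b_{\theta,\ell;i,k_1}b_{\theta,\ell;i,k_2}G_\nu(d_{i+\theta k_1,i+\theta k_2}).$$ (For all large $n$ the denominators do not vanish.) Here $a_n\sim b_n$ means $a_n/b_n\to1$, and $a_n\asymp b_n$ means $0<\liminf a_n/b_n\le\limsup a_n/b_n<\infty$. **Theorem.** Let $\theta,\ell\in\{1,2\}$ and $\nu\in(0,\ell)$. Then $\tilde V_{\theta,\ell}$ has a finite second moment and, as $n\to\infty$, $$E(\tilde V_{\theta,\ell})\sim\tilde f_{\theta,\ell}(\nu)\asymp n^{2\ell+1-2\nu}.$$ In addition, let $\Gamma\subset\mathbb R^2$ be a compact convex set containing $\{\gamma(t):0\le t\le L\}$ and suppose that (i) for all nonnegative integers $a_1,a_2$ with $a_1+a_2=2\ell$, $\tilde K^{(a_1,a_2)}$ exists and is continuous on an open set containing $\{\mathbf x-\mathbf y:\mathbf x,\mathbf y\in\Gamma,\ \mathbf x\ne\mathbf y\}$; (ii) there is a constant $C_4$ such that $|\tilde K^{(a_1,a_2)}(\mathbf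 x-\mathbf y)|\le C_4\|\mathbf x-\mathbf y\|^{2\nu-2\ell}$ for all nonnegative integers $a_1,a_2$ with $2\le a_1+a_2\le2\ell$ and all $\mathbf x,\mathbf y\in\Gamma$, $\mathbf x\ne\mathbf y$. Then $\tilde V_{\theta,\ell}/E(\tilde V_{\theta,\ell})\to1$ almost surely as $n\to\infty$, and $$\operatorname{Var}\bigl\{\tilde V_{\theta,\ell}/E(\tilde V_{\theta,\ell})\bigr\}=\begin{cases}O(n^{-1}),&\nu<(4\ell-1)/4,\\ O(n^{-1}\log n),&\nu=(4\ell-1)/4,\\ O(n^{-4\ell+4\nu}),&\nu>(4\ell-1)/4.\end{cases}$$ -/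

import Mathlib

open MeasureTheory ProbabilityTheory Filter Topology Asymptotics

noncomputable section

namespace CurveVariation

/-- The Euclidean plane. -/
abbrev Plane : Type := EuclideanSpace ℝ (Fin 2)

/-- The covariance function `K(x, y) = Cov(X(x), X(y))`. -/
def covFun {Ω : Type*} [MeasurableSpace Ω] (P : Measure Ω) (X : Plane → Ω → ℝ)
    (x y : Plane) : ℝ :=
  covariance (X x) (X y) P

/-- For a stationary field, `K̃(x - y) = K(x, y)`; in particular `K̃(z) = K(z, 0)`. -/
def covTilde {Ω : Type*} [MeasurableSpace Ω] (P : Measure Ω) (X : Plane → Ω → ℝ)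
    (z : Plane) : ℝ :=
  covFun P X z 0

/-- A Gaussian random field on the plane (all finite dimensional distributions are Gaussian,
possibly degenerate) with constant mean, whose covariance depends only on the distance of the
two points. -/
structure IsStationaryIsotropicGaussianField {Ω : Type*} [MeasurableSpace Ω]
    (P : Measure Ω) (X : Plane → Ω → ℝ) : Prop where
  gaussian : IsGaussianProcess X P
  mean_const : ∃ μ : ℝ, ∀ x, ∫ ω, X x ω ∂P = μ
  isotropic : ∀ x y x' y' : Plane, ‖x - y‖ = ‖x' - y'‖ → covFun P X x y = covFun P X x' y'

open Classical in
/-- The principal irregular function: `G_ν(0) = 0`, and for `s > 0`, `G_ν(s) = s^{2ν}` if `ν` is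
not an integer, `G_ν(s) = s^{2ν} log s` if `ν` is an integer. -/
def G (ν s : ℝ) : ℝ :=
  if s = 0 then 0
  else if ∃ m : ℤ, ν = m then s ^ (2 * ν) * Real.log s
  else s ^ (2 * ν)

/-- The covariance model: `K(x, y) = ∑_{j ≤ ⌊ν⌋} β_j ‖x - y‖^{2j} + β* G_ν(‖x - y‖) + r(x, y)`
for all `x, y`, where `r(x, y) = O(‖x - y‖^{2ν + τ})` as `‖x - y‖ → 0` for some `τ > 0`. -/
def HasCovarianceExpansion (K : Plane → Plane → ℝ) (ν : ℝ) (β : ℕ → ℝ) (βstar : ℝ) : Prop :=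
  ∃ r : Plane → Plane → ℝ,
    (∀ x y, K x y = (∑ j ∈ Finset.range (⌊ν⌋₊ + 1), β j * ‖x - y‖ ^ (2 * j))
      + βstar * G ν ‖x - y‖ + r x y) ∧
    ∃ τ : ℝ, 0 < τ ∧
      (fun p : Plane × Plane => r p.1 p.2)
        =O[comap (fun p : Plane × Plane => ‖p.1 - p.2‖) (𝓝 0)]
      (fun p : Plane × Plane => ‖p.1 - p.2‖ ^ (2 * ν + τ))

/-- The sampling parameters `t_{n,i} = φ(L (i - 1) / (n - 1))`, `1 ≤ i ≤ n`. -/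
def samplePt (φ : ℝ → ℝ) (L : ℝ) (n i : ℕ) : ℝ :=
  φ (L * ((i : ℝ) - 1) / ((n : ℝ) - 1))

/-- The distances `d_{i,j} = ‖γ(t_{n,i}) - γ(t_{n,j})‖`. -/
def dist2 (γ : ℝ → Plane) (φ : ℝ → ℝ) (L : ℝ) (n i j : ℕ) : ℝ :=
  ‖γ (samplePt φ L n i) - γ (samplePt φ L n j)‖

/-- The coefficients
`b_{θ,ℓ;i,k} = ℓ / ∏_{0 ≤ j ≤ ℓ, j ≠ k} (d_{i,i+θk} - d_{i,i+θj})`. -/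
def coeffB (γ : ℝ → Plane) (φ : ℝ → ℝ) (L : ℝ) (θ ℓ n i k : ℕ) : ℝ :=
  (ℓ : ℝ) / ∏ j ∈ (Finset.range (ℓ + 1)).erase k,
    (dist2 γ φ L n i (i + θ * k) - dist2 γ φ L n i (i + θ * j))

/-- The generalized difference `∇̃_{θ,ℓ} X_i = ∑_{k=0}^ℓ b_{θ,ℓ;i,k} X(γ(t_{n,i+θk}))`. -/
def nablaTilde {Ω : Type*} (X : Plane → Ω → ℝ) (γ : ℝ → Plane) (φ : ℝ → ℝ) (L : ℝ)
    (θ ℓ n i : ℕ) (ω : Ω) : ℝ :=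
  ∑ k ∈ Finset.range (ℓ + 1),
    coeffB γ φ L θ ℓ n i k * X (γ (samplePt φ L n (i + θ * k))) ω

/-- The `ℓ`-th order quadratic variation `Ṽ_{θ,ℓ} = ∑_{i=1}^{n-θℓ} (∇̃_{θ,ℓ} X_i)²`, based on
`n` observations. -/
def VTilde {Ω : Type*} (X : Plane → Ω → ℝ) (γ : ℝ → Plane) (φ : ℝ → ℝ) (L : ℝ)
    (θ ℓ n : ℕ) (ω : Ω) : ℝ :=
  ∑ i ∈ Finset.Icc 1 (n - θ * ℓ), (nablaTilde X γ φ L θ ℓ n i ω) ^ 2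

/-- `f̃_{θ,ℓ}(ν) = 2 β* ∑_{i=1}^{n-θℓ} ∑_{0 ≤ k₁ < k₂ ≤ ℓ}
b_{θ,ℓ;i,k₁} b_{θ,ℓ;i,k₂} G_ν(d_{i+θk₁,i+θk₂})`. -/
def fTilde (βstar : ℝ) (γ : ℝ → Plane) (φ : ℝ → ℝ) (L : ℝ) (θ ℓ : ℕ) (ν : ℝ) (n : ℕ) : ℝ :=
  2 * βstar * ∑ i ∈ Finset.Icc 1 (n - θ * ℓ),
    ∑ k₂ ∈ Finset.range (ℓ + 1), ∑ k₁ ∈ Finset.range k₂,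
      coeffB γ φ L θ ℓ n i k₁ * coeffB γ φ L θ ℓ n i k₂
        * G ν (dist2 γ φ L n (i + θ * k₁) (i + θ * k₂))

/-- `a_n ≍ b_n`, that is `0 < liminf a_n / b_n ≤ limsup a_n / b_n < ∞`: the quotients eventually
lie between two strictly positive constants. -/
def SameOrder (a b : ℕ → ℝ) : Prop :=
  ∃ c C : ℝ, 0 < c ∧ ∀ᶠ n in atTop, c ≤ a n / b n ∧ a n / b n ≤ C

/-- The first order partial derivative `∂f/∂x_i` (with value `0` where it does not exist). -/
def pderiv (i : Fin 2) (f : Plane → ℝ) (x : Plane) : ℝ :=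
  lineDeriv ℝ f x (EuclideanSpace.single i (1 : ℝ))

/-- The partial derivative `f^{(a₁,a₂)} = ∂^{a₁+a₂} f / ∂x₁^{a₁} ∂x₂^{a₂}`. -/
def mixedPartial (a₁ a₂ : ℕ) (f : Plane → ℝ) : Plane → ℝ :=
  (pderiv 0)^[a₁] ((pderiv 1)^[a₂] f)

/-- `f^{(a₁,a₂)}` exists at every point of the open set `U`: each of the successive one-variable
differentiations, `a₂` times in `x₂` and then `a₁` times in `x₁`, is possible on `U`. -/
def MixedPartialExistsOn (a₁ a₂ : ℕ) (f : Plane → ℝ) (U : Set Plane) : Prop :=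
  (∀ b < a₂, ∀ x ∈ U,
    LineDifferentiableAt ℝ (mixedPartial 0 b f) x (EuclideanSpace.single 1 (1 : ℝ))) ∧
  (∀ a < a₁, ∀ x ∈ U,
    LineDifferentiableAt ℝ (mixedPartial a a₂ f) x (EuclideanSpace.single 0 (1 : ℝ)))

end CurveVariation

end

noncomputable section
namespace CurveVariation

/-! ### One-dimensional Gaussian integrals -/

/-! Composing `γ` with the design function `φ` gives a regular curve `c` sampled at equally spaced
parameters, so each generalized difference is a divided difference of `X ∘ c` over a window of
spacing `δ` of order `1/n`. Its weights have order `δ ^ (-ℓ)` and sum to zero. The differences are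
therefore centred and jointly Gaussian, and the quadratic variation is a sum of their squares.

Expectation. The covariance expansion is inserted into the variance of one difference. The constant
term disappears; the term in `‖x - y‖ ^ 2` equals `-2` times the squared divided difference of the
curve itself, hence is bounded (`abs_windowCov_sq_le`); the remainder has lower order. The principal
irregular term is asymptotic to a nonzero constant times `δ ^ (2ν - 2ℓ)`, uniformly over windows up
to the speed of the curve (`irregularSum_asymp`). Its sign comes for free, because a variance is
nonnegative (`windowCov_diag_asymp`). Summing about `n` such terms gives `VTilde_expectation`.

Covariances at a distance. By isotropy the covariance is a function of the squared distance.
Conditions (i) and (ii) make this profile smooth away from zero and bound its derivatives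
(`contDiffAt_radialProfile`, `RadialChain.profileBound`). Two divided differences, one in each
argument, are controlled by the mixed derivatives of the kernel with order between `1` and `ℓ` in
each variable; this needs only two derivatives of the curve (`abs_windowCov_radial_le`). With `s =
2ℓ - 2ν`, the covariance of the differences `i` and `j` is at most a constant times `(n / (1 + |i -
j|)) ^ s`.

Fluctuations. A Gaussian vector can be rotated to independent coordinates, so the variance of the
sum of squares is twice the sum of the squared covariances (`variance_sum_sq`). Divided by the
squared mean this is of order at most `n⁻¹ * ∑ (k + 1) ^ (-2s)`, and the three regimes correspond to
`2s` above, at or below `1`. These rates need not be summable, so almost sure convergence rests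
instead on an exponential tail bound in the Frobenius norm of the covariance matrix
(`measure_abs_sum_sq_sub_integral_ge_le`) and Borel–Cantelli. -/

lemma exp_gaussian_sq_eq {v : NNReal} (hv : v ≠ 0) (s x : ℝ) :
    gaussianPDFReal 0 v x • Real.exp (s * x ^ 2)
      = (√(2 * Real.pi * v))⁻¹ * Real.exp (-((1 - 2 * s * v) / (2 * v)) * x ^ 2) := by
  have : (v : ℝ) ≠ 0 := by exact_mod_cast hv
  rw [gaussianPDFReal, smul_eq_mul, mul_assoc, ← Real.exp_add]
  congr 2
  field_simp
  ring

lemma integral_exp_sq_gaussianReal {v : NNReal} {s : ℝ} (hs : 2 * s * v < 1) :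
    ∫ x, Real.exp (s * x ^ 2) ∂(gaussianReal 0 v) = (√(1 - 2 * s * v))⁻¹ := by
  by_cases hv : v = 0
  · simp [hv, gaussianReal_zero_var]
  have hv' : (0 : ℝ) < v := by positivity
  rw [integral_gaussianReal_eq_integral_smul hv]
  simp_rw [exp_gaussian_sq_eq hv]
  rw [integral_const_mul, integral_gaussian, ← Real.sqrt_inv, ← Real.sqrt_inv,
    ← Real.sqrt_mul (by positivity)]
  congr 1
  have : 1 - 2 * s * v ≠ 0 := by linarith
  field_simp

/-- After squaring, the claim is `1 ≤ (1 - 2x) exp(2x + 4x²)`. For `x ≤ 0` the linear lower bound of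
`exp` suffices, since `(1 - 2x)(1 + 2x + 4x²) = 1 - 8x³`; for `x ≥ 0` the quadratic term of `exp` is
needed. -/
lemma inv_sqrt_one_sub_le {x : ℝ} (hx : |x| ≤ 1 / 4) :
    (√(1 - 2 * x))⁻¹ ≤ Real.exp (x + 2 * x ^ 2) := by
  obtain ⟨h1, h2⟩ := abs_le.1 hx
  have h3 : 0 < 1 - 2 * x := by linarith
  have key : 1 ≤ (1 - 2 * x) * Real.exp (2 * x + 4 * x ^ 2) := by
    rcases le_total 0 x with h | h
    · have := Real.quadratic_le_exp_of_nonneg (x := 2 * x + 4 * x ^ 2) (by positivity)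
      calc (1 : ℝ) ≤ (1 - 2 * x) * (1 + (2 * x + 4 * x ^ 2) + (2 * x + 4 * x ^ 2) ^ 2 / 2) := by
            have e1 : 0 ≤ x ^ 2 * (1 / 4 - x) := mul_nonneg (sq_nonneg _) (by linarith)
            have e2 : 0 ≤ x ^ 4 * (1 / 4 - x) := mul_nonneg (by positivity) (by linarith)
            nlinarith [pow_nonneg h 3, pow_nonneg h 4]
        _ ≤ _ := by gcongr
    · have := Real.add_one_le_exp (2 * x + 4 * x ^ 2)
      calc (1 : ℝ) ≤ (1 - 2 * x) * (2 * x + 4 * x ^ 2 + 1) := by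
            nlinarith [mul_nonneg (sq_nonneg x) (neg_nonneg.2 h)]
        _ ≤ _ := by gcongr
  rw [inv_le_iff_one_le_mul₀ (Real.sqrt_pos.2 h3)]
  have : Real.exp (x + 2 * x ^ 2) = √(Real.exp (2 * x + 4 * x ^ 2)) := by
    rw [← Real.exp_half]; congr 1; ring
  rw [this, mul_comm, ← Real.sqrt_mul h3.le]
  exact Real.one_le_sqrt.2 key

lemma integral_pow_four_gaussianReal (v : NNReal) :
    ∫ x, x ^ 4 ∂(gaussianReal 0 v) = 3 * (v : ℝ) ^ 2 := by
  have h := iteratedDeriv_mgf_zero (X := id) (μ := gaussianReal 0 v)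
    (by simp [integrableExpSet_id_gaussianReal]) 4
  rw [mgf_id_gaussianReal] at h
  simp only [Pi.pow_apply, id] at h
  rw [← h]
  -- One rule serves all four differentiations of `exp(v t² / 2)`: every function that gets
  -- differentiated is a polynomial of degree at most three times this exponential.
  have hd : ∀ (a b c d e t : ℝ), HasDerivAt (fun t : ℝ => (a + b * t + c * t ^ 2 + d * t ^ 3 + e * t ^ 4) *
      Real.exp (0 * t + v * t ^ 2 / 2))
      ((b + v * a * t + 2 * c * t + 3 * d * t ^ 2 + 4 * e * t ^ 3 + v * t * (b * t + c * t ^ 2 + d * t ^ 3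
        + e * t ^ 4)) * Real.exp (0 * t + v * t ^ 2 / 2)) t := by
    intro a b c d e t
    have h1 : HasDerivAt (fun t : ℝ => Real.exp (0 * t + v * t ^ 2 / 2))
        (Real.exp (0 * t + v * t ^ 2 / 2) * (v * t)) t := by
      apply HasDerivAt.exp
      have := ((hasDerivAt_id t).const_mul 0).add ((((hasDerivAt_id t).pow 2).const_mul (v : ℝ)).div_const 2)
      exact this.congr_deriv (by simp; ring)
    have h2 : HasDerivAt (fun t : ℝ => a + b * t + c * t ^ 2 + d * t ^ 3 + e * t ^ 4)
        (b + 2 * c * t + 3 * d * t ^ 2 + 4 * e * t ^ 3) t := by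
      have := (((((hasDerivAt_id t).const_mul b).const_add a).add
        (((hasDerivAt_id t).pow 2).const_mul c)).add (((hasDerivAt_id t).pow 3).const_mul d)).add
        (((hasDerivAt_id t).pow 4).const_mul e)
      exact this.congr_deriv (by simp; ring)
    exact (h2.mul h1).congr_deriv (by ring)
  rw [iteratedDeriv_succ', iteratedDeriv_succ', iteratedDeriv_succ', iteratedDeriv_succ', iteratedDeriv_zero]
  have d1 : deriv (fun t : ℝ => Real.exp (0 * t + v * t ^ 2 / 2)) =
      fun t => (0 + v * t + 0 * t ^ 2 + 0 * t ^ 3 + 0 * t ^ 4) * Real.exp (0 * t + v * t ^ 2 / 2) := by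
    ext t
    have := (hd 1 0 0 0 0 t).deriv
    simp only [zero_mul, add_zero, one_mul] at this ⊢
    rw [this]; ring_nf
  have d2 : deriv (fun t : ℝ => (0 + v * t + 0 * t ^ 2 + 0 * t ^ 3 + 0 * t ^ 4) * Real.exp (0 * t + v * t ^ 2 / 2)) =
      fun t => (v + 0 * t + v ^ 2 * t ^ 2 + 0 * t ^ 3 + 0 * t ^ 4) * Real.exp (0 * t + v * t ^ 2 / 2) := by
    ext t
    rw [(hd _ _ _ _ _ t).deriv]; ring_nf
  have d3 : deriv (fun t : ℝ => (v + 0 * t + v ^ 2 * t ^ 2 + 0 * t ^ 3 + 0 * t ^ 4) * Real.exp (0 * t + v * t ^ 2 / 2)) =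
      fun t => (0 + 3 * v ^ 2 * t + 0 * t ^ 2 + v ^ 3 * t ^ 3 + 0 * t ^ 4) * Real.exp (0 * t + v * t ^ 2 / 2) := by
    ext t
    rw [(hd _ _ _ _ _ t).deriv]; ring_nf
  rw [d1, d2, d3, (hd _ _ _ _ _ 0).deriv]
  simp

/-! ### Squares of centred Gaussian variables -/

section

variable {Ω : Type*} [MeasurableSpace Ω] {P : Measure Ω}

lemma map_eq_gaussianReal_of_centred {W : Ω → ℝ} (hW : HasGaussianLaw W P) (h0 : ∫ ω, W ω ∂P = 0) :
    P.map W = gaussianReal 0 (variance W P).toNNReal := by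
  rw [hW.map_eq_gaussianReal, h0]

/-- The exponent is the mean term plus a term quadratic in the variance, so that multiplying over
independent coordinates produces the mean and the squared Frobenius norm. Positivity is recorded
because it later excludes the default value `0` of a divergent integral. -/
lemma mgf_sq_le {W : Ω → ℝ} (hW : HasGaussianLaw W P) (h0 : ∫ ω, W ω ∂P = 0) {s : ℝ}
    (hs : |s| * variance W P ≤ 1 / 4) :
    0 < mgf (fun ω => W ω ^ 2) P s ∧
    mgf (fun ω => W ω ^ 2) P s ≤ Real.exp (s * variance W P + 2 * s ^ 2 * variance W P ^ 2) := by
  have hv : ((variance W P).toNNReal : ℝ) = variance W P := Real.coe_toNNReal _ (variance_nonneg _ _)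
  have hx : |s * variance W P| ≤ 1 / 4 := by rwa [abs_mul, abs_of_nonneg (variance_nonneg _ _)]
  have hlt : 2 * s * ((variance W P).toNNReal : ℝ) < 1 := by
    rw [hv]; linarith [(abs_le.1 hx).2]
  have : mgf (fun ω => W ω ^ 2) P s = (√(1 - 2 * (s * variance W P)))⁻¹ := by
    have h := integral_exp_sq_gaussianReal hlt
    rw [← map_eq_gaussianReal_of_centred hW h0, integral_map hW.aemeasurable (by fun_prop), hv] at h
    rw [mgf, h, mul_assoc]
  rw [this]
  refine ⟨inv_pos.2 (Real.sqrt_pos.2 (by linarith [(abs_le.1 hx).2])), ?_⟩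
  refine (inv_sqrt_one_sub_le hx).trans (le_of_eq ?_)
  ring_nf

lemma memLp_sq {W : Ω → ℝ} (hW : HasGaussianLaw W P) : MemLp (fun ω => W ω ^ 2) 2 P := by
  have h4 : MemLp W 4 P := hW.memLp (by simp)
  have := h4.mul (p := 4) (q := 4) (r := 2) h4 (hpqr := ⟨by
    rw [show (4 : ENNReal) = 2 * 2 by norm_num, ENNReal.mul_inv (by simp) (by simp),
      ← mul_add, ENNReal.inv_two_add_inv_two, mul_one]⟩)
  simpa [Pi.mul_def, sq] using this

lemma variance_sq [IsProbabilityMeasure P] {W : Ω → ℝ} (hW : HasGaussianLaw W P)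
    (h0 : ∫ ω, W ω ∂P = 0) :
    variance (fun ω => W ω ^ 2) P = 2 * variance W P ^ 2 := by
  have hv : ((variance W P).toNNReal : ℝ) = variance W P := Real.coe_toNNReal _ (variance_nonneg _ _)
  have h2 : ∫ ω, W ω ^ 2 ∂P = variance W P := by
    rw [variance_of_integral_eq_zero hW.aemeasurable h0]
  have h4 : ∫ ω, W ω ^ 4 ∂P = 3 * variance W P ^ 2 := by
    have h := integral_pow_four_gaussianReal (variance W P).toNNReal
    rwa [← map_eq_gaussianReal_of_centred hW h0, integral_map hW.aemeasurable (by fun_prop), hv] at h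
  rw [variance_eq_sub (memLp_sq hW), h2]
  simp only [Pi.pow_apply, ← pow_mul]
  rw [h4]; ring

end

/-! ### Sums of squares of jointly Gaussian variables -/

section

variable {Ω : Type*} [MeasurableSpace Ω] {P : Measure Ω}

lemma exists_orthogonal_diagonalization {ι : Type*} [Fintype ι] [DecidableEq ι] (C : Matrix ι ι ℝ)
    (hC : C.IsHermitian) : ∃ (U : Matrix ι ι ℝ) (d : ι → ℝ), U * U.transpose = 1 ∧
      U.transpose * U = 1 ∧ U.transpose * C * U = Matrix.diagonal d := by
  refine ⟨hC.eigenvectorUnitary, hC.eigenvalues, ?_, ?_, ?_⟩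
  · have := (Matrix.mem_unitaryGroup_iff (A := (hC.eigenvectorUnitary : Matrix ι ι ℝ))).1
      hC.eigenvectorUnitary.2
    simpa [Matrix.star_eq_conjTranspose] using this
  · have := (Matrix.mem_unitaryGroup_iff' (A := (hC.eigenvectorUnitary : Matrix ι ι ℝ))).1
      hC.eigenvectorUnitary.2
    simpa [Matrix.star_eq_conjTranspose] using this
  · have := hC.conjStarAlgAut_star_eigenvectorUnitary
    rw [Unitary.conjStarAlgAut_apply] at this
    simpa [Matrix.star_eq_conjTranspose, Function.comp_def] using this

lemma sum_sq_orthogonal {ι : Type*} [Fintype ι] [DecidableEq ι] {U : Matrix ι ι ℝ}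
    (hU : U * U.transpose = 1) (y : ι → ℝ) :
    ∑ j, (∑ i, U i j * y i) ^ 2 = ∑ i, y i ^ 2 := by
  have h1 : ∑ j, (∑ i, U i j * y i) ^ 2 = (U.transpose.mulVec y) ⬝ᵥ (U.transpose.mulVec y) := by
    simp [dotProduct, Matrix.mulVec, sq]
  rw [h1, Matrix.dotProduct_mulVec, Matrix.vecMul_transpose, Matrix.mulVec_mulVec, hU,
    Matrix.one_mulVec]
  simp [dotProduct, sq]

lemma sum_sq_eq_trace {ι : Type*} [Fintype ι] {C : Matrix ι ι ℝ} (hC : C.IsHermitian) :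
    ∑ i, ∑ j, C i j ^ 2 = (C * C).trace := by
  simp only [Matrix.trace, Matrix.diag, Matrix.mul_apply, sq]
  refine Finset.sum_congr rfl fun i _ => Finset.sum_congr rfl fun j _ => ?_
  have := hC.apply i j
  simp only [star_trivial] at this
  rw [this]

/-- A centred Gaussian vector can be rotated to have independent coordinates. -/
lemma exists_independent_rotation [IsProbabilityMeasure P] {ι : Type*} [Fintype ι]
    {Y : ι → Ω → ℝ} (hY : HasGaussianLaw (fun ω i => Y i ω) P) (h0 : ∀ i, ∫ ω, Y i ω ∂P = 0) :
    ∃ W : ι → Ω → ℝ, (∀ i, HasGaussianLaw (W i) P) ∧ (∀ i, ∫ ω, W i ω ∂P = 0) ∧ iIndepFun W P ∧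
      (∀ ω, ∑ i, W i ω ^ 2 = ∑ i, Y i ω ^ 2) ∧
      ∑ i, variance (W i) P ^ 2 = ∑ i, ∑ j, covariance (Y i) (Y j) P ^ 2 := by
  classical
  set C : Matrix ι ι ℝ := Matrix.of fun i j => covariance (Y i) (Y j) P with hCdef
  have hC : C.IsHermitian := by
    ext i j; simp [C, covariance_comm]
  have hLp : ∀ i, MemLp (Y i) 2 P := fun i => (hY.eval i).memLp_two
  obtain ⟨U, d, hU1, hU2, hUd⟩ := exists_orthogonal_diagonalization C hC
  let T : (ι → ℝ) →L[ℝ] (ι → ℝ) := LinearMap.toContinuousLinearMap (Matrix.mulVecLin U.transpose)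
  let W : ι → Ω → ℝ := fun j ω => ∑ i, U i j * Y i ω
  have hT : (fun ω i => W i ω) = fun ω => T (fun i => Y i ω) := by
    ext ω j; simp [T, W, Matrix.vecMul, dotProduct, mul_comm]
  have hW : HasGaussianLaw (fun ω i => W i ω) P := by
    rw [hT]; exact hY.map_fun T
  have hcov : ∀ j k, covariance (W j) (W k) P = Matrix.diagonal d j k := by
    intro j k
    have := covariance_fun_sum_fun_sum (μ := P) (X := fun i ω => U i j * Y i ω)
      (Y := fun i ω => U i k * Y i ω) (fun i => (hLp i).const_mul _) (fun i => (hLp i).const_mul _)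
    rw [show covariance (W j) (W k) P = _ from this, ← hUd]
    simp only [covariance_const_mul_left, covariance_const_mul_right, Matrix.mul_apply,
      Matrix.transpose_apply, Finset.sum_mul]
    rw [Finset.sum_comm]
    refine Finset.sum_congr rfl fun i _ => Finset.sum_congr rfl fun i' _ => ?_
    simp [C]; ring
  refine ⟨W, fun i => hW.eval i, fun j => ?_, ?_, fun ω => sum_sq_orthogonal hU1 _, ?_⟩
  · simp only [W]
    rw [integral_finsetSum _ fun i _ => ((hLp i).integrable (by norm_num)).const_mul _]
    simp [integral_const_mul, h0]
  · exact hW.iIndepFun_of_covariance_eq_zero fun i j hij => by rw [hcov, Matrix.diagonal_apply_ne _ hij]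
  · have h1 : ∀ i, variance (W i) P = d i := fun i => by
      rw [← covariance_self (hW.eval i).aemeasurable, hcov, Matrix.diagonal_apply_eq]
    have h2 : ∑ i, ∑ j, covariance (Y i) (Y j) P ^ 2 = (C * C).trace := sum_sq_eq_trace hC
    -- The sum of the squared entries of `C` is the trace of `C * C`, which is invariant under
    -- conjugation by `U`.
    have h3 : U.transpose * (C * C) * U = Matrix.diagonal d * Matrix.diagonal d := by
      rw [← hUd]
      calc U.transpose * (C * C) * U = U.transpose * C * 1 * C * U := by simp only [Matrix.mul_assoc, Matrix.one_mul]
        _ = _ := by rw [← hU1]; simp only [Matrix.mul_assoc]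
    rw [h2, ← Matrix.one_mul (C * C), ← hU1, Matrix.mul_assoc, Matrix.trace_mul_comm, h3]
    simp [h1, Matrix.trace, sq]

variable [IsProbabilityMeasure P] {ι : Type*} [Fintype ι] {Y : ι → Ω → ℝ}

/-- After the rotation the summands are independent squares, each with variance twice the square of
its own variance. -/
lemma variance_sum_sq (hY : HasGaussianLaw (fun ω i => Y i ω) P) (h0 : ∀ i, ∫ ω, Y i ω ∂P = 0) :
    variance (fun ω => ∑ i, Y i ω ^ 2) P = 2 * ∑ i, ∑ j, covariance (Y i) (Y j) P ^ 2 := by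
  obtain ⟨W, hW, hW0, hind, hsum, hvar⟩ := exists_independent_rotation hY h0
  have h1 : (fun ω => ∑ i, Y i ω ^ 2) = ∑ i, (fun ω => W i ω ^ 2) := by
    ext ω; rw [← hsum, Finset.sum_apply]
  rw [h1, IndepFun.variance_sum (fun i _ => memLp_sq (hW i)), ← hvar, Finset.mul_sum]
  · exact Finset.sum_congr rfl fun i _ => variance_sq (hW i) (hW0 i)
  · intro i _ j _ hij
    exact (hind.indepFun hij).comp (φ := fun x : ℝ => x ^ 2) (ψ := fun x : ℝ => x ^ 2)
      (by fun_prop) (by fun_prop)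

lemma integral_sum_sq (hY : HasGaussianLaw (fun ω i => Y i ω) P) (h0 : ∀ i, ∫ ω, Y i ω ∂P = 0) :
    ∫ ω, ∑ i, Y i ω ^ 2 ∂P = ∑ i, variance (Y i) P := by
  rw [integral_finsetSum _ fun i _ => (memLp_sq (hY.eval i)).integrable (by norm_num)]
  exact Finset.sum_congr rfl fun i _ =>
    (variance_of_integral_eq_zero (hY.eval i).aemeasurable (h0 i)).symm

/-- `F` dominates the Frobenius norm, hence every eigenvalue of the covariance matrix. With `|s| = 1
/ (4F)` each one-dimensional bound is applicable, and the quadratic terms add up to at most `1/8`,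
which is rounded up to `1`. -/
lemma mgf_sum_sq_le (hY : HasGaussianLaw (fun ω i => Y i ω) P) (h0 : ∀ i, ∫ ω, Y i ω ∂P = 0)
    {F : ℝ} (hF : 0 < F) (hFle : ∑ i, ∑ j, covariance (Y i) (Y j) P ^ 2 ≤ F ^ 2) {s : ℝ}
    (hs : |s| = 1 / (4 * F)) :
    Integrable (fun ω => Real.exp (s * ∑ i, Y i ω ^ 2)) P ∧
    mgf (fun ω => ∑ i, Y i ω ^ 2) P s
      ≤ Real.exp (s * ∫ ω, ∑ i, Y i ω ^ 2 ∂P + 1) := by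
  obtain ⟨W, hW, hW0, hind, hsum, hvar⟩ := exists_independent_rotation hY h0
  have h1 : (fun ω => ∑ i, Y i ω ^ 2) = ∑ i, (fun ω => W i ω ^ 2) := by
    ext ω; rw [← hsum, Finset.sum_apply]
  have hle : ∀ i, |s| * variance (W i) P ≤ 1 / 4 := by
    intro i
    have : variance (W i) P ≤ F := by
      refine abs_le_of_sq_le_sq' (le_trans ?_ hFle) hF.le |>.2
      rw [← hvar]
      exact Finset.single_le_sum (f := fun i => variance (W i) P ^ 2) (fun i _ => sq_nonneg _)
        (Finset.mem_univ i)
    rw [hs]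
    calc 1 / (4 * F) * variance (W i) P ≤ 1 / (4 * F) * F := by gcongr
      _ = 1 / 4 := by field_simp
  have hmgf := fun i => mgf_sq_le (hW i) (hW0 i) (hle i)
  have hind' : iIndepFun (fun i ω => W i ω ^ 2) P :=
    hind.comp (fun _ x => x ^ 2) (fun _ => by fun_prop)
  have hprod := hind'.mgf_sum₀ (t := s) (fun i => ((hW i).aemeasurable.pow_const 2)) Finset.univ
  have hint : ∫ ω, ∑ i, Y i ω ^ 2 ∂P = ∑ i, variance (W i) P := by
    simp_rw [← hsum]
    rw [integral_finsetSum _ fun i _ => (memLp_sq (hW i)).integrable (by norm_num)]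
    exact Finset.sum_congr rfl fun i _ =>
      (variance_of_integral_eq_zero (hW i).aemeasurable (hW0 i)).symm
  rw [hint, h1]
  constructor
  -- Without integrability the moment generating function would take the default value `0`, but it
  -- is a product of positive factors.
  · by_contra hcon
    have : mgf (∑ i, fun ω => W i ω ^ 2) P s = 0 := by
      rw [mgf, integral_undef]
      convert hcon using 2
      ext ω
      rw [← hsum, Finset.sum_apply]
    rw [hprod] at this
    exact (Finset.prod_pos fun i _ => (hmgf i).1).ne' this
  · rw [hprod]
    calc _ ≤ ∏ i, Real.exp (s * variance (W i) P + 2 * s ^ 2 * variance (W i) P ^ 2) :=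
          Finset.prod_le_prod (fun i _ => (hmgf i).1.le) fun i _ => (hmgf i).2
      _ = Real.exp (s * ∑ i, variance (W i) P + 2 * s ^ 2 * ∑ i, variance (W i) P ^ 2) := by
          rw [← Real.exp_sum, Finset.sum_add_distrib, Finset.mul_sum, Finset.mul_sum]
      _ ≤ _ := by
          apply Real.exp_le_exp.2
          gcongr
          rw [hvar, ← sq_abs s, hs]
          calc 2 * (1 / (4 * F)) ^ 2 * ∑ i, ∑ j, covariance (Y i) (Y j) P ^ 2
              ≤ 2 * (1 / (4 * F)) ^ 2 * F ^ 2 := by gcongr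
            _ = 1 / 8 := by field_simp; norm_num
            _ ≤ 1 := by norm_num

/-- Exponential concentration of a quadratic form in Gaussian variables. -/
lemma measure_abs_sum_sq_sub_integral_ge_le (hY : HasGaussianLaw (fun ω i => Y i ω) P)
    (h0 : ∀ i, ∫ ω, Y i ω ∂P = 0) {F : ℝ} (hF : 0 < F)
    (hFle : ∑ i, ∑ j, covariance (Y i) (Y j) P ^ 2 ≤ F ^ 2) (t : ℝ) :
    P.real {ω | t ≤ |∑ i, Y i ω ^ 2 - ∫ ω, ∑ i, Y i ω ^ 2 ∂P|}
      ≤ 2 * Real.exp (1 - t / (4 * F)) := by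
  set S : Ω → ℝ := fun ω => ∑ i, Y i ω ^ 2
  set m := ∫ ω, S ω ∂P
  obtain ⟨hi1, hm1⟩ := mgf_sum_sq_le hY h0 hF hFle (s := 1 / (4 * F)) (abs_of_pos (by positivity))
  obtain ⟨hi2, hm2⟩ := mgf_sum_sq_le hY h0 hF hFle (s := -(1 / (4 * F)))
    (by rw [abs_neg]; exact abs_of_pos (by positivity))
  have hu := measure_ge_le_exp_mul_mgf (μ := P) (X := S) (m + t) (by positivity) hi1
  have hl := measure_le_le_exp_mul_mgf (μ := P) (X := S) (m - t) (by simp; positivity) hi2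
  have hsub : {ω | t ≤ |S ω - m|} ⊆ {ω | m + t ≤ S ω} ∪ {ω | S ω ≤ m - t} := by
    intro ω hω
    rcases le_abs.1 (show t ≤ |S ω - m| from hω) with h | h
    · left; show m + t ≤ S ω; linarith
    · right; show S ω ≤ m - t; linarith
  calc P.real {ω | t ≤ |S ω - m|} ≤ P.real {ω | m + t ≤ S ω} + P.real {ω | S ω ≤ m - t} :=
        (measureReal_mono hsub).trans (measureReal_union_le _ _)
    _ ≤ Real.exp (-(1 / (4 * F)) * (m + t)) * Real.exp (1 / (4 * F) * m + 1)
        + Real.exp (-(-(1 / (4 * F))) * (m - t)) * Real.exp (-(1 / (4 * F)) * m + 1) :=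
        add_le_add (hu.trans (by gcongr)) (hl.trans (by gcongr))
    _ = _ := by
        rw [← Real.exp_add, ← Real.exp_add, two_mul]
        congr 2 <;> ring

end

/-! ### Almost sure convergence from stretched exponential tails -/

lemma summable_exp_neg_mul_rpow {a δ : ℝ} (ha : 0 < a) (hδ : 0 < δ) :
    Summable fun n : ℕ => Real.exp (1 - a * (n : ℝ) ^ δ) := by
  -- The exponent `-2 / δ` turns `n ^ δ` into the summable `n ^ (-2)`.
  have h := (isLittleO_exp_neg_mul_rpow_atTop ha (-2 / δ)).comp_tendsto
    ((tendsto_rpow_atTop hδ).comp tendsto_natCast_atTop_atTop)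
  have hs : Summable fun n : ℕ => (n : ℝ) ^ (-2 : ℝ) := Real.summable_nat_rpow.2 (by norm_num)
  have h2 : Summable fun n : ℕ => Real.exp (-a * (n : ℝ) ^ δ) := by
    refine summable_of_isBigO_nat hs (h.isBigO.congr (fun n => rfl) fun n => ?_)
    simp only [Function.comp]
    rw [← Real.rpow_mul (Nat.cast_nonneg _)]
    congr 1
    field_simp
  refine (h2.mul_left (Real.exp 1)).congr fun n => ?_
  rw [← Real.exp_add]; ring_nf

/-- At `t = ε * m n` the tails are summable in `n`, so Borel–Cantelli applies without any
independence between different `n`; countably many `ε` suffice. -/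
lemma ae_tendsto_div_one_of_exp_tail {Ω : Type*} [MeasurableSpace Ω] {P : Measure Ω}
    [IsProbabilityMeasure P] {S : ℕ → Ω → ℝ} {m : ℕ → ℝ} {c δ : ℝ} (hc : 0 < c) (hδ : 0 < δ)
    (h : ∀ᶠ n in atTop, 0 < m n ∧ ∀ t, P.real {ω | t ≤ |S n ω - m n|}
      ≤ 2 * Real.exp (1 - c * (n : ℝ) ^ δ * (t / m n))) :
    ∀ᵐ ω ∂P, Tendsto (fun n => S n ω / m n) atTop (𝓝 1) := by
  have key : ∀ ε : ℝ, 0 < ε → ∀ᵐ ω ∂P, ∀ᶠ n in atTop, |S n ω - m n| < ε * m n := by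
    intro ε hε
    have hsum : Summable fun n => P.real {ω | ε * m n ≤ |S n ω - m n|} := by
      refine summable_of_isBigO_nat (summable_exp_neg_mul_rpow (mul_pos hc hε) hδ)
        (IsBigO.of_bound 2 ?_)
      filter_upwards [h] with n ⟨hn, hb⟩
      rw [Real.norm_of_nonneg measureReal_nonneg, Real.norm_of_nonneg (Real.exp_nonneg _)]
      refine (hb _).trans (le_of_eq ?_)
      congr 2
      field_simp
    have hne : ∑' n, P {ω | ε * m n ≤ |S n ω - m n|} ≠ ⊤ := by
      have := hsum.tsum_ofReal_ne_top
      simpa [measureReal_def] using this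
    filter_upwards [ae_eventually_notMem hne] with ω hω
    filter_upwards [hω] with n hn
    simpa using hn
  have hall : ∀ᵐ ω ∂P, ∀ k : ℕ, ∀ᶠ n in atTop, |S n ω - m n| < (1 / ((k : ℝ) + 1)) * m n :=
    ae_all_iff.2 fun k => key _ (by positivity)
  filter_upwards [hall] with ω hω
  rw [Metric.tendsto_atTop']
  intro ε hε
  obtain ⟨k, hk⟩ := exists_nat_one_div_lt hε
  obtain ⟨N, hN⟩ := eventually_atTop.1 ((hω k).and h)
  refine ⟨N, fun n hn => ?_⟩
  obtain ⟨h1, h2, -⟩ := hN n hn.le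
  rw [Real.dist_eq, show S n ω / m n - 1 = (S n ω - m n) / m n by field_simp, abs_div,
    abs_of_pos h2, div_lt_iff₀ h2]
  exact h1.trans (by gcongr)

/-! ### Power sums -/

/-- Induction; the step is Bernoulli's inequality for the concave power `1 - p` at `-1 / (n + 1)`.
-/
lemma sum_rpow_neg_le {p : ℝ} (hp0 : 0 ≤ p) (hp : p < 1) (n : ℕ) :
    ∑ k ∈ Finset.range n, ((k : ℝ) + 1) ^ (-p) ≤ (n : ℝ) ^ (1 - p) / (1 - p) := by
  have h1p : 0 < 1 - p := by linarith
  induction n with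
  | zero => simp [Real.zero_rpow h1p.ne']
  | succ n ih =>
    rw [Finset.sum_range_succ]
    refine (add_le_add_left ih _).trans ?_
    rw [← sub_nonneg, ← mul_nonneg_iff_of_pos_left h1p]
    have hpos : (0 : ℝ) < n + 1 := by positivity
    have hb := rpow_one_add_le_one_add_mul_self (s := -1 / ((n : ℝ) + 1)) (p := 1 - p)
      (by rw [le_div_iff₀ hpos]; nlinarith [Nat.cast_nonneg (α := ℝ) n]) h1p.le (by linarith)
    have hn : (n : ℝ) ^ (1 - p) = ((n : ℝ) + 1) ^ (1 - p) * (1 + -1 / ((n : ℝ) + 1)) ^ (1 - p) := by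
      rw [← Real.mul_rpow hpos.le]
      · congr 1; field_simp; ring
      · rw [show 1 + -1 / ((n : ℝ) + 1) = n / (n + 1) by field_simp; ring]; positivity
    have hr : ((n : ℝ) + 1) ^ (1 - p) = (n + 1) * ((n : ℝ) + 1) ^ (-p) := by
      rw [sub_eq_add_neg, Real.rpow_add hpos, Real.rpow_one]
    have hle : (n : ℝ) ^ (1 - p) ≤ ((n : ℝ) + 1) ^ (1 - p) - (1 - p) * ((n : ℝ) + 1) ^ (-p) := by
      rw [hn]
      refine (mul_le_mul_of_nonneg_left hb (by positivity)).trans (le_of_eq ?_)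
      rw [mul_add, mul_one, hr]; field_simp; ring
    push_cast
    have : (1 - p) * (((n : ℝ) + 1) ^ (1 - p) / (1 - p) - ((n : ℝ) ^ (1 - p) / (1 - p) + ((n : ℝ) + 1) ^ (-p)))
        = ((n : ℝ) + 1) ^ (1 - p) - (n : ℝ) ^ (1 - p) - (1 - p) * ((n : ℝ) + 1) ^ (-p) := by
      field_simp
      ring
    rw [this]; linarith

lemma sum_rpow_neg_bounded {p : ℝ} (hp : 1 < p) :
    ∃ C, ∀ n : ℕ, ∑ k ∈ Finset.range n, ((k : ℝ) + 1) ^ (-p) ≤ C := by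
  have hs : Summable fun k : ℕ => ((k : ℝ) + 1) ^ (-p) := by
    have := (summable_nat_add_iff 1).2 (Real.summable_nat_rpow.2 (show -p < -1 by linarith))
    simpa using this
  exact ⟨_, fun n => hs.sum_le_tsum _ fun k _ => by positivity⟩

lemma sum_inv_le_log (n : ℕ) :
    ∑ k ∈ Finset.range n, ((k : ℝ) + 1) ^ (-1 : ℝ) ≤ 1 + Real.log n := by
  refine le_trans (le_of_eq ?_) (harmonic_le_one_add_log n)
  rw [harmonic]
  push_cast
  exact Finset.sum_congr rfl fun k _ => by rw [Real.rpow_neg_one]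

/-- With truncated subtraction `(i - j) + (j - i)` is the lag `|i - j|`, and on each side of `i`
every lag occurs at most once. -/
lemma sum_abs_sub_le {f : ℕ → ℝ} (hf : ∀ k, 0 ≤ f k) (N i : ℕ) (hi : i ∈ Finset.Icc 1 N) :
    ∑ j ∈ Finset.Icc 1 N, f ((i - j) + (j - i)) ≤ 2 * ∑ k ∈ Finset.range N, f k := by
  rw [Finset.mem_Icc] at hi
  have aux : ∀ A : Finset ℕ, A ⊆ Finset.Icc 1 N → Set.InjOn (fun j => (i - j) + (j - i)) A →
      ∑ j ∈ A, f ((i - j) + (j - i)) ≤ ∑ k ∈ Finset.range N, f k := by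
    intro A hA hinj
    rw [← Finset.sum_image (f := f) hinj]
    refine Finset.sum_le_sum_of_subset_of_nonneg (fun k hk => ?_) fun _ _ _ => hf _
    obtain ⟨j, hj, rfl⟩ := Finset.mem_image.1 hk
    have := Finset.mem_Icc.1 (hA hj)
    rw [Finset.mem_range]; omega
  rw [← Finset.sum_filter_add_sum_filter_not _ (fun j => j ≤ i), two_mul]
  refine add_le_add (aux _ (Finset.filter_subset _ _) ?_) (aux _ (Finset.filter_subset _ _) ?_)
  all_goals
    intro a ha b hb hab
    simp only [Finset.coe_filter, Set.mem_ofPred_eq] at ha hb hab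
    omega

/-! ### Regular curves with two bounded derivatives -/

/-- `c` is twice differentiable on `[0, L]` with derivatives `c₁`, `c₂` bounded by `B`, speed at least
`κ`, and chords of length at least `κ` times the parameter distance. -/
structure RegularCurve (c c₁ c₂ : ℝ → Plane) (L κ B : ℝ) : Prop where
  pos : 0 < κ
  hasDeriv : ∀ u ∈ Set.Icc 0 L, HasDerivAt c (c₁ u) u
  hasDeriv₁ : ∀ u ∈ Set.Icc 0 L, HasDerivAt c₁ (c₂ u) u
  le_speed : ∀ u ∈ Set.Icc 0 L, κ ≤ ‖c₁ u‖
  speed_le : ∀ u ∈ Set.Icc 0 L, ‖c₁ u‖ ≤ B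
  norm_le : ∀ u ∈ Set.Icc 0 L, ‖c₂ u‖ ≤ B
  chord : ∀ u ∈ Set.Icc 0 L, ∀ w ∈ Set.Icc 0 L, κ * |u - w| ≤ ‖c u - c w‖

lemma norm_sub_le_of_deriv_le {E : Type*} [NormedAddCommGroup E] [NormedSpace ℝ E] {g g₁ : ℝ → E}
    {S : Set ℝ} (hS : Convex ℝ S) (hg : ∀ u ∈ S, HasDerivAt g (g₁ u) u) {M : ℝ}
    (hM : ∀ u ∈ S, ‖g₁ u‖ ≤ M) {u w : ℝ} (hu : u ∈ S) (hw : w ∈ S) :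
    ‖g w - g u‖ ≤ M * |w - u| :=
  hS.norm_image_sub_le_of_norm_hasDerivWithin_le (fun x hx => (hg x hx).hasDerivWithinAt) hM hu hw

/-- The mean value inequality for `g t - (t - u) • g₁ u`, whose derivative is at most `M * |w - u|`
between `u` and `w`. No continuity of `g₂` is needed, at the price of the constant `M` in place of
`M / 2`. -/
lemma norm_taylor_le {E : Type*} [NormedAddCommGroup E] [NormedSpace ℝ E] {g g₁ g₂ : ℝ → E}
    {S : Set ℝ} (hS : Convex ℝ S) (hg : ∀ u ∈ S, HasDerivAt g (g₁ u) u)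
    (hg₁ : ∀ u ∈ S, HasDerivAt g₁ (g₂ u) u) {M : ℝ}
    (hM : ∀ u ∈ S, ‖g₂ u‖ ≤ M) {u w : ℝ} (hu : u ∈ S) (hw : w ∈ S) :
    ‖g w - g u - (w - u) • g₁ u‖ ≤ M * (w - u) ^ 2 := by
  have hM0 : 0 ≤ M := (norm_nonneg _).trans (hM u hu)
  have hsub : Set.uIcc u w ⊆ S := by
    rw [← segment_eq_uIcc]; exact hS.segment_subset hu hw
  have h := norm_sub_le_of_deriv_le (g := fun t => g t - (t - u) • g₁ u)
    (g₁ := fun t => g₁ t - g₁ u) (M := M * |w - u|) (convex_uIcc u w) (fun t ht => by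
      have := (hg t (hsub ht)).sub (((hasDerivAt_id t).sub_const u).smul_const (g₁ u))
      exact this.congr_deriv (by simp)) (fun t ht => by
      refine (norm_sub_le_of_deriv_le hS hg₁ hM hu (hsub ht)).trans ?_
      exact mul_le_mul_of_nonneg_left (Set.abs_sub_left_of_mem_uIcc ht) hM0) Set.left_mem_uIcc Set.right_mem_uIcc
  have e : g w - (w - u) • g₁ u - (g u - (u - u) • g₁ u) = g w - g u - (w - u) • g₁ u := by
    simp; abel
  rw [e] at h
  refine h.trans (le_of_eq ?_)
  rw [mul_assoc, abs_mul_abs_self, sq]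

namespace RegularCurve

variable {c c₁ c₂ : ℝ → Plane} {L κ B : ℝ}

lemma abs_dist_sub_le (h : RegularCurve c c₁ c₂ L κ B) {u w : ℝ} (hu : u ∈ Set.Icc 0 L)
    (hw : w ∈ Set.Icc 0 L) : |‖c u - c w‖ - |w - u| * ‖c₁ u‖| ≤ B * (w - u) ^ 2 := by
  have := norm_taylor_le (convex_Icc 0 L) h.hasDeriv h.hasDeriv₁ h.norm_le hu hw
  refine le_trans ?_ this
  rw [norm_sub_rev, ← Real.norm_eq_abs (w - u), ← norm_smul]
  exact abs_norm_sub_norm_le _ _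

lemma dist_le (h : RegularCurve c c₁ c₂ L κ B) {u w : ℝ} (hu : u ∈ Set.Icc 0 L)
    (hw : w ∈ Set.Icc 0 L) : ‖c u - c w‖ ≤ B * |u - w| :=
  norm_sub_le_of_deriv_le (convex_Icc 0 L) h.hasDeriv h.speed_le hw hu

lemma abs_speed_sub_le (h : RegularCurve c c₁ c₂ L κ B) {u w : ℝ} (hu : u ∈ Set.Icc 0 L)
    (hw : w ∈ Set.Icc 0 L) : |‖c₁ w‖ - ‖c₁ u‖| ≤ B * |w - u| :=
  (abs_norm_sub_norm_le _ _).trans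
    (norm_sub_le_of_deriv_le (convex_Icc 0 L) h.hasDeriv₁ h.norm_le hu hw)

end RegularCurve

/-! ### Weights of the divided differences -/

/-- The distance of the base point of a window of spacing `δ` to its `k`-th node. -/
def nodeDist (c : ℝ → Plane) (u δ : ℝ) (k : ℕ) : ℝ := ‖c u - c (u + k * δ)‖

/-- The weights of the divided difference of order `ℓ` with respect to the distance to the base
point. -/
def nodeWeight (c : ℝ → Plane) (ℓ : ℕ) (u δ : ℝ) (k : ℕ) : ℝ :=
  (ℓ : ℝ) / ∏ j ∈ (Finset.range (ℓ + 1)).erase k, (nodeDist c u δ k - nodeDist c u δ j)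

lemma nodeDist_zero (c : ℝ → Plane) (u δ : ℝ) : nodeDist c u δ 0 = 0 := by simp [nodeDist]

lemma nodeWeight_one (c : ℝ → Plane) (u δ : ℝ) :
    nodeWeight c 1 u δ 0 = -1 / nodeDist c u δ 1 ∧ nodeWeight c 1 u δ 1 = 1 / nodeDist c u δ 1 := by
  have e0 : (Finset.range 2).erase 0 = {1} := by decide
  have e1 : (Finset.range 2).erase 1 = {0} := by decide
  constructor
  · simp [nodeWeight, e0, nodeDist_zero, inv_neg, neg_div]
  · simp [nodeWeight, e1, nodeDist_zero]

lemma nodeWeight_two (c : ℝ → Plane) (u δ : ℝ) :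
    nodeWeight c 2 u δ 0 = 2 / (nodeDist c u δ 1 * nodeDist c u δ 2) ∧
    nodeWeight c 2 u δ 1 = -2 / (nodeDist c u δ 1 * (nodeDist c u δ 2 - nodeDist c u δ 1)) ∧
    nodeWeight c 2 u δ 2 = 2 / (nodeDist c u δ 2 * (nodeDist c u δ 2 - nodeDist c u δ 1)) := by
  have e0 : (Finset.range 3).erase 0 = {1, 2} := by decide
  have e1 : (Finset.range 3).erase 1 = {0, 2} := by decide
  have e2 : (Finset.range 3).erase 2 = {0, 1} := by decide
  refine ⟨?_, ?_, ?_⟩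
  · simp [nodeWeight, e0, nodeDist_zero]
  · simp [nodeWeight, e1, nodeDist_zero]
    rw [← neg_sub (nodeDist c u δ 2), mul_neg, div_neg, neg_div]
  · simp [nodeWeight, e2, nodeDist_zero]

/-- An admissible window: spacing `δ` small against the curvature of the curve, and all nodes in
`[0, L]`. -/
structure Window (L κ B : ℝ) (ℓ : ℕ) (u δ : ℝ) : Prop where
  pos : 0 < δ
  small : 10 * B * δ ≤ κ
  nonneg : 0 ≤ u
  le : u + ℓ * δ ≤ L

lemma Window.mem {L κ B : ℝ} {ℓ : ℕ} {u δ : ℝ} (hw : Window L κ B ℓ u δ) {t : ℝ} (h0 : 0 ≤ t)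
    (ht : t ≤ ℓ) : u + t * δ ∈ Set.Icc 0 L :=
  ⟨add_nonneg hw.nonneg (mul_nonneg h0 hw.pos.le),
    (add_le_add_right (mul_le_mul_of_nonneg_right ht hw.pos.le) u).trans hw.le⟩

namespace RegularCurve

variable {c c₁ c₂ : ℝ → Plane} {L κ B : ℝ} {u δ : ℝ} {ℓ : ℕ}

lemma nonneg (h : RegularCurve c c₁ c₂ L κ B) (hw : Window L κ B ℓ u δ) : 0 ≤ B := by
  have := hw.mem (t := 0) le_rfl (Nat.cast_nonneg _)
  exact (norm_nonneg _).trans (h.norm_le _ this)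

lemma le_nodeDist (h : RegularCurve c c₁ c₂ L κ B) (hw : Window L κ B ℓ u δ) {k : ℕ} (hk : k ≤ ℓ) :
    k * (κ * δ) ≤ nodeDist c u δ k := by
  have h0 := hw.mem (t := 0) le_rfl (Nat.cast_nonneg _)
  have hk' := hw.mem (t := k) (Nat.cast_nonneg _) (by exact_mod_cast hk)
  rw [zero_mul, add_zero] at h0
  have := h.chord _ h0 _ hk'
  rw [show u - (u + k * δ) = -(k * δ) by ring, abs_neg,
    abs_of_nonneg (mul_nonneg (Nat.cast_nonneg _) hw.pos.le)] at this
  exact le_trans (le_of_eq (by ring)) this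

lemma nodeDist_approx (h : RegularCurve c c₁ c₂ L κ B) (hw : Window L κ B ℓ u δ) {k : ℕ}
    (hk : k ≤ ℓ) : |nodeDist c u δ k - k * δ * ‖c₁ u‖| ≤ B * (k * δ) ^ 2 := by
  have h0 := hw.mem (t := 0) le_rfl (Nat.cast_nonneg _)
  have hk' := hw.mem (t := k) (Nat.cast_nonneg _) (by exact_mod_cast hk)
  rw [zero_mul, add_zero] at h0
  have := h.abs_dist_sub_le h0 hk'
  rwa [add_sub_cancel_left, abs_of_nonneg (mul_nonneg (Nat.cast_nonneg _) hw.pos.le)] at this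

/-- Everything follows from `d_k = kδ‖c₁ u‖ + O(B (kδ)²)`. The gap between the two distances loses
at most `5Bδ² ≤ κδ / 2`, which is where the factor `10` in `Window.small` comes from. In `d₂ - 2d₁`
the speed cancels and `4Bδ² + 2Bδ²` remains. -/
lemma nodeDist_two_sub (h : RegularCurve c c₁ c₂ L κ B) (hw : Window L κ B 2 u δ) :
    κ * δ ≤ nodeDist c u δ 1 ∧ 2 * (κ * δ) ≤ nodeDist c u δ 2 ∧
    κ * δ / 2 ≤ nodeDist c u δ 2 - nodeDist c u δ 1 ∧
    |nodeDist c u δ 2 - 2 * nodeDist c u δ 1| ≤ 6 * B * δ ^ 2 := by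
  have h1 := h.nodeDist_approx hw (k := 1) (by norm_num)
  have h2 := h.nodeDist_approx hw (k := 2) (by norm_num)
  have l1 := h.le_nodeDist hw (k := 1) (by norm_num)
  have l2 := h.le_nodeDist hw (k := 2) (by norm_num)
  have h0 := hw.mem (t := 0) le_rfl (by norm_num)
  rw [zero_mul, add_zero] at h0
  have hsp := h.le_speed u h0
  push_cast at h1 h2 l1 l2
  rw [abs_le] at h1 h2
  have hδ := hw.pos
  have hs := mul_le_mul_of_nonneg_right hw.small hδ.le
  have hsp' := mul_le_mul_of_nonneg_right hsp hδ.le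
  refine ⟨by linarith, l2, ?_, abs_le.2 ⟨?_, ?_⟩⟩
  · nlinarith [h1.1, h1.2, h2.1, h2.2]
  · nlinarith [h1.1, h1.2, h2.1, h2.2]
  · nlinarith [h1.1, h1.2, h2.1, h2.2]

/-- Divided differences annihilate constants. This centres the generalized differences and removes
`β 0` from their variances. -/
lemma sum_nodeWeight (h : RegularCurve c c₁ c₂ L κ B) (hℓ : ℓ = 1 ∨ ℓ = 2)
    (hw : Window L κ B ℓ u δ) : ∑ k ∈ Finset.range (ℓ + 1), nodeWeight c ℓ u δ k = 0 := by
  have hκδ := mul_pos h.pos hw.pos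
  rcases hℓ with rfl | rfl
  · simp only [Finset.sum_range_succ, Finset.sum_range_zero, zero_add, nodeWeight_one]
    ring
  · obtain ⟨l1, l2, l3, -⟩ := h.nodeDist_two_sub hw
    simp only [Finset.sum_range_succ, Finset.sum_range_zero, zero_add, nodeWeight_two]
    have e1 : nodeDist c u δ 1 ≠ 0 := by linarith
    have e2 : nodeDist c u δ 2 ≠ 0 := by linarith
    have e3 : nodeDist c u δ 2 - nodeDist c u δ 1 ≠ 0 := by linarith
    field_simp
    ring

lemma abs_nodeWeight_le (h : RegularCurve c c₁ c₂ L κ B) (hℓ : ℓ = 1 ∨ ℓ = 2)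
    (hw : Window L κ B ℓ u δ) {k : ℕ} (hk : k ≤ ℓ) :
    |nodeWeight c ℓ u δ k| ≤ 4 / (κ * δ) ^ ℓ := by
  have hκδ := mul_pos h.pos hw.pos
  rcases hℓ with rfl | rfl
  · have l1 := h.le_nodeDist hw (k := 1) le_rfl
    rw [Nat.cast_one, one_mul] at l1
    have l0 : 0 < nodeDist c u δ 1 := hκδ.trans_le l1
    have key : 1 / nodeDist c u δ 1 ≤ 4 / (κ * δ) ^ 1 := by
      rw [pow_one]; gcongr; norm_num
    interval_cases k
    · rw [(nodeWeight_one c u δ).1, neg_div, abs_neg, abs_of_pos (by positivity)]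
      exact key
    · rw [(nodeWeight_one c u δ).2, abs_of_pos (by positivity)]
      exact key
  · obtain ⟨l1, l2, l3, -⟩ := h.nodeDist_two_sub hw
    -- The least favourable denominator is `κδ * (κδ / 2)`, whence the constant `4`.
    have hb : ∀ p q : ℝ, κ * δ ≤ p → κ * δ / 2 ≤ q → |2 / (p * q)| ≤ 4 / (κ * δ) ^ 2 := by
      intro p q hp hq
      have hp0 : 0 < p := by linarith
      have hq0 : 0 < q := by linarith
      rw [abs_of_pos (by positivity)]
      calc 2 / (p * q) ≤ 2 / ((κ * δ) * (κ * δ / 2)) := by gcongr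
        _ = _ := by field_simp; norm_num
    interval_cases k
    · rw [(nodeWeight_two c u δ).1]
      exact hb _ _ l1 (by linarith)
    · rw [(nodeWeight_two c u δ).2.1, neg_div, abs_neg]
      exact hb _ _ l1 l3
    · rw [(nodeWeight_two c u δ).2.2]
      exact hb _ _ (by linarith) l3

/-- The divided difference of order `ℓ` is bounded by the derivatives of order `1` to `ℓ`. -/
lemma norm_sum_nodeWeight_smul_le (h : RegularCurve c c₁ c₂ L κ B) (hℓ : ℓ = 1 ∨ ℓ = 2)
    (hw : Window L κ B ℓ u δ) {E : Type*} [NormedAddCommGroup E] [NormedSpace ℝ E]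
    {g g₁ g₂ : ℝ → E} {M : ℝ} (hg : ∀ t ∈ Set.Icc u (u + ℓ * δ), HasDerivAt g (g₁ t) t)
    (hM : ∀ t ∈ Set.Icc u (u + ℓ * δ), ‖g₁ t‖ ≤ M)
    (hg₁ : ℓ = 2 → ∀ t ∈ Set.Icc u (u + ℓ * δ), HasDerivAt g₁ (g₂ t) t)
    (hM₂ : ℓ = 2 → ∀ t ∈ Set.Icc u (u + ℓ * δ), ‖g₂ t‖ ≤ M) :
    ‖∑ k ∈ Finset.range (ℓ + 1), nodeWeight c ℓ u δ k • g (u + k * δ)‖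
      ≤ (4 / κ + 20 / κ ^ 2 + 12 * B / κ ^ 3) * M := by
  have hκ := h.pos
  have hδ := hw.pos
  have hB := h.nonneg hw
  have hκδ := mul_pos h.pos hw.pos
  have hℓ0 : (0 : ℝ) ≤ ℓ := Nat.cast_nonneg _
  have hu : u ∈ Set.Icc u (u + ℓ * δ) := ⟨le_rfl, by nlinarith⟩
  have hM0 : 0 ≤ M := (norm_nonneg _).trans (hM u hu)
  have hsum := h.sum_nodeWeight hℓ hw
  have hwt := fun k (hk : k ≤ ℓ) => h.abs_nodeWeight_le hℓ hw hk
  have hsub : ∑ k ∈ Finset.range (ℓ + 1), nodeWeight c ℓ u δ k • g (u + k * δ)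
      = ∑ k ∈ Finset.range (ℓ + 1), nodeWeight c ℓ u δ k • (g (u + k * δ) - g u) := by
    simp only [smul_sub, Finset.sum_sub_distrib, ← Finset.sum_smul, hsum, zero_smul, sub_zero]
  rw [hsub]
  rcases hℓ with rfl | rfl
  · have hmem : u + 1 * δ ∈ Set.Icc u (u + (1 : ℕ) * δ) := ⟨by linarith, by simp⟩
    have h1 := norm_sub_le_of_deriv_le (convex_Icc _ _) hg hM hu hmem
    rw [one_mul, add_sub_cancel_left, abs_of_pos hδ] at h1
    simp only [Finset.sum_range_succ, Finset.sum_range_zero, zero_add, Nat.cast_zero, zero_mul,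
      add_zero, sub_self, smul_zero, Nat.cast_one, one_mul]
    rw [norm_smul, Real.norm_eq_abs]
    have h2 := hwt 1 le_rfl
    rw [pow_one] at h2
    calc _ ≤ 4 / (κ * δ) * (M * δ) := by gcongr
      _ = 4 / κ * M := by field_simp
      _ ≤ _ := by
        gcongr
        have : 0 ≤ 20 / κ ^ 2 + 12 * B / κ ^ 3 := by positivity
        linarith
  · have hmem : ∀ k : ℕ, k ≤ 2 → u + k * δ ∈ Set.Icc u (u + (2 : ℕ) * δ) := fun k hk =>
      ⟨by nlinarith [Nat.cast_nonneg (α := ℝ) k], by gcongr⟩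
    obtain ⟨l1, l2, l3, l4⟩ := h.nodeDist_two_sub hw
    have t1 := norm_taylor_le (convex_Icc _ _) hg (hg₁ rfl) (hM₂ rfl) hu (hmem 1 (by norm_num))
    have t2 := norm_taylor_le (convex_Icc _ _) hg (hg₁ rfl) (hM₂ rfl) hu (hmem 2 le_rfl)
    have hw1 := hwt 1 (by norm_num)
    have hw2 := hwt 2 le_rfl
    -- The weights are adapted to chord length, so they do not annihilate linear functions of the
    -- parameter. The defect is proportional to `d₂ - 2d₁ = O(δ²)`, and its contribution is
    -- therefore bounded.
    have hlin : |nodeWeight c 2 u δ 1 + 2 * nodeWeight c 2 u δ 2| * δ ≤ 12 * B / κ ^ 3 := by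
      have e1 : 0 < nodeDist c u δ 1 := by linarith
      have e2 : 0 < nodeDist c u δ 2 := by linarith
      have e3 : 0 < nodeDist c u δ 2 - nodeDist c u δ 1 := by linarith
      have : nodeWeight c 2 u δ 1 + 2 * nodeWeight c 2 u δ 2
          = -(2 * (nodeDist c u δ 2 - 2 * nodeDist c u δ 1))
            / (nodeDist c u δ 1 * nodeDist c u δ 2 * (nodeDist c u δ 2 - nodeDist c u δ 1)) := by
        rw [(nodeWeight_two c u δ).2.1, (nodeWeight_two c u δ).2.2]
        field_simp
        ring
      rw [this, abs_div, abs_neg, abs_mul, abs_two, abs_of_pos (mul_pos (mul_pos e1 e2) e3)]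
      calc _ ≤ 2 * (6 * B * δ ^ 2) / (κ * δ * (2 * (κ * δ)) * (κ * δ / 2)) * δ := by gcongr
        _ = _ := by field_simp; ring
    push_cast at t1 t2
    simp only [add_sub_cancel_left, one_mul] at t1 t2
    simp only [Finset.sum_range_succ, Finset.sum_range_zero, zero_add, Nat.cast_zero, zero_mul,
      add_zero, sub_self, smul_zero, Nat.cast_one, one_mul, Nat.cast_ofNat]
    -- Linear part, controlled by `hlin`, plus Taylor remainders of size `δ²` against weights of
    -- size `δ ^ (-2)`.
    have e : nodeWeight c 2 u δ 1 • (g (u + δ) - g u) + nodeWeight c 2 u δ 2 • (g (u + 2 * δ) - g u)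
        = ((nodeWeight c 2 u δ 1 + 2 * nodeWeight c 2 u δ 2) * δ) • g₁ u
          + (nodeWeight c 2 u δ 1 • (g (u + δ) - g u - δ • g₁ u)
          + nodeWeight c 2 u δ 2 • (g (u + 2 * δ) - g u - (2 * δ) • g₁ u)) := by
      module
    rw [e]
    have n1 : ‖((nodeWeight c 2 u δ 1 + 2 * nodeWeight c 2 u δ 2) * δ) • g₁ u‖
        ≤ 12 * B / κ ^ 3 * M := by
      rw [norm_smul, Real.norm_eq_abs, abs_mul, abs_of_pos hδ]
      exact mul_le_mul hlin (hM u hu) (norm_nonneg _) (by positivity)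
    have n2 : ‖nodeWeight c 2 u δ 1 • (g (u + δ) - g u - δ • g₁ u)‖ ≤ 4 / κ ^ 2 * M := by
      rw [norm_smul, Real.norm_eq_abs]
      calc _ ≤ 4 / (κ * δ) ^ 2 * (M * δ ^ 2) := by gcongr
        _ = _ := by field_simp
    have n3 : ‖nodeWeight c 2 u δ 2 • (g (u + 2 * δ) - g u - (2 * δ) • g₁ u)‖ ≤ 16 / κ ^ 2 * M := by
      rw [norm_smul, Real.norm_eq_abs]
      calc _ ≤ 4 / (κ * δ) ^ 2 * (M * (2 * δ) ^ 2) := by gcongr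
        _ = _ := by field_simp; ring
    calc _ ≤ 12 * B / κ ^ 3 * M + (4 / κ ^ 2 * M + 16 / κ ^ 2 * M) :=
          (norm_add_le _ _).trans (add_le_add n1 ((norm_add_le _ _).trans (add_le_add n2 n3)))
      _ = (20 / κ ^ 2 + 12 * B / κ ^ 3) * M := by ring
      _ ≤ _ := by
        gcongr
        have : 0 ≤ 4 / κ := by positivity
        linarith

end RegularCurve

/-! ### The principal irregular function -/

open Classical in
/-- The coefficient of the logarithm in the scaling law of `G ν`. -/
def logCoeff (ν : ℝ) : ℝ := if ∃ m : ℤ, ν = m then 1 else 0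

lemma logCoeff_eq_zero_or {ν : ℝ} (h0 : 0 < ν) (h2 : ν < 2) : logCoeff ν = 0 ∨ ν = 1 := by
  by_cases h : ∃ m : ℤ, ν = m
  · obtain ⟨m, rfl⟩ := h
    right
    have h0' : 0 < m := by exact_mod_cast h0
    have h2' : m < 2 := by exact_mod_cast h2
    have : m = 1 := by omega
    simp [this]
  · left; simp only [logCoeff, h, if_false]

lemma logCoeff_mul_nonneg (ν : ℝ) : 0 ≤ logCoeff ν ∧ logCoeff ν ≤ 1 := by
  unfold logCoeff; split_ifs <;> norm_num

lemma G_zero (ν : ℝ) : G ν 0 = 0 := by simp [G]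

/-- For integer `ν` homogeneity fails by the term coming from `log (x * y) = log x + log y`;
`logCoeff` treats both cases in one formula. -/
lemma G_mul (ν : ℝ) {x y : ℝ} (hx : 0 < x) (hy : 0 < y) :
    G ν (x * y) = x ^ (2 * ν) * (G ν y + logCoeff ν * Real.log x * y ^ (2 * ν)) := by
  rw [G, G, logCoeff, if_neg (mul_pos hx hy).ne', if_neg hy.ne']
  split_ifs with h
  · rw [Real.mul_rpow hx.le hy.le, Real.log_mul hx.ne' hy.ne']; ring
  · rw [Real.mul_rpow hx.le hy.le]; ring

lemma continuousAt_G (ν : ℝ) {y : ℝ} (hy : 0 < y) : ContinuousAt (G ν) y := by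
  have hne : ∀ᶠ s in 𝓝 y, s ≠ 0 := eventually_ne_nhds hy.ne'
  by_cases h : ∃ m : ℤ, ν = m
  · have : ContinuousAt (fun s : ℝ => s ^ (2 * ν) * Real.log s) y :=
      (Real.continuousAt_rpow_const _ _ (Or.inl hy.ne')).mul (Real.continuousAt_log hy.ne')
    refine this.congr ?_
    filter_upwards [hne] with s hs
    rw [G, if_neg hs, if_pos h]
  · have : ContinuousAt (fun s : ℝ => s ^ (2 * ν)) y :=
      Real.continuousAt_rpow_const _ _ (Or.inl hy.ne')
    refine this.congr ?_
    filter_upwards [hne] with s hs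
    rw [G, if_neg hs, if_neg h]

lemma G_one_eq {ν : ℝ} (h0 : 0 < ν) (h1 : ν < 1) (s : ℝ) (hs : 0 < s) : G ν s = s ^ (2 * ν) := by
  rw [G, if_neg hs.ne', if_neg]
  rintro ⟨m, rfl⟩
  have h0' : 0 < m := by exact_mod_cast h0
  have h1' : m < 1 := by exact_mod_cast h1
  omega

/-- Nondegeneracy of the limit constant of second differences. For integer `ν` one has `G ν 1 = 0`
and only the term with `log 2` survives; otherwise `2 ^ (2ν) = 4` would force `ν = 1`. -/
lemma G_two_sub_ne_zero {ν : ℝ} : G ν 2 - 4 * G ν 1 ≠ 0 := by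
  by_cases h : ∃ m : ℤ, ν = m
  · have : G ν 2 - 4 * G ν 1 = 2 ^ (2 * ν) * Real.log 2 := by
      simp [G, h]
    rw [this]
    have := Real.log_pos one_lt_two
    positivity
  · have : G ν 2 - 4 * G ν 1 = 2 ^ (2 * ν) - 4 := by
      simp [G, h]
    rw [this, sub_ne_zero, show (4 : ℝ) = 2 ^ (2 : ℝ) by norm_num]
    intro h2
    rw [Real.rpow_right_inj two_pos (by norm_num)] at h2
    exact h ⟨1, by push_cast; linarith⟩

/-- The contribution of the principal irregular function to the variance of a divided difference. -/
def irregularSum (c : ℝ → Plane) (ν : ℝ) (ℓ : ℕ) (u δ : ℝ) : ℝ :=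
  ∑ k₂ ∈ Finset.range (ℓ + 1), ∑ k₁ ∈ Finset.range k₂,
    nodeWeight c ℓ u δ k₁ * nodeWeight c ℓ u δ k₂ * G ν ‖c (u + k₁ * δ) - c (u + k₂ * δ)‖

/-- The contribution of a function with values `g₁, gz, gy` at `1, z, y` to the normalised second
order divided difference with nodes `0, 1, z`. -/
def secondDiffForm (g₁ gz gy z : ℝ) : ℝ :=
  -4 / (z * (z - 1)) * g₁ + 4 / (z ^ 2 * (z - 1)) * gz - 4 / (z * (z - 1) ^ 2) * gy

/-- Up to a denominator bounded below, the form of the squared distance is `4((z - 1)² - y²)`, which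
vanishes when the three nodes are in line. This smallness is what beats the unbounded `log x` that
multiplies it when `ν = 1`. -/
lemma abs_secondDiffForm_sq_le {y z : ℝ} (hy : |y - 1| ≤ 1 / 2) (hz : |z - 2| ≤ 1 / 2) :
    |secondDiffForm 1 (z ^ 2) (y ^ 2) z| ≤ 32 * (|z - 2| + |y - 1|) := by
  obtain ⟨y1, y2⟩ := abs_le.1 hy
  obtain ⟨z1, z2⟩ := abs_le.1 hz
  have hz0 : 0 < z := by linarith
  have hz1 : 0 < z - 1 := by linarith
  have e : secondDiffForm 1 (z ^ 2) (y ^ 2) z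
      = 4 * ((z - 2) - (y - 1)) * (z - 1 + y) / (z * (z - 1) ^ 2) := by
    unfold secondDiffForm; field_simp; ring
  rw [e, abs_div, abs_mul, abs_mul, abs_of_pos (show (0 : ℝ) < 4 by norm_num),
    abs_of_pos (show 0 < z - 1 + y by linarith),
    abs_of_pos (show 0 < z * (z - 1) ^ 2 by positivity)]
  have hden : 3 / 8 ≤ z * (z - 1) ^ 2 := by
    calc (3 / 8 : ℝ) = 3 / 2 * (1 / 2) ^ 2 := by norm_num
      _ ≤ z * (z - 1) ^ 2 := by gcongr <;> linarith
  calc _ ≤ 4 * (|z - 2| + |y - 1|) * 3 / (3 / 8) := by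
        gcongr
        · linarith
        · exact abs_sub _ _
        · linarith
    _ = _ := by ring

namespace RegularCurve

variable {c c₁ c₂ : ℝ → Plane} {L κ B : ℝ} {u δ : ℝ} {ℓ : ℕ}

lemma irregularSum_one (c : ℝ → Plane) {ν : ℝ} (h0 : 0 < ν) (h1 : ν < 1)
    (hx : 0 < nodeDist c u δ 1) :
    irregularSum c ν 1 u δ = -1 * nodeDist c u δ 1 ^ (2 * ν - 2) := by
  have hd : ‖c u - c (u + δ)‖ = nodeDist c u δ 1 := by simp [nodeDist]
  simp only [irregularSum, Finset.sum_range_succ, Finset.sum_range_zero, zero_add, nodeWeight_one,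
    Nat.cast_zero, zero_mul, add_zero, Nat.cast_one, one_mul, hd, G_one_eq h0 h1 _ hx]
  rw [Real.rpow_sub hx, Real.rpow_two]
  field_simp

/-- Rescaling by the first node distance `x` leaves the nodes `0, 1, z`, with `y` the rescaled
distance between the last two. All dependence on `x` is then a power and, for integer `ν`, a
logarithm. -/
lemma irregularSum_two (c : ℝ → Plane) {ν x y z : ℝ} (hx : 0 < x) (hy : 0 < y) (hz : 1 < z)
    (h1 : nodeDist c u δ 1 = x) (h2 : nodeDist c u δ 2 = x * z)
    (h3 : ‖c (u + δ) - c (u + 2 * δ)‖ = x * y) :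
    irregularSum c ν 2 u δ = (secondDiffForm (G ν 1) (G ν z) (G ν y) z + logCoeff ν * Real.log x *
      secondDiffForm 1 (z ^ (2 * ν)) (y ^ (2 * ν)) z) * x ^ (2 * ν - 4) := by
  have hd1 : ‖c u - c (u + δ)‖ = x * 1 := by rw [mul_one, ← h1]; simp [nodeDist]
  have hd2 : ‖c u - c (u + 2 * δ)‖ = x * z := by rw [← h2]; simp [nodeDist]
  simp only [irregularSum, Finset.sum_range_succ, Finset.sum_range_zero, zero_add, nodeWeight_two,
    Nat.cast_zero, zero_mul, add_zero, Nat.cast_one, one_mul, Nat.cast_ofNat, hd1, hd2, h3, h1, h2,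
    G_mul ν hx one_pos, G_mul ν hx hy, G_mul ν hx (zero_lt_one.trans hz), Real.one_rpow]
  have e : x * z - x = x * (z - 1) := by ring
  have hz1 : z - 1 ≠ 0 := by linarith
  have hz0 : z ≠ 0 := by linarith
  rw [Real.rpow_sub hx, show (4 : ℝ) = ((4 : ℕ) : ℝ) by norm_num, Real.rpow_natCast, e,
    secondDiffForm, secondDiffForm]
  field_simp
  ring

lemma node_ratio_two (h : RegularCurve c c₁ c₂ L κ B) (hw : Window L κ B 2 u δ) :
    |nodeDist c u δ 2 / nodeDist c u δ 1 - 2| ≤ 6 * B / κ * δ ∧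
    |‖c (u + δ) - c (u + 2 * δ)‖ / nodeDist c u δ 1 - 1| ≤ 3 * B / κ * δ := by
  obtain ⟨l1, -, -, l4⟩ := h.nodeDist_two_sub hw
  have hκ := h.pos
  have hδ := hw.pos
  have hB := h.nonneg hw
  have hx : 0 < nodeDist c u δ 1 := lt_of_lt_of_le (by positivity) l1
  have m0 := hw.mem (t := 0) le_rfl (by norm_num)
  have m1 := hw.mem (t := 1) (by norm_num) (by norm_num)
  have m2 := hw.mem (t := 2) (by norm_num) (by norm_num)
  rw [zero_mul, add_zero] at m0
  rw [one_mul] at m1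
  have n1 := h.nodeDist_approx hw (k := 1) (by norm_num)
  have n2 := h.abs_dist_sub_le m1 m2
  have n3 := h.abs_speed_sub_le m0 m1
  rw [show u + 2 * δ - (u + δ) = δ by ring, abs_of_pos hδ] at n2
  rw [add_sub_cancel_left, abs_of_pos hδ] at n3
  push_cast at n1
  rw [one_mul] at n1
  constructor
  · rw [div_sub' hx.ne', abs_div, abs_of_pos hx, mul_comm]
    calc _ ≤ 6 * B * δ ^ 2 / (κ * δ) := by rw [mul_comm]; gcongr; rwa [mul_comm]
      _ = _ := by field_simp
  · rw [div_sub' hx.ne', abs_div, abs_of_pos hx, mul_one]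
    have : |‖c (u + δ) - c (u + 2 * δ)‖ - nodeDist c u δ 1| ≤ 3 * B * δ ^ 2 := by
      rw [abs_le] at n1 n2 n3 ⊢
      have a1 := mul_le_mul_of_nonneg_left n3.1 hδ.le
      have a2 := mul_le_mul_of_nonneg_left n3.2 hδ.le
      constructor <;> nlinarith [n1.1, n1.2, n2.1, n2.2]
    calc _ ≤ 3 * B * δ ^ 2 / (κ * δ) := by gcongr
      _ = _ := by field_simp

/-- Uniform asymptotics of the irregular part of the variance of a divided difference. -/
lemma irregularSum_asymp (h : RegularCurve c c₁ c₂ L κ B) (hB : 0 < B) (hℓ : ℓ = 1 ∨ ℓ = 2) {ν : ℝ}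
    (hν0 : 0 < ν) (hν : ν < ℓ) : ∃ q : ℝ, q ≠ 0 ∧ ∀ ε > 0, ∃ δ₀ > 0, ∀ u δ, Window L κ B ℓ u δ →
      δ < δ₀ → |irregularSum c ν ℓ u δ - q * nodeDist c u δ 1 ^ (2 * ν - 2 * ℓ)|
        ≤ ε * nodeDist c u δ 1 ^ (2 * ν - 2 * ℓ) := by
  have hκ := h.pos
  rcases hℓ with rfl | rfl
  · refine ⟨-1, by norm_num, fun ε hε => ⟨1, one_pos, fun u δ hw _ => ?_⟩⟩
    have hx : 0 < nodeDist c u δ 1 := by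
      have := h.le_nodeDist hw (k := 1) le_rfl
      have := mul_pos h.pos hw.pos
      push_cast at *
      linarith
    rw [irregularSum_one c hν0 (by simpa using hν) hx, Nat.cast_one, mul_one, sub_self, abs_zero]
    positivity
  · push_cast at hν
    -- This is the value of `secondDiffForm` at the equispaced configuration `y = 1`, `z = 2`.
    refine ⟨G ν 2 - 4 * G ν 1, G_two_sub_ne_zero, fun ε hε => ?_⟩
    have hcont : ContinuousAt (fun p : ℝ × ℝ => secondDiffForm (G ν 1) (G ν p.2) (G ν p.1) p.2)
        (1, 2) := by
      have c1 : ContinuousAt (fun p : ℝ × ℝ => G ν p.2) (1, 2) :=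
        ContinuousAt.comp (f := Prod.snd) (continuousAt_G ν two_pos) continuousAt_snd
      have c2 : ContinuousAt (fun p : ℝ × ℝ => G ν p.1) (1, 2) :=
        ContinuousAt.comp (f := Prod.fst) (continuousAt_G ν one_pos) continuousAt_fst
      unfold secondDiffForm
      have d1 : ContinuousAt (fun p : ℝ × ℝ => -4 / (p.2 * (p.2 - 1))) (1, 2) :=
        ContinuousAt.div (by fun_prop) (by fun_prop) (by norm_num)
      have d2 : ContinuousAt (fun p : ℝ × ℝ => 4 / (p.2 ^ 2 * (p.2 - 1))) (1, 2) :=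
        ContinuousAt.div (by fun_prop) (by fun_prop) (by norm_num)
      have d3 : ContinuousAt (fun p : ℝ × ℝ => 4 / (p.2 * (p.2 - 1) ^ 2)) (1, 2) :=
        ContinuousAt.div (by fun_prop) (by fun_prop) (by norm_num)
      exact ((d1.mul continuousAt_const).add (d2.mul c1)).sub (d3.mul c2)
    obtain ⟨η, hη, hclose⟩ := Metric.continuousAt_iff.1 hcont (ε / 2) (by positivity)
    -- Combines the constant of `abs_secondDiffForm_sq_le`, the ratio errors `6Bδ/κ + 3Bδ/κ`, and
    -- `κδ ≤ x`.
    set D : ℝ := 32 * (9 * B / κ ^ 2) with hD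
    have hD0 : 0 < D := by positivity
    have hlog : ContinuousAt (fun x : ℝ => x * Real.log x) 0 := Real.continuous_mul_log.continuousAt
    obtain ⟨η₂, hη₂, hlog'⟩ := Metric.continuousAt_iff.1 hlog (ε / (2 * D)) (by positivity)
    -- The three thresholds put the ratios within `η` of their limits, put them within `1/2`, and
    -- make `x ≤ Bδ < η₂`.
    refine ⟨min (min (η * κ / (6 * B)) (κ / (12 * B))) (η₂ / B), by positivity, fun u δ hw hδlt => ?_⟩
    have hδ := hw.pos
    obtain ⟨⟨hδ1, hδ2⟩, hδ3⟩ : (δ < η * κ / (6 * B) ∧ δ < κ / (12 * B)) ∧ δ < η₂ / B := by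
      simpa [lt_min_iff] using hδlt
    rw [lt_div_iff₀ (by positivity)] at hδ1 hδ2 hδ3
    obtain ⟨l1, l2, l3, -⟩ := h.nodeDist_two_sub hw
    set x := nodeDist c u δ 1 with hx_def
    have hx : 0 < x := lt_of_lt_of_le (by positivity) l1
    have hxB : x ≤ B * δ := by
      have m0 := hw.mem (t := 0) le_rfl (by norm_num)
      have m1 := hw.mem (t := 1) (by norm_num) (by norm_num)
      have := h.dist_le m0 m1
      rw [show u + 0 * δ - (u + 1 * δ) = -δ by ring, abs_neg, abs_of_pos hδ] at this
      simpa [x, nodeDist] using this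
    obtain ⟨r1, r2⟩ := h.node_ratio_two hw
    set z := nodeDist c u δ 2 / x with hz_def
    set y := ‖c (u + δ) - c (u + 2 * δ)‖ / x with hy_def
    have hz2 : |z - 2| ≤ 1 / 2 := r1.trans (by
      rw [div_mul_eq_mul_div, div_le_iff₀ hκ]; linarith)
    have hy2 : |y - 1| ≤ 1 / 2 := r2.trans (by
      rw [div_mul_eq_mul_div, div_le_iff₀ hκ]; nlinarith)
    have hz3 : |z - 2| < η := r1.trans_lt (by
      rw [div_mul_eq_mul_div, div_lt_iff₀ hκ]; linarith)
    have hy3 : |y - 1| < η := r2.trans_lt (by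
      rw [div_mul_eq_mul_div, div_lt_iff₀ hκ]; nlinarith)
    have hz1 : 1 < z := by linarith [(abs_le.1 hz2).1]
    have hy0 : 0 < y := by linarith [(abs_le.1 hy2).1]
    rw [irregularSum_two c hx hy0 hz1 rfl (by rw [hz_def]; field_simp) (by rw [hy_def]; field_simp),
      show (2 * ν - 2 * ((2 : ℕ) : ℝ)) = 2 * ν - 4 by push_cast; ring, ← sub_mul, abs_mul,
      abs_of_pos (Real.rpow_pos_of_pos hx _)]
    refine mul_le_mul_of_nonneg_right ?_ (Real.rpow_pos_of_pos hx _).le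
    have b1 : |secondDiffForm (G ν 1) (G ν z) (G ν y) z - (G ν 2 - 4 * G ν 1)| ≤ ε / 2 := by
      have := hclose (x := (y, z)) (by
        rw [Prod.dist_eq, Real.dist_eq, Real.dist_eq]; exact max_lt hy3 hz3)
      rw [Real.dist_eq] at this
      refine le_trans (le_of_eq ?_) this.le
      congr 2
      simp only [secondDiffForm]; norm_num; ring
    -- A logarithm occurs only for `ν = 1`; there the form is `O(x)`, and `x log x` tends to zero.
    have b2 : |logCoeff ν * Real.log x * secondDiffForm 1 (z ^ (2 * ν)) (y ^ (2 * ν)) z| ≤ ε / 2 := by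
      rcases logCoeff_eq_zero_or hν0 hν with h0 | rfl
      · rw [h0, zero_mul, zero_mul, abs_zero]; positivity
      · rw [mul_one, Real.rpow_two, Real.rpow_two, abs_mul, abs_mul]
        have k1 : |secondDiffForm 1 (z ^ 2) (y ^ 2) z| ≤ D * x := by
          refine (abs_secondDiffForm_sq_le hy2 hz2).trans ?_
          calc 32 * (|z - 2| + |y - 1|) ≤ 32 * (6 * B / κ * δ + 3 * B / κ * δ) := by gcongr
            _ = 32 * (9 * B / κ ^ 2) * (κ * δ) := by field_simp; ring
            _ ≤ _ := by rw [hD]; gcongr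
        have k2 : |x * Real.log x| < ε / (2 * D) := by
          have := hlog' (x := x) (by
            rw [Real.dist_eq, sub_zero, abs_of_pos hx]; linarith)
          simpa [Real.dist_eq] using this
        rw [abs_mul, abs_of_pos hx] at k2
        have k3 := logCoeff_mul_nonneg 1
        calc |logCoeff 1| * |Real.log x| * |secondDiffForm 1 (z ^ 2) (y ^ 2) z|
            ≤ 1 * |Real.log x| * (D * x) := by
              gcongr
              rw [abs_of_nonneg k3.1]; exact k3.2
          _ = D * (x * |Real.log x|) := by ring
          _ ≤ D * (ε / (2 * D)) := by gcongr
          _ = ε / 2 := by field_simp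
    calc _ = |(secondDiffForm (G ν 1) (G ν z) (G ν y) z - (G ν 2 - 4 * G ν 1))
          + logCoeff ν * Real.log x * secondDiffForm 1 (z ^ (2 * ν)) (y ^ (2 * ν)) z| := by
            congr 1; ring
      _ ≤ ε / 2 + ε / 2 := (abs_add_le _ _).trans (add_le_add b1 b2)
      _ = ε := by ring

end RegularCurve

/-! ### Variance of a divided difference -/

lemma sum_sum_symm_eq {f : ℕ → ℕ → ℝ} (hs : ∀ i j, f i j = f j i) (h0 : ∀ i, f i i = 0) (N : ℕ) :
    ∑ i ∈ Finset.range N, ∑ j ∈ Finset.range N, f i j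
      = 2 * ∑ j ∈ Finset.range N, ∑ i ∈ Finset.range j, f i j := by
  induction N with
  | zero => simp
  | succ N ih =>
    rw [Finset.sum_range_succ, Finset.sum_range_succ (fun j => f N j), h0, add_zero,
      Finset.sum_range_succ (fun j => ∑ i ∈ Finset.range j, f i j), mul_add, ← ih]
    simp only [Finset.sum_range_succ (f _), Finset.sum_add_distrib]
    rw [Finset.sum_congr rfl fun j _ => hs N j]
    ring

/-- The filter is pulled back along the distance, so the bound on the remainder is uniform over all
pairs of points closer than `ρ`. -/
lemma HasCovarianceExpansion.exists_bound {K : Plane → Plane → ℝ} {ν : ℝ} {β : ℕ → ℝ} {βstar : ℝ}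
    (hK : HasCovarianceExpansion K ν β βstar) :
    ∃ (r : Plane → Plane → ℝ) (τ A ρ : ℝ), 0 < τ ∧ 0 ≤ A ∧ 0 < ρ ∧
      (∀ x y, K x y = (∑ j ∈ Finset.range (⌊ν⌋₊ + 1), β j * ‖x - y‖ ^ (2 * j))
        + βstar * G ν ‖x - y‖ + r x y) ∧
      ∀ x y, ‖x - y‖ < ρ → |r x y| ≤ A * ‖x - y‖ ^ (2 * ν + τ) := by
  obtain ⟨r, hr, τ, hτ, hO⟩ := hK
  obtain ⟨A, hA, hb⟩ := hO.exists_nonneg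
  rw [IsBigOWith, eventually_comap] at hb
  obtain ⟨ρ, hρ, hball⟩ := Metric.eventually_nhds_iff.1 hb
  refine ⟨r, τ, A, ρ, hτ, hA, hρ, hr, fun x y hxy => ?_⟩
  have := hball (y := ‖x - y‖) (by rwa [Real.dist_eq, sub_zero, abs_norm]) (x, y) rfl
  rwa [Real.norm_eq_abs, Real.norm_of_nonneg (Real.rpow_nonneg (norm_nonneg _) _)] at this

/-- The covariance of two divided differences, expressed by the covariance function. -/
def windowCov (K : Plane → Plane → ℝ) (c : ℝ → Plane) (ℓ : ℕ) (u u' δ : ℝ) : ℝ :=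
  ∑ k ∈ Finset.range (ℓ + 1), ∑ k' ∈ Finset.range (ℓ + 1),
    nodeWeight c ℓ u δ k * nodeWeight c ℓ u' δ k' * K (c (u + k * δ)) (c (u' + k' * δ))

namespace RegularCurve

variable {c c₁ c₂ : ℝ → Plane} {L κ B : ℝ} {u δ : ℝ} {ℓ : ℕ}

/-- Because the weights sum to zero, polarisation turns the double sum into `-2` times the squared
norm of the divided difference of `c`, which is bounded by the derivatives of the curve. The naive
estimate would lose a negative power of `δ`. -/
lemma abs_windowCov_sq_le (h : RegularCurve c c₁ c₂ L κ B) (hℓ : ℓ = 1 ∨ ℓ = 2)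
    (hw : Window L κ B ℓ u δ) :
    |windowCov (fun x y => ‖x - y‖ ^ 2) c ℓ u u δ|
      ≤ 2 * ((4 / κ + 20 / κ ^ 2 + 12 * B / κ ^ 3) * B) ^ 2 := by
  have hs := h.sum_nodeWeight hℓ hw
  have e := inner_sum_smul_sum_smul_of_sum_eq_zero (ι₁ := ℕ) (ι₂ := ℕ)
    (s₁ := Finset.range (ℓ + 1)) (s₂ := Finset.range (ℓ + 1))
    (w₁ := nodeWeight c ℓ u δ) (fun k => c (u + k * δ)) hs
    (w₂ := nodeWeight c ℓ u δ) (fun k => c (u + k * δ)) hs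
  rw [real_inner_self_eq_norm_sq] at e
  have e2 : windowCov (fun x y => ‖x - y‖ ^ 2) c ℓ u u δ
      = -2 * ‖∑ k ∈ Finset.range (ℓ + 1), nodeWeight c ℓ u δ k • c (u + k * δ)‖ ^ 2 := by
    rw [e, windowCov]; simp only [sq]; ring
  have hsub : Set.Icc u (u + ℓ * δ) ⊆ Set.Icc 0 L := Set.Icc_subset_Icc hw.nonneg hw.le
  have hn := h.norm_sum_nodeWeight_smul_le hℓ hw (g := c) (g₁ := c₁) (g₂ := c₂) (M := B)
    (fun t ht => h.hasDeriv t (hsub ht)) (fun t ht => h.speed_le t (hsub ht))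
    (fun _ t ht => h.hasDeriv₁ t (hsub ht)) (fun _ t ht => h.norm_le t (hsub ht))
  rw [e2, abs_mul, abs_neg, abs_two, abs_of_nonneg (sq_nonneg _)]
  gcongr

lemma windowCov_const (h : RegularCurve c c₁ c₂ L κ B) (hℓ : ℓ = 1 ∨ ℓ = 2)
    (hw : Window L κ B ℓ u δ) (b : ℝ) : windowCov (fun _ _ => b) c ℓ u u δ = 0 := by
  have hs := h.sum_nodeWeight hℓ hw
  simp only [windowCov, ← Finset.sum_mul, ← Finset.mul_sum, hs, mul_zero, zero_mul,
    Finset.sum_const_zero]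

lemma windowCov_G (c : ℝ → Plane) (ν : ℝ) (ℓ : ℕ) (u δ : ℝ) :
    windowCov (fun x y => G ν ‖x - y‖) c ℓ u u δ = 2 * irregularSum c ν ℓ u δ :=
  sum_sum_symm_eq (fun i j => by simp only [norm_sub_rev (c (u + i * δ))]; ring) (fun i => by simp [G_zero]) _

/-- Termwise estimate: at most nine pairs of nodes, weights at most `4 / (κδ) ^ ℓ`, node distances
at most `2Bδ`; hence `144 = 9 * 4 * 4`. -/
lemma abs_windowCov_remainder_le (h : RegularCurve c c₁ c₂ L κ B) (hℓ : ℓ = 1 ∨ ℓ = 2)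
    (hw : Window L κ B ℓ u δ) {r : Plane → Plane → ℝ} {a A ρ : ℝ} (ha : 0 < a) (hA : 0 ≤ A)
    (hr : ∀ x y, ‖x - y‖ < ρ → |r x y| ≤ A * ‖x - y‖ ^ a) (hδρ : 2 * B * δ < ρ) :
    |windowCov r c ℓ u u δ| ≤ 144 * A * (2 * B) ^ a / κ ^ (2 * ℓ) * δ ^ (a - 2 * ℓ) := by
  have hκ := h.pos
  have hδ := hw.pos
  have hB := h.nonneg hw
  have hℓ2 : (ℓ : ℝ) ≤ 2 := by rcases hℓ with rfl | rfl <;> norm_num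
  have hterm : ∀ k ∈ Finset.range (ℓ + 1), ∀ k' ∈ Finset.range (ℓ + 1),
      |nodeWeight c ℓ u δ k * nodeWeight c ℓ u δ k' * r (c (u + k * δ)) (c (u + k' * δ))|
        ≤ 4 / (κ * δ) ^ ℓ * (4 / (κ * δ) ^ ℓ) * (A * (2 * B * δ) ^ a) := by
    intro k hk k' hk'
    rw [Finset.mem_range, Nat.lt_succ_iff] at hk hk'
    have hkℓ : (k : ℝ) ≤ ℓ := by exact_mod_cast hk
    have hkℓ' : (k' : ℝ) ≤ ℓ := by exact_mod_cast hk'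
    have hk0 : (0 : ℝ) ≤ k := Nat.cast_nonneg _
    have hk0' : (0 : ℝ) ≤ k' := Nat.cast_nonneg _
    have hd : ‖c (u + k * δ) - c (u + k' * δ)‖ ≤ 2 * B * δ := by
      refine (h.dist_le (hw.mem hk0 hkℓ) (hw.mem hk0' hkℓ')).trans ?_
      rw [show u + k * δ - (u + k' * δ) = (k - k') * δ by ring, abs_mul, abs_of_pos hδ]
      have : |(k : ℝ) - k'| ≤ 2 := abs_le.2 ⟨by linarith, by linarith⟩
      calc B * (|(k : ℝ) - k'| * δ) ≤ B * (2 * δ) := by gcongr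
        _ = _ := by ring
    have hw1 := h.abs_nodeWeight_le hℓ hw hk
    have hw2 := h.abs_nodeWeight_le hℓ hw hk'
    have hr' := hr _ _ (hd.trans_lt hδρ)
    rw [abs_mul, abs_mul]
    have hp : A * ‖c (u + k * δ) - c (u + k' * δ)‖ ^ a ≤ A * (2 * B * δ) ^ a := by gcongr
    have : (0 : ℝ) ≤ 4 / (κ * δ) ^ ℓ := by positivity
    gcongr
    exact hr'.trans hp
  have hcard : ((ℓ : ℝ) + 1) * (ℓ + 1) ≤ 9 := by nlinarith [Nat.cast_nonneg (α := ℝ) ℓ]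
  have hX : 0 ≤ 4 / (κ * δ) ^ ℓ * (4 / (κ * δ) ^ ℓ) * (A * (2 * B * δ) ^ a) := by positivity
  calc |windowCov r c ℓ u u δ|
      ≤ ∑ k ∈ Finset.range (ℓ + 1), ∑ k' ∈ Finset.range (ℓ + 1),
        4 / (κ * δ) ^ ℓ * (4 / (κ * δ) ^ ℓ) * (A * (2 * B * δ) ^ a) :=
        (Finset.abs_sum_le_sum_abs _ _).trans (Finset.sum_le_sum fun k hk =>
          (Finset.abs_sum_le_sum_abs _ _).trans (Finset.sum_le_sum fun k' hk' => hterm k hk k' hk'))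
    _ = ((ℓ : ℝ) + 1) * (ℓ + 1) * (4 / (κ * δ) ^ ℓ * (4 / (κ * δ) ^ ℓ) * (A * (2 * B * δ) ^ a)) := by
        simp; ring
    _ ≤ 9 * (4 / (κ * δ) ^ ℓ * (4 / (κ * δ) ^ ℓ) * (A * (2 * B * δ) ^ a)) := by gcongr
    _ = _ := by
        rw [Real.mul_rpow (by positivity) hδ.le, Real.rpow_sub hδ,
          show (2 * (ℓ : ℝ)) = ((2 * ℓ : ℕ) : ℝ) by push_cast; ring, Real.rpow_natCast]
        field_simp
        ring

/-- The variance of a divided difference agrees with its irregular part up to lower order. -/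
lemma abs_windowCov_sub_le (h : RegularCurve c c₁ c₂ L κ B) (hℓ : ℓ = 1 ∨ ℓ = 2)
    {K : Plane → Plane → ℝ} {ν : ℝ} (hν0 : 0 < ν) (hν : ν < ℓ) {β : ℕ → ℝ} {βstar : ℝ}
    (hK : HasCovarianceExpansion K ν β βstar) :
    ∃ τ > 0, ∃ A ≥ 0, ∃ δ₀ > 0, ∀ u δ, Window L κ B ℓ u δ → δ < δ₀ →
      |windowCov K c ℓ u u δ - 2 * βstar * irregularSum c ν ℓ u δ|
        ≤ A * (1 + δ ^ (2 * ν + τ - 2 * ℓ)) := by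
  obtain ⟨r, τ, A, ρ, hτ, hA, hρ, hexp, hr⟩ := hK.exists_bound
  have hκ := h.pos
  set D : ℝ := (4 / κ + 20 / κ ^ 2 + 12 * B / κ ^ 3) * B with hD
  refine ⟨τ, hτ, |β 1| * (2 * D ^ 2) + |144 * A * (2 * B) ^ (2 * ν + τ) / κ ^ (2 * ℓ)|, by positivity,
    ρ / (2 * (|B| + 1)), by positivity, fun u δ hw hδ => ?_⟩
  have hδ0 := hw.pos
  have hB := h.nonneg hw
  rw [abs_of_nonneg hB, lt_div_iff₀ (by positivity)] at hδ
  have hrem := h.abs_windowCov_remainder_le hℓ hw (a := 2 * ν + τ) (by linarith) hA hr (by nlinarith)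
  have hsq := h.abs_windowCov_sq_le hℓ hw
  rw [← hD] at hsq
  have hpoly : |windowCov (fun x y => ∑ j ∈ Finset.range (⌊ν⌋₊ + 1), β j * ‖x - y‖ ^ (2 * j)) c ℓ u u δ|
      ≤ |β 1| * (2 * D ^ 2) := by
    -- Since `ν < ℓ ≤ 2`, only the constant and the quadratic term of the polynomial part occur.
    have hfl : ⌊ν⌋₊ < 2 := by
      rw [Nat.floor_lt hν0.le]
      refine hν.trans_le ?_
      rcases hℓ with rfl | rfl <;> norm_num
    interval_cases hfv : ⌊ν⌋₊
    · have := h.windowCov_const hℓ hw (β 0)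
      simp only [zero_add, Finset.sum_range_one, mul_zero, pow_zero, mul_one]
      rw [this, abs_zero]; positivity
    · have e : windowCov (fun x y => ∑ j ∈ Finset.range (1 + 1), β j * ‖x - y‖ ^ (2 * j)) c ℓ u u δ
          = windowCov (fun _ _ => β 0) c ℓ u u δ
            + β 1 * windowCov (fun x y => ‖x - y‖ ^ 2) c ℓ u u δ := by
        simp only [windowCov, Finset.mul_sum, ← Finset.sum_add_distrib]
        refine Finset.sum_congr rfl fun k _ => Finset.sum_congr rfl fun k' _ => ?_
        simp [Finset.sum_range_succ]; ring
      rw [e, h.windowCov_const hℓ hw, zero_add, abs_mul]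
      gcongr
  have hsplit : windowCov K c ℓ u u δ - 2 * βstar * irregularSum c ν ℓ u δ
      = windowCov (fun x y => ∑ j ∈ Finset.range (⌊ν⌋₊ + 1), β j * ‖x - y‖ ^ (2 * j)) c ℓ u u δ
        + windowCov r c ℓ u u δ := by
    rw [mul_comm (2 : ℝ), mul_assoc, ← windowCov_G, sub_eq_iff_eq_add]
    simp only [windowCov, Finset.mul_sum, ← Finset.sum_add_distrib]
    refine Finset.sum_congr rfl fun k _ => Finset.sum_congr rfl fun k' _ => ?_
    rw [hexp, ← Finset.mul_sum]; ring
  have hp : 0 ≤ δ ^ (2 * ν + τ - 2 * ℓ) := by positivity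
  rw [hsplit]
  refine (abs_add_le _ _).trans ((add_le_add hpoly hrem).trans ?_)
  have h1 : 144 * A * (2 * B) ^ (2 * ν + τ) / κ ^ (2 * ℓ) * δ ^ (2 * ν + τ - 2 * ℓ)
      ≤ |144 * A * (2 * B) ^ (2 * ν + τ) / κ ^ (2 * ℓ)| * δ ^ (2 * ν + τ - 2 * ℓ) := by
    gcongr; exact le_abs_self _
  nlinarith [mul_nonneg (show (0 : ℝ) ≤ |β 1| * (2 * D ^ 2) by positivity) hp,
    abs_nonneg (144 * A * (2 * B) ^ (2 * ν + τ) / κ ^ (2 * ℓ))]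

end RegularCurve

/-! ### Smoothness of radial functions -/

lemma contDiffOn_of_hasDerivAt_chain {V : Set ℝ} (hV : IsOpen V) (N : ℕ) (f : ℕ → ℝ → ℝ)
    (hf : ∀ b < N, ∀ t ∈ V, HasDerivAt (f b) (f (b + 1) t) t) (hc : ContinuousOn (f N) V) :
    ContDiffOn ℝ N (f 0) V := by
  induction N generalizing f with
  | zero => exact contDiffOn_zero.2 hc
  | succ N ih =>
    push_cast
    rw [contDiffOn_succ_iff_deriv_of_isOpen hV]
    refine ⟨fun t ht => (hf 0 (Nat.succ_pos _) t ht).differentiableAt.differentiableWithinAt,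
      fun h => absurd h (by simp), ?_⟩
    refine (ih (fun b => f (b + 1)) (fun b hb => hf (b + 1) (by omega)) hc).congr fun t ht => ?_
    exact (hf 0 (Nat.succ_pos _) t ht).deriv

lemma hasDerivAt_iteratedDeriv {W : Set ℝ} (hW : IsOpen W) {m : ℝ → ℝ} {N j : ℕ}
    (hm : ContDiffOn ℝ N m W) (hj : j < N) {w : ℝ} (hw : w ∈ W) :
    HasDerivAt (iteratedDeriv j m) (iteratedDeriv (j + 1) m w) w := by
  have key : ∀ k n : ℕ, k + n ≤ N → ContDiffOn ℝ n (iteratedDeriv k m) W := by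
    intro k
    induction k with
    | zero => intro n hn; rw [iteratedDeriv_zero]; exact hm.of_le (by exact_mod_cast (by omega))
    | succ k ih =>
      intro n hn
      rw [iteratedDeriv_succ]
      exact (ih (n + 1) (by omega)).deriv_of_isOpen hW (by push_cast; exact le_rfl)
  have h := ((key j 1 (by omega)).differentiableOn (by norm_num)).differentiableAt (hW.mem_nhds hw)
  rw [iteratedDeriv_succ]
  exact h.hasDerivAt

/-- The profile of a radial function, as a function of the squared norm. -/
def radialProfile (F : Plane → ℝ) (w : ℝ) : ℝ := F (EuclideanSpace.single 0 (√w))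

lemma norm_sq_eq (z : Plane) : ‖z‖ ^ 2 = z 0 ^ 2 + z 1 ^ 2 := by
  simp [EuclideanSpace.norm_sq_eq, Fin.sum_univ_two]

lemma radialProfile_norm_sq {F : Plane → ℝ} (hF : ∀ x y, ‖x‖ = ‖y‖ → F x = F y) (z : Plane) :
    F z = radialProfile F (‖z‖ ^ 2) := by
  refine hF _ _ ?_
  rw [Real.sqrt_sq (norm_nonneg _)]; simp

lemma norm_sq_add_smul_single (z : Plane) (i : Fin 2) (t : ℝ) :
    ‖z + t • EuclideanSpace.single i (1 : ℝ)‖ ^ 2 = ‖z‖ ^ 2 + 2 * t * z i + t ^ 2 := by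
  rw [norm_sq_eq, norm_sq_eq]
  fin_cases i <;> simp <;> ring

/-- Iterated pure partials are ordinary derivatives of the restriction to a line, so their existence
and the continuity of the last one give a `C^N` slice. -/
lemma contDiffAt_slice {F : Plane → ℝ} {U : Set Plane} (hU : IsOpen U) {i : Fin 2} {N : ℕ}
    (hd : ∀ b < N, ∀ x ∈ U, LineDifferentiableAt ℝ ((pderiv i)^[b] F) x
      (EuclideanSpace.single i (1 : ℝ)))
    (hc : ContinuousOn ((pderiv i)^[N] F) U) {z : Plane} (hz : z ∈ U) :
    ContDiffAt ℝ N (fun t : ℝ => F (z + t • EuclideanSpace.single i (1 : ℝ))) 0 := by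
  have hcont : Continuous fun t : ℝ => z + t • EuclideanSpace.single i (1 : ℝ) := by fun_prop
  set V : Set ℝ := (fun t : ℝ => z + t • EuclideanSpace.single i (1 : ℝ)) ⁻¹' U
  have hV : IsOpen V := hU.preimage hcont
  have h0 : (0 : ℝ) ∈ V := by simpa [V] using hz
  refine (contDiffOn_of_hasDerivAt_chain hV N
    (fun b t => (pderiv i)^[b] F (z + t • EuclideanSpace.single i (1 : ℝ))) ?_ ?_).contDiffAt
    (hV.mem_nhds h0)
  · intro b hb t ht
    have h := (hd b hb _ ht).hasLineDerivAt
    rw [HasLineDerivAt, ← sub_self t] at h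
    have h2 := h.comp_sub_const t t
    rw [Function.iterate_succ_apply']
    refine h2.congr_of_eventuallyEq (Eventually.of_forall fun s => ?_)
    exact congrArg ((pderiv i)^[b] F) (by rw [add_assoc, ← add_smul, add_sub_cancel])
  · exact hc.comp hcont.continuousOn fun t ht => ht

/-- Along the line through `z` in direction `i` the squared norm is `‖z‖² + 2 t z_i + t²`. For `z i
≠ 0` this can be solved for `t` as a smooth function of the squared norm, so the profile is the
slice composed with that solution. -/
lemma contDiffAt_radialProfile_of_slice {F : Plane → ℝ} (hF : ∀ x y, ‖x‖ = ‖y‖ → F x = F y)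
    {N : ℕ} {z : Plane} {i : Fin 2} (hzi : z i ≠ 0)
    (hs : ContDiffAt ℝ N (fun t : ℝ => F (z + t • EuclideanSpace.single i (1 : ℝ))) 0) :
    ContDiffAt ℝ N (radialProfile F) (‖z‖ ^ 2) := by
  -- The sign selects the root of the quadratic equation that equals `0` at `w = ‖z‖²`.
  obtain ⟨σ, hσ1, hσ2⟩ : ∃ σ : ℝ, σ ^ 2 = 1 ∧ σ * |z i| = z i := by
    rcases lt_or_gt_of_ne hzi with h | h
    · exact ⟨-1, by norm_num, by rw [abs_of_neg h]; ring⟩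
    · exact ⟨1, by norm_num, by rw [abs_of_pos h]; ring⟩
  set T : ℝ → ℝ := fun w => σ * √(z i ^ 2 + w - ‖z‖ ^ 2) - z i with hT
  have hT0 : T (‖z‖ ^ 2) = 0 := by
    simp only [hT, add_sub_cancel_right, Real.sqrt_sq_eq_abs, hσ2, sub_self]
  have hTd : ContDiffAt ℝ N T (‖z‖ ^ 2) := by
    refine (contDiffAt_const.mul (ContDiffAt.sqrt (by fun_prop) ?_)).sub contDiffAt_const
    simpa using hzi
  have hzpos : 0 < ‖z‖ ^ 2 := by
    have : z ≠ 0 := by rintro rfl; simp at hzi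
    positivity
  have hcomp := ContDiffAt.comp (‖z‖ ^ 2) (by rw [hT0]; exact hs) hTd
  refine hcomp.congr_of_eventuallyEq ?_
  have e1 : ∀ᶠ w in 𝓝 (‖z‖ ^ 2), 0 < z i ^ 2 + w - ‖z‖ ^ 2 := by
    refine ContinuousAt.eventually_lt (by fun_prop) (by fun_prop) ?_
    simp; positivity
  filter_upwards [e1, lt_mem_nhds hzpos] with w hw hw0
  simp only [Function.comp, radialProfile]
  refine hF _ _ ?_
  rw [← sq_eq_sq₀ (norm_nonneg _) (norm_nonneg _), norm_sq_add_smul_single]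
  have hq := Real.sq_sqrt hw.le
  have e2 : T w ^ 2 + 2 * T w * z i = w - ‖z‖ ^ 2 := by
    simp only [hT]
    have : (σ * √(z i ^ 2 + w - ‖z‖ ^ 2)) ^ 2 = z i ^ 2 + w - ‖z‖ ^ 2 := by
      rw [mul_pow, hσ1, one_mul, hq]
    linear_combination this
  rw [PiLp.norm_single, Real.norm_of_nonneg (Real.sqrt_nonneg _), Real.sq_sqrt hw0.le]
  linarith

/-- A radial function with continuous pure partial derivatives of order `N` on an open set has a
profile of class `C^N`. -/
lemma contDiffAt_radialProfile {F : Plane → ℝ} (hF : ∀ x y, ‖x‖ = ‖y‖ → F x = F y) {U : Set Plane}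
    (hU : IsOpen U) {N : ℕ} (h1 : MixedPartialExistsOn 0 N F U) (h1c : ContinuousOn (mixedPartial 0 N F) U)
    (h0 : MixedPartialExistsOn N 0 F U) (h0c : ContinuousOn (mixedPartial N 0 F) U)
    {z : Plane} (hz : z ∈ U) (hz0 : z ≠ 0) :
    ContDiffAt ℝ N (radialProfile F) (‖z‖ ^ 2) := by
  by_cases h : z 0 = 0
  · have hz1 : z 1 ≠ 0 := by
      intro h'
      apply hz0
      ext i; fin_cases i <;> simp [h, h']
    exact contDiffAt_radialProfile_of_slice hF hz1 (contDiffAt_slice hU h1.1 h1c hz)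
  · exact contDiffAt_radialProfile_of_slice hF h (contDiffAt_slice hU h0.2 h0c hz)

/-! ### Partial derivatives of radial functions -/

lemma pderiv_zero_eq {f : Plane → ℝ} {H : ℝ → ℝ → ℝ} {V : Set Plane} (hV : IsOpen V)
    (hf : ∀ z ∈ V, f z = H (z 0) (z 1)) {z : Plane} (hz : z ∈ V) {d : ℝ}
    (hd : HasDerivAt (fun a => H a (z 1)) d (z 0)) : pderiv 0 f z = d := by
  have he : f =ᶠ[𝓝 z] fun z => H (z 0) (z 1) := by
    filter_upwards [hV.mem_nhds hz] with y hy using hf y hy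
  rw [pderiv, he.lineDeriv_eq]
  refine HasLineDerivAt.lineDeriv ?_
  rw [HasLineDerivAt]
  have h : HasDerivAt (fun t : ℝ => H (z 0 + t) (z 1)) d 0 := by
    have := HasDerivAt.comp_const_add (z 0) 0 (f := fun a => H a (z 1)) (f' := d) (by simpa using hd)
    simpa using this
  simpa using h

lemma pderiv_one_eq {f : Plane → ℝ} {H : ℝ → ℝ → ℝ} {V : Set Plane} (hV : IsOpen V)
    (hf : ∀ z ∈ V, f z = H (z 0) (z 1)) {z : Plane} (hz : z ∈ V) {d : ℝ}
    (hd : HasDerivAt (fun b => H (z 0) b) d (z 1)) : pderiv 1 f z = d := by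
  have he : f =ᶠ[𝓝 z] fun z => H (z 0) (z 1) := by
    filter_upwards [hV.mem_nhds hz] with y hy using hf y hy
  rw [pderiv, he.lineDeriv_eq]
  refine HasLineDerivAt.lineDeriv ?_
  rw [HasLineDerivAt]
  have h : HasDerivAt (fun t : ℝ => H (z 0) (z 1 + t)) d 0 := by
    have := HasDerivAt.comp_const_add (z 1) 0 (f := fun b => H (z 0) b) (f' := d) (by simpa using hd)
    simpa using this
  simpa using h

/-- `F` is a radial function `M 0 (‖z‖²)`, and `M 0, …, M N` are successive derivatives on `W`. -/
structure RadialChain (F : Plane → ℝ) (M : ℕ → ℝ → ℝ) (N : ℕ) (W : Set ℝ) : Prop where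
  isOpen : IsOpen W
  hasDeriv : ∀ k < N, ∀ w ∈ W, HasDerivAt (M k) (M (k + 1) w) w
  eq : ∀ z, F z = M 0 (‖z‖ ^ 2)

namespace RadialChain

variable {F : Plane → ℝ} {M : ℕ → ℝ → ℝ} {N : ℕ} {W : Set ℝ}

lemma isOpen_preimage (h : RadialChain F M N W) : IsOpen {z : Plane | z 0 ^ 2 + z 1 ^ 2 ∈ W} :=
  h.isOpen.preimage (f := fun z : Plane => z 0 ^ 2 + z 1 ^ 2) (by fun_prop)

/-- The rule that generates the table of partial derivatives below. For `i = 0` the truncated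
exponent `i - 1` is harmless because of the factor `i`. -/
lemma hasDerivAt_left (h : RadialChain F M N W) (i : ℕ) {k : ℕ} (hk : k < N) {a b : ℝ}
    (hw : a ^ 2 + b ^ 2 ∈ W) : HasDerivAt (fun a => a ^ i * M k (a ^ 2 + b ^ 2))
      (i * a ^ (i - 1) * M k (a ^ 2 + b ^ 2) + 2 * a ^ (i + 1) * M (k + 1) (a ^ 2 + b ^ 2)) a := by
  have h1 : HasDerivAt (fun a : ℝ => a ^ 2 + b ^ 2) (2 * a) a :=
    ((hasDerivAt_pow 2 a).add_const _).congr_deriv (by simp)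
  exact ((hasDerivAt_pow i a).mul ((h.hasDeriv k hk _ hw).comp a h1)).congr_deriv
    (by simp only [Function.comp]; ring)

lemma hasDerivAt_right (h : RadialChain F M N W) (i : ℕ) {k : ℕ} (hk : k < N) {a b : ℝ}
    (hw : a ^ 2 + b ^ 2 ∈ W) : HasDerivAt (fun b => b ^ i * M k (a ^ 2 + b ^ 2))
      (i * b ^ (i - 1) * M k (a ^ 2 + b ^ 2) + 2 * b ^ (i + 1) * M (k + 1) (a ^ 2 + b ^ 2)) b := by
  simp only [add_comm (a ^ 2)] at hw ⊢
  exact h.hasDerivAt_left i hk hw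

lemma eq_coord (h : RadialChain F M N W) (z : Plane) : F z = M 0 (z 0 ^ 2 + z 1 ^ 2) := by
  rw [h.eq, norm_sq_eq]

lemma mixedPartial_succ_left (a b : ℕ) (F : Plane → ℝ) :
    mixedPartial (a + 1) b F = pderiv 0 (mixedPartial a b F) := by
  rw [mixedPartial, Function.iterate_succ_apply', mixedPartial]

lemma mixedPartial_succ_right (b : ℕ) (F : Plane → ℝ) :
    mixedPartial 0 (b + 1) F = pderiv 1 (mixedPartial 0 b F) := by
  rw [mixedPartial, Function.iterate_zero, id, Function.iterate_succ_apply', mixedPartial,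
    Function.iterate_zero, id]

section

variable {z : Plane}

/-- The table follows the order of differentiation in `mixedPartial`: first the second coordinate,
then the first. -/
lemma partial_0_1 (h : RadialChain F M N W) (hN : 1 ≤ N) (hz : z 0 ^ 2 + z 1 ^ 2 ∈ W) :
    mixedPartial 0 1 F z = 2 * z 1 * M 1 (z 0 ^ 2 + z 1 ^ 2) := by
  rw [mixedPartial_succ_right]
  refine pderiv_one_eq (H := fun a b => b ^ 0 * M 0 (a ^ 2 + b ^ 2)) h.isOpen_preimage
    (fun y _ => by rw [pow_zero, one_mul]; exact h.eq_coord y) hz ?_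
  exact (h.hasDerivAt_right 0 (by omega) hz).congr_deriv (by push_cast; ring)

lemma partial_0_2 (h : RadialChain F M N W) (hN : 2 ≤ N) (hz : z 0 ^ 2 + z 1 ^ 2 ∈ W) :
    mixedPartial 0 2 F z = 2 * M 1 (z 0 ^ 2 + z 1 ^ 2) + 4 * z 1 ^ 2 * M 2 (z 0 ^ 2 + z 1 ^ 2) := by
  rw [mixedPartial_succ_right]
  refine pderiv_one_eq (H := fun a b => 2 * (b ^ 1 * M 1 (a ^ 2 + b ^ 2))) h.isOpen_preimage
    (fun y hy => by rw [h.partial_0_1 (by omega) hy]; ring) hz ?_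
  exact ((h.hasDerivAt_right 1 (by omega) hz).const_mul 2).congr_deriv (by push_cast; ring)

lemma partial_0_3 (h : RadialChain F M N W) (hN : 3 ≤ N) (hz : z 0 ^ 2 + z 1 ^ 2 ∈ W) :
    mixedPartial 0 3 F z
      = 12 * z 1 * M 2 (z 0 ^ 2 + z 1 ^ 2) + 8 * z 1 ^ 3 * M 3 (z 0 ^ 2 + z 1 ^ 2) := by
  rw [mixedPartial_succ_right]
  refine pderiv_one_eq (H := fun a b => 2 * (b ^ 0 * M 1 (a ^ 2 + b ^ 2))
    + 4 * (b ^ 2 * M 2 (a ^ 2 + b ^ 2))) h.isOpen_preimage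
    (fun y hy => by rw [h.partial_0_2 (by omega) hy]; ring) hz ?_
  exact (((h.hasDerivAt_right 0 (by omega) hz).const_mul 2).add
    ((h.hasDerivAt_right 2 (by omega) hz).const_mul 4)).congr_deriv (by push_cast; ring)

lemma partial_0_4 (h : RadialChain F M N W) (hN : 4 ≤ N) (hz : z 0 ^ 2 + z 1 ^ 2 ∈ W) :
    mixedPartial 0 4 F z = 12 * M 2 (z 0 ^ 2 + z 1 ^ 2) + 48 * z 1 ^ 2 * M 3 (z 0 ^ 2 + z 1 ^ 2)
      + 16 * z 1 ^ 4 * M 4 (z 0 ^ 2 + z 1 ^ 2) := by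
  rw [mixedPartial_succ_right]
  refine pderiv_one_eq (H := fun a b => 12 * (b ^ 1 * M 2 (a ^ 2 + b ^ 2))
    + 8 * (b ^ 3 * M 3 (a ^ 2 + b ^ 2))) h.isOpen_preimage
    (fun y hy => by rw [h.partial_0_3 (by omega) hy]; ring) hz ?_
  exact (((h.hasDerivAt_right 1 (by omega) hz).const_mul 12).add
    ((h.hasDerivAt_right 3 (by omega) hz).const_mul 8)).congr_deriv (by push_cast; ring)

lemma partial_1_0 (h : RadialChain F M N W) (hN : 1 ≤ N) (hz : z 0 ^ 2 + z 1 ^ 2 ∈ W) :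
    mixedPartial 1 0 F z = 2 * z 0 * M 1 (z 0 ^ 2 + z 1 ^ 2) := by
  rw [mixedPartial_succ_left]
  refine pderiv_zero_eq (H := fun a b => a ^ 0 * M 0 (a ^ 2 + b ^ 2)) h.isOpen_preimage
    (fun y _ => by rw [pow_zero, one_mul]; exact h.eq_coord y) hz ?_
  exact (h.hasDerivAt_left 0 (by omega) hz).congr_deriv (by push_cast; ring)

lemma partial_2_0 (h : RadialChain F M N W) (hN : 2 ≤ N) (hz : z 0 ^ 2 + z 1 ^ 2 ∈ W) :
    mixedPartial 2 0 F z = 2 * M 1 (z 0 ^ 2 + z 1 ^ 2) + 4 * z 0 ^ 2 * M 2 (z 0 ^ 2 + z 1 ^ 2) := by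
  rw [mixedPartial_succ_left]
  refine pderiv_zero_eq (H := fun a b => 2 * (a ^ 1 * M 1 (a ^ 2 + b ^ 2))) h.isOpen_preimage
    (fun y hy => by rw [h.partial_1_0 (by omega) hy]; ring) hz ?_
  exact ((h.hasDerivAt_left 1 (by omega) hz).const_mul 2).congr_deriv (by push_cast; ring)

lemma partial_3_0 (h : RadialChain F M N W) (hN : 3 ≤ N) (hz : z 0 ^ 2 + z 1 ^ 2 ∈ W) :
    mixedPartial 3 0 F z
      = 12 * z 0 * M 2 (z 0 ^ 2 + z 1 ^ 2) + 8 * z 0 ^ 3 * M 3 (z 0 ^ 2 + z 1 ^ 2) := by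
  rw [mixedPartial_succ_left]
  refine pderiv_zero_eq (H := fun a b => 2 * (a ^ 0 * M 1 (a ^ 2 + b ^ 2))
    + 4 * (a ^ 2 * M 2 (a ^ 2 + b ^ 2))) h.isOpen_preimage
    (fun y hy => by rw [h.partial_2_0 (by omega) hy]; ring) hz ?_
  exact (((h.hasDerivAt_left 0 (by omega) hz).const_mul 2).add
    ((h.hasDerivAt_left 2 (by omega) hz).const_mul 4)).congr_deriv (by push_cast; ring)

lemma partial_4_0 (h : RadialChain F M N W) (hN : 4 ≤ N) (hz : z 0 ^ 2 + z 1 ^ 2 ∈ W) :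
    mixedPartial 4 0 F z = 12 * M 2 (z 0 ^ 2 + z 1 ^ 2) + 48 * z 0 ^ 2 * M 3 (z 0 ^ 2 + z 1 ^ 2)
      + 16 * z 0 ^ 4 * M 4 (z 0 ^ 2 + z 1 ^ 2) := by
  rw [mixedPartial_succ_left]
  refine pderiv_zero_eq (H := fun a b => 12 * (a ^ 1 * M 2 (a ^ 2 + b ^ 2))
    + 8 * (a ^ 3 * M 3 (a ^ 2 + b ^ 2))) h.isOpen_preimage
    (fun y hy => by rw [h.partial_3_0 (by omega) hy]; ring) hz ?_
  exact (((h.hasDerivAt_left 1 (by omega) hz).const_mul 12).add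
    ((h.hasDerivAt_left 3 (by omega) hz).const_mul 8)).congr_deriv (by push_cast; ring)

lemma partial_1_1 (h : RadialChain F M N W) (hN : 2 ≤ N) (hz : z 0 ^ 2 + z 1 ^ 2 ∈ W) :
    mixedPartial 1 1 F z = 4 * z 0 * z 1 * M 2 (z 0 ^ 2 + z 1 ^ 2) := by
  rw [mixedPartial_succ_left]
  refine pderiv_zero_eq (H := fun a b => (2 * b) * (a ^ 0 * M 1 (a ^ 2 + b ^ 2))) h.isOpen_preimage
    (fun y hy => by rw [h.partial_0_1 (by omega) hy]; ring) hz ?_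
  exact ((h.hasDerivAt_left 0 (by omega) hz).const_mul (2 * z 1)).congr_deriv (by push_cast; ring)

lemma partial_2_1 (h : RadialChain F M N W) (hN : 3 ≤ N) (hz : z 0 ^ 2 + z 1 ^ 2 ∈ W) :
    mixedPartial 2 1 F z = 4 * z 1 * M 2 (z 0 ^ 2 + z 1 ^ 2)
      + 8 * z 0 ^ 2 * z 1 * M 3 (z 0 ^ 2 + z 1 ^ 2) := by
  rw [mixedPartial_succ_left]
  refine pderiv_zero_eq (H := fun a b => (4 * b) * (a ^ 1 * M 2 (a ^ 2 + b ^ 2))) h.isOpen_preimage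
    (fun y hy => by rw [h.partial_1_1 (by omega) hy]; ring) hz ?_
  exact ((h.hasDerivAt_left 1 (by omega) hz).const_mul (4 * z 1)).congr_deriv (by push_cast; ring)

lemma partial_3_1 (h : RadialChain F M N W) (hN : 4 ≤ N) (hz : z 0 ^ 2 + z 1 ^ 2 ∈ W) :
    mixedPartial 3 1 F z = 24 * z 0 * z 1 * M 3 (z 0 ^ 2 + z 1 ^ 2)
      + 16 * z 0 ^ 3 * z 1 * M 4 (z 0 ^ 2 + z 1 ^ 2) := by
  rw [mixedPartial_succ_left]
  refine pderiv_zero_eq (H := fun a b => (4 * b) * (a ^ 0 * M 2 (a ^ 2 + b ^ 2))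
    + (8 * b) * (a ^ 2 * M 3 (a ^ 2 + b ^ 2))) h.isOpen_preimage
    (fun y hy => by rw [h.partial_2_1 (by omega) hy]; ring) hz ?_
  exact (((h.hasDerivAt_left 0 (by omega) hz).const_mul (4 * z 1)).add
    ((h.hasDerivAt_left 2 (by omega) hz).const_mul (8 * z 1))).congr_deriv (by push_cast; ring)

lemma partial_1_2 (h : RadialChain F M N W) (hN : 3 ≤ N) (hz : z 0 ^ 2 + z 1 ^ 2 ∈ W) :
    mixedPartial 1 2 F z = 4 * z 0 * M 2 (z 0 ^ 2 + z 1 ^ 2)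
      + 8 * z 0 * z 1 ^ 2 * M 3 (z 0 ^ 2 + z 1 ^ 2) := by
  rw [mixedPartial_succ_left]
  refine pderiv_zero_eq (H := fun a b => 2 * (a ^ 0 * M 1 (a ^ 2 + b ^ 2))
    + (4 * b ^ 2) * (a ^ 0 * M 2 (a ^ 2 + b ^ 2))) h.isOpen_preimage
    (fun y hy => by rw [h.partial_0_2 (by omega) hy]; ring) hz ?_
  exact (((h.hasDerivAt_left 0 (by omega) hz).const_mul 2).add
    ((h.hasDerivAt_left 0 (by omega) hz).const_mul (4 * z 1 ^ 2))).congr_deriv (by push_cast; ring)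

lemma partial_2_2 (h : RadialChain F M N W) (hN : 4 ≤ N) (hz : z 0 ^ 2 + z 1 ^ 2 ∈ W) :
    mixedPartial 2 2 F z = 4 * M 2 (z 0 ^ 2 + z 1 ^ 2)
      + 8 * (z 0 ^ 2 + z 1 ^ 2) * M 3 (z 0 ^ 2 + z 1 ^ 2)
      + 16 * z 0 ^ 2 * z 1 ^ 2 * M 4 (z 0 ^ 2 + z 1 ^ 2) := by
  rw [mixedPartial_succ_left]
  refine pderiv_zero_eq (H := fun a b => 4 * (a ^ 1 * M 2 (a ^ 2 + b ^ 2))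
    + (8 * b ^ 2) * (a ^ 1 * M 3 (a ^ 2 + b ^ 2))) h.isOpen_preimage
    (fun y hy => by rw [h.partial_1_2 (by omega) hy]; ring) hz ?_
  exact (((h.hasDerivAt_left 1 (by omega) hz).const_mul 4).add
    ((h.hasDerivAt_left 1 (by omega) hz).const_mul (8 * z 1 ^ 2))).congr_deriv (by push_cast; ring)

lemma partial_1_3 (h : RadialChain F M N W) (hN : 4 ≤ N) (hz : z 0 ^ 2 + z 1 ^ 2 ∈ W) :
    mixedPartial 1 3 F z = 24 * z 0 * z 1 * M 3 (z 0 ^ 2 + z 1 ^ 2)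
      + 16 * z 0 * z 1 ^ 3 * M 4 (z 0 ^ 2 + z 1 ^ 2) := by
  rw [mixedPartial_succ_left]
  refine pderiv_zero_eq (H := fun a b => (12 * b) * (a ^ 0 * M 2 (a ^ 2 + b ^ 2))
    + (8 * b ^ 3) * (a ^ 0 * M 3 (a ^ 2 + b ^ 2))) h.isOpen_preimage
    (fun y hy => by rw [h.partial_0_3 (by omega) hy]; ring) hz ?_
  exact (((h.hasDerivAt_left 0 (by omega) hz).const_mul (12 * z 1)).add
    ((h.hasDerivAt_left 0 (by omega) hz).const_mul (8 * z 1 ^ 3))).congr_deriv (by push_cast; ring)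

end

lemma abs_coord_le (z : Plane) (i : Fin 2) : |z i| ≤ ‖z‖ := by
  simpa using PiLp.norm_apply_le z i

/-- Second order bounds for the profile from bounds for the second order partial derivatives. -/
lemma abs_deriv_le_of_partials (h : RadialChain F M N W) (hN : 2 ≤ N) {z : Plane} (hz0 : z ≠ 0)
    (hz : ‖z‖ ^ 2 ∈ W) {Q : ℝ} (hQ : ∀ a₁ a₂ : ℕ, a₁ + a₂ = 2 → |mixedPartial a₁ a₂ F z| ≤ Q) :
    |M 1 (‖z‖ ^ 2)| ≤ 2 * Q ∧ ‖z‖ ^ 2 * |M 2 (‖z‖ ^ 2)| ≤ 2 * Q := by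
  have hr : 0 < ‖z‖ := norm_pos_iff.2 hz0
  have e20 := h.partial_2_0 hN (norm_sq_eq z ▸ hz)
  have e11 := h.partial_1_1 hN (norm_sq_eq z ▸ hz)
  have e02 := h.partial_0_2 hN (norm_sq_eq z ▸ hz)
  rw [← norm_sq_eq] at e20 e11 e02
  have q20 := hQ 2 0 rfl
  have q11 := hQ 1 1 rfl
  have q02 := hQ 0 2 rfl
  have hQ0 : 0 ≤ Q := (abs_nonneg _).trans q20
  have a0 := abs_coord_le z 0
  have a1 := abs_coord_le z 1
  have hn := norm_sq_eq z
  set r := ‖z‖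
  -- The second derivative in the tangential direction `(z 1, -z 0)` does not see `M 2`; it equals
  -- `2 r² M 1`.
  have k1 : r ^ 2 * |M 1 (r ^ 2)| ≤ r ^ 2 * (2 * Q) := by
    have : r ^ 2 * M 1 (r ^ 2) = (z 1 ^ 2 * mixedPartial 2 0 F z - 2 * (z 0 * z 1) * mixedPartial 1 1 F z
        + z 0 ^ 2 * mixedPartial 0 2 F z) / 2 := by
      rw [e20, e11, e02]; generalize M 1 (r ^ 2) = m1; generalize M 2 (r ^ 2) = m2
      rw [hn]; ring
    rw [← abs_of_nonneg (sq_nonneg r), ← abs_mul, abs_of_nonneg (sq_nonneg r), this, abs_div, abs_two,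
      div_le_iff₀ two_pos]
    calc _ ≤ |z 1| ^ 2 * |mixedPartial 2 0 F z| + 2 * (|z 0| * |z 1|) * |mixedPartial 1 1 F z|
          + |z 0| ^ 2 * |mixedPartial 0 2 F z| := by
          refine (abs_add_le _ _).trans (add_le_add ((abs_sub _ _).trans (add_le_add ?_ ?_)) ?_) <;>
          simp [abs_mul]
      _ ≤ r ^ 2 * Q + 2 * (r * r) * Q + r ^ 2 * Q := by gcongr
      _ = _ := by ring
  have k1' : |M 1 (r ^ 2)| ≤ 2 * Q := le_of_mul_le_mul_left k1 (by positivity)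
  refine ⟨k1', ?_⟩
  -- The second derivative in the radial direction is `2 r² M 1 + 4 r⁴ M 2`, and `M 1` is already
  -- bounded.
  have k2 : r ^ 2 * (r ^ 2 * |M 2 (r ^ 2)|) ≤ r ^ 2 * (2 * Q) := by
    have : r ^ 2 * (r ^ 2 * M 2 (r ^ 2)) = (z 0 ^ 2 * mixedPartial 2 0 F z
        + 2 * (z 0 * z 1) * mixedPartial 1 1 F z
        + z 1 ^ 2 * mixedPartial 0 2 F z - 2 * r ^ 2 * M 1 (r ^ 2)) / 4 := by
      rw [e20, e11, e02]; generalize M 1 (r ^ 2) = m1; generalize M 2 (r ^ 2) = m2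
      rw [hn]; ring
    rw [show r ^ 2 * (r ^ 2 * |M 2 (r ^ 2)|) = |r ^ 2 * (r ^ 2 * M 2 (r ^ 2))| by
      rw [abs_mul, abs_mul, abs_of_nonneg (sq_nonneg r)], this, abs_div,
      abs_of_pos (show (0 : ℝ) < 4 by norm_num), div_le_iff₀ (by norm_num)]
    calc _ ≤ |z 0| ^ 2 * |mixedPartial 2 0 F z| + 2 * (|z 0| * |z 1|) * |mixedPartial 1 1 F z|
          + |z 1| ^ 2 * |mixedPartial 0 2 F z| + 2 * |r| ^ 2 * |M 1 (r ^ 2)| := by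
          refine (abs_sub _ _).trans (add_le_add ((abs_add_le _ _).trans (add_le_add
            ((abs_add_le _ _).trans (add_le_add ?_ ?_)) ?_)) ?_) <;>
          simp [abs_mul]
      _ ≤ r ^ 2 * Q + 2 * (r * r) * Q + r ^ 2 * Q + 2 * r ^ 2 * (2 * Q) := by
          rw [abs_of_pos hr]; gcongr
      _ = _ := by ring
  exact le_of_mul_le_mul_left k2 (by positivity)

/-- Coefficient count for the derivative taken twice radially and twice tangentially: `1 + 2 + 3 + 2
+ 1 = 9`. -/
lemma sum_abs_mixed_coeff_le {α γ r : ℝ} (hα : |α| ≤ r ^ 2) (hγ : |γ| ≤ r ^ 2) :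
    |α ^ 2| + |-2 * α * γ| + |γ ^ 2 - 2 * α ^ 2| + |2 * α * γ| + |α ^ 2| ≤ 9 * r ^ 4 := by
  have h1 : |α| * |γ| ≤ r ^ 2 * r ^ 2 := by gcongr
  have h2 : |α| ^ 2 ≤ (r ^ 2) ^ 2 := by gcongr
  have h3 : |γ| ^ 2 ≤ (r ^ 2) ^ 2 := by gcongr
  have h4 : |γ ^ 2 - 2 * α ^ 2| ≤ |γ| ^ 2 + 2 * |α| ^ 2 := by
    refine (abs_sub _ _).trans (le_of_eq ?_)
    rw [abs_pow, abs_mul 2, abs_two, abs_pow]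
  rw [abs_mul (-2 * α), abs_mul (-2), abs_mul (2 * α), abs_mul 2, abs_neg, abs_two, abs_pow]
  nlinarith

set_option maxHeartbeats 600000 in
/-- Fourth order bounds for the profile from bounds for the fourth order partial derivatives. -/
lemma abs_deriv_four_le_of_partials (h : RadialChain F M N W) (hN : 4 ≤ N) {z : Plane} (hz0 : z ≠ 0)
    (hz : ‖z‖ ^ 2 ∈ W) {Q : ℝ} (hQ : ∀ a₁ a₂ : ℕ, a₁ + a₂ = 4 → |mixedPartial a₁ a₂ F z| ≤ Q) :
    |M 2 (‖z‖ ^ 2)| ≤ 2 * Q ∧ ‖z‖ ^ 2 * |M 3 (‖z‖ ^ 2)| ≤ 3 * Q ∧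
      ‖z‖ ^ 4 * |M 4 (‖z‖ ^ 2)| ≤ 12 * Q := by
  have hr : 0 < ‖z‖ := norm_pos_iff.2 hz0
  have e40 := h.partial_4_0 hN (norm_sq_eq z ▸ hz)
  have e31 := h.partial_3_1 hN (norm_sq_eq z ▸ hz)
  have e22 := h.partial_2_2 hN (norm_sq_eq z ▸ hz)
  have e13 := h.partial_1_3 hN (norm_sq_eq z ▸ hz)
  have e04 := h.partial_0_4 hN (norm_sq_eq z ▸ hz)
  rw [← norm_sq_eq] at e40 e31 e22 e13 e04
  have q40 := hQ 4 0 rfl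
  have q31 := hQ 3 1 rfl
  have q22 := hQ 2 2 rfl
  have q13 := hQ 1 3 rfl
  have q04 := hQ 0 4 rfl
  have hQ0 : 0 ≤ Q := (abs_nonneg _).trans q40
  have a0 := abs_coord_le z 0
  have a1 := abs_coord_le z 1
  have hn := norm_sq_eq z
  set r := ‖z‖
  have five : ∀ c₀ c₁ c₂ c₃ c₄ T : ℝ, T = c₀ * mixedPartial 4 0 F z + c₁ * mixedPartial 3 1 F z
      + c₂ * mixedPartial 2 2 F z + c₃ * mixedPartial 1 3 F z + c₄ * mixedPartial 0 4 F z →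
      |T| ≤ (|c₀| + |c₁| + |c₂| + |c₃| + |c₄|) * Q := by
    intro c₀ c₁ c₂ c₃ c₄ T hT
    calc |T| ≤ |c₀ * mixedPartial 4 0 F z| + |c₁ * mixedPartial 3 1 F z| + |c₂ * mixedPartial 2 2 F z|
          + |c₃ * mixedPartial 1 3 F z| + |c₄ * mixedPartial 0 4 F z| := by
          rw [hT]
          exact (abs_add_le _ _).trans (add_le_add_left ((abs_add_le _ _).trans (add_le_add_left
            ((abs_add_le _ _).trans (add_le_add_left (abs_add_le _ _) _)) _)) _)
      _ ≤ |c₀| * Q + |c₁| * Q + |c₂| * Q + |c₃| * Q + |c₄| * Q := by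
          simp only [abs_mul]; gcongr
      _ = _ := by ring
  -- The fourth tangential derivative isolates `M 2`. The binomial coefficients sum to `16`, so `12
  -- |M 2| ≤ 16 Q`.
  have m2 : |M 2 (r ^ 2)| ≤ 2 * Q := by
    have e : r ^ 4 * (12 * M 2 (r ^ 2)) = z 1 ^ 4 * mixedPartial 4 0 F z
        + (-4 * z 1 ^ 3 * z 0) * mixedPartial 3 1 F z + (6 * z 1 ^ 2 * z 0 ^ 2) * mixedPartial 2 2 F z
        + (-4 * z 1 * z 0 ^ 3) * mixedPartial 1 3 F z + z 0 ^ 4 * mixedPartial 0 4 F z := by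
      rw [e40, e31, e22, e13, e04, show r ^ 4 = (r ^ 2) ^ 2 by ring]
      generalize M 2 (r ^ 2) = m2; generalize M 3 (r ^ 2) = m3; generalize M 4 (r ^ 2) = m4
      rw [hn]; ring
    have hb := five _ _ _ _ _ _ e
    have hc : |z 1 ^ 4| + |-4 * z 1 ^ 3 * z 0| + |6 * z 1 ^ 2 * z 0 ^ 2| + |-4 * z 1 * z 0 ^ 3|
        + |z 0 ^ 4| ≤ 16 * r ^ 4 := by
      simp only [abs_mul, abs_pow, abs_neg]
      calc _ ≤ r ^ 4 + |4| * r ^ 3 * r + |6| * r ^ 2 * r ^ 2 + |4| * r * r ^ 3 + r ^ 4 := by gcongr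
        _ = _ := by norm_num; ring
    rw [abs_mul, abs_mul, abs_of_pos (show 0 < r ^ 4 by positivity),
      abs_of_pos (show (0 : ℝ) < 12 by norm_num)] at hb
    have := hb.trans (mul_le_mul_of_nonneg_right hc hQ0)
    have h2 : r ^ 4 * |M 2 (r ^ 2)| ≤ r ^ 4 * (2 * Q) := by nlinarith [show 0 ≤ r ^ 4 * Q by positivity]
    exact le_of_mul_le_mul_left h2 (by positivity)
  -- Two radial and two tangential derivatives eliminate `M 4` and leave `M 3` together with the
  -- known `M 2`.
  have m3 : r ^ 2 * |M 3 (r ^ 2)| ≤ 3 * Q := by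
    have e : r ^ 4 * (8 * (r ^ 2 * M 3 (r ^ 2)) + 4 * M 2 (r ^ 2))
        = (z 0 * z 1) ^ 2 * mixedPartial 4 0 F z
        + (-2 * (z 0 * z 1) * (z 0 ^ 2 - z 1 ^ 2)) * mixedPartial 3 1 F z
        + ((z 0 ^ 2 - z 1 ^ 2) ^ 2 - 2 * (z 0 * z 1) ^ 2) * mixedPartial 2 2 F z
        + (2 * (z 0 * z 1) * (z 0 ^ 2 - z 1 ^ 2)) * mixedPartial 1 3 F z
        + (z 0 * z 1) ^ 2 * mixedPartial 0 4 F z := by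
      rw [e40, e31, e22, e13, e04, show r ^ 4 = (r ^ 2) ^ 2 by ring]
      generalize M 2 (r ^ 2) = m2; generalize M 3 (r ^ 2) = m3; generalize M 4 (r ^ 2) = m4
      rw [hn]; ring
    have hb := five _ _ _ _ _ _ e
    have hα : |z 0 * z 1| ≤ r ^ 2 := by
      rw [abs_mul, sq]; gcongr
    have hγ : |z 0 ^ 2 - z 1 ^ 2| ≤ r ^ 2 := by
      rw [abs_le, hn]; constructor <;> nlinarith [sq_nonneg (z 0), sq_nonneg (z 1)]
    have hc : |(z 0 * z 1) ^ 2| + |-2 * (z 0 * z 1) * (z 0 ^ 2 - z 1 ^ 2)|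
        + |(z 0 ^ 2 - z 1 ^ 2) ^ 2 - 2 * (z 0 * z 1) ^ 2| + |2 * (z 0 * z 1) * (z 0 ^ 2 - z 1 ^ 2)|
        + |(z 0 * z 1) ^ 2| ≤ 9 * r ^ 4 := by
      exact sum_abs_mixed_coeff_le hα hγ
    rw [abs_mul, abs_of_pos (show 0 < r ^ 4 by positivity)] at hb
    have h2 := hb.trans (mul_le_mul_of_nonneg_right hc hQ0)
    have h3 : |8 * (r ^ 2 * M 3 (r ^ 2)) + 4 * M 2 (r ^ 2)| ≤ 9 * Q :=
      le_of_mul_le_mul_left (h2.trans (le_of_eq (by ring))) (show 0 < r ^ 4 by positivity)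
    have h4 : 8 * (r ^ 2 * |M 3 (r ^ 2)|) ≤ |8 * (r ^ 2 * M 3 (r ^ 2)) + 4 * M 2 (r ^ 2)|
        + 4 * |M 2 (r ^ 2)| := by
      have := abs_sub (8 * (r ^ 2 * M 3 (r ^ 2)) + 4 * M 2 (r ^ 2)) (4 * M 2 (r ^ 2))
      rw [add_sub_cancel_right, abs_mul 8, abs_mul (r ^ 2), abs_of_pos (show 0 < r ^ 2 by positivity),
        abs_mul 4, abs_of_pos (show (0 : ℝ) < 8 by norm_num),
        abs_of_pos (show (0 : ℝ) < 4 by norm_num)] at this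
      exact this
    linarith
  refine ⟨m2, m3, ?_⟩
  -- The fourth radial derivative brings in `M 4`; the terms in `M 3` and `M 2` are subtracted by
  -- the bounds just found.
  have e : r ^ 4 * (16 * (r ^ 4 * M 4 (r ^ 2)) + (48 * (r ^ 2 * M 3 (r ^ 2)) + 12 * M 2 (r ^ 2)))
      = z 0 ^ 4 * mixedPartial 4 0 F z
      + (4 * z 0 ^ 3 * z 1) * mixedPartial 3 1 F z + (6 * z 0 ^ 2 * z 1 ^ 2) * mixedPartial 2 2 F z
      + (4 * z 0 * z 1 ^ 3) * mixedPartial 1 3 F z + z 1 ^ 4 * mixedPartial 0 4 F z := by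
    rw [e40, e31, e22, e13, e04, show r ^ 4 = (r ^ 2) ^ 2 by ring]
    generalize M 2 (r ^ 2) = m2; generalize M 3 (r ^ 2) = m3; generalize M 4 (r ^ 2) = m4
    rw [hn]; ring
  have hb := five _ _ _ _ _ _ e
  have hc : |z 0 ^ 4| + |4 * z 0 ^ 3 * z 1| + |6 * z 0 ^ 2 * z 1 ^ 2| + |4 * z 0 * z 1 ^ 3|
      + |z 1 ^ 4| ≤ 16 * r ^ 4 := by
    simp only [abs_mul, abs_pow]
    calc _ ≤ r ^ 4 + |4| * r ^ 3 * r + |6| * r ^ 2 * r ^ 2 + |4| * r * r ^ 3 + r ^ 4 := by gcongr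
      _ = _ := by norm_num; ring
  rw [abs_mul, abs_of_pos (show 0 < r ^ 4 by positivity)] at hb
  have h2 := hb.trans (mul_le_mul_of_nonneg_right hc hQ0)
  have h3 : |16 * (r ^ 4 * M 4 (r ^ 2)) + (48 * (r ^ 2 * M 3 (r ^ 2)) + 12 * M 2 (r ^ 2))| ≤ 16 * Q :=
    le_of_mul_le_mul_left (h2.trans (le_of_eq (by ring))) (show 0 < r ^ 4 by positivity)
  have h4 := abs_sub (16 * (r ^ 4 * M 4 (r ^ 2)) + (48 * (r ^ 2 * M 3 (r ^ 2)) + 12 * M 2 (r ^ 2)))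
    (48 * (r ^ 2 * M 3 (r ^ 2)) + 12 * M 2 (r ^ 2))
  have h5 := abs_add_le (48 * (r ^ 2 * M 3 (r ^ 2))) (12 * M 2 (r ^ 2))
  rw [add_sub_cancel_right, abs_mul 16, abs_mul (r ^ 4), abs_of_pos (show 0 < r ^ 4 by positivity),
    abs_of_pos (show (0 : ℝ) < 16 by norm_num)] at h4
  rw [abs_mul 48, abs_mul (r ^ 2), abs_of_pos (show 0 < r ^ 2 by positivity), abs_mul 12,
    abs_of_pos (show (0 : ℝ) < 48 by norm_num), abs_of_pos (show (0 : ℝ) < 12 by norm_num)] at h5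
  linarith

end RadialChain

/-! ### Covariance of distant divided differences -/

/-- Bounds for the derivatives `m₁, …, m₄` of the profile at squared distance `r²`, as needed for
differences of order `ℓ`. -/
structure ProfileBound (ℓ : ℕ) (M : ℕ → ℝ → ℝ) (r Q : ℝ) : Prop where
  one : |M 1 (r ^ 2)| ≤ Q
  two : r ^ 2 * |M 2 (r ^ 2)| ≤ Q
  two' : ℓ = 2 → |M 2 (r ^ 2)| ≤ Q
  three : ℓ = 2 → r ^ 2 * |M 3 (r ^ 2)| ≤ Q
  four : ℓ = 2 → r ^ 4 * |M 4 (r ^ 2)| ≤ Q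

/-- Here and in the next two lemmas the expression is a mixed derivative of `m (w s t)` with `w` the
squared chord. Each further derivative of the profile costs inverse powers of `r`, which are repaid
by first derivatives of `w`, each of size `O(r)`. The common factor `15` is what the order-four case
requires. -/
lemma abs_mixed_two_le {m₁ m₂ r Q E ws wt wst : ℝ} (hE : 1 ≤ E) (hQ : 0 ≤ Q)
    (h1 : |m₁| ≤ Q) (h2 : r ^ 2 * |m₂| ≤ Q) (hs : |ws| ≤ E * r) (ht : |wt| ≤ E * r)
    (hst : |wst| ≤ E) : |m₂ * wt * ws + m₁ * wst| ≤ 15 * E ^ 4 * Q := by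
  have hE0 : 0 ≤ E := by linarith
  have t1 : |m₂ * wt * ws| ≤ E ^ 4 * Q := by
    rw [abs_mul, abs_mul]
    have : 0 ≤ E * r := (abs_nonneg _).trans hs
    calc |m₂| * |wt| * |ws| ≤ |m₂| * (E * r) * (E * r) := by gcongr
      _ = E ^ 2 * (r ^ 2 * |m₂|) := by ring
      _ ≤ E ^ 4 * Q := by gcongr; norm_num
  have t2 : |m₁ * wst| ≤ E ^ 4 * Q := by
    rw [abs_mul]
    calc |m₁| * |wst| ≤ Q * E := by gcongr
      _ = E ^ 1 * Q := by ring
      _ ≤ E ^ 4 * Q := by gcongr; norm_num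
  have : 0 ≤ E ^ 4 * Q := by positivity
  linarith [abs_add_le (m₂ * wt * ws) (m₁ * wst)]

lemma abs_mixed_three_le {m₁ m₂ m₃ r Q E ws wt wst wtt wstt : ℝ} (hE : 1 ≤ E) (hQ : 0 ≤ Q)
    (hr0 : 0 ≤ r) (hr : r ≤ E)
    (h1 : |m₁| ≤ Q) (h2 : |m₂| ≤ Q) (h3 : r ^ 2 * |m₃| ≤ Q) (hs : |ws| ≤ E * r) (ht : |wt| ≤ E * r)
    (hst : |wst| ≤ E) (htt : |wtt| ≤ E) (hstt : |wstt| ≤ E) :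
    |m₃ * wt ^ 2 * ws + m₂ * wtt * ws + 2 * (m₂ * wt * wst) + m₁ * wstt| ≤ 15 * E ^ 4 * Q := by
  have hE0 : 0 ≤ E := by linarith
  have t1 : |m₃ * wt ^ 2 * ws| ≤ E ^ 4 * Q := by
    rw [abs_mul, abs_mul, abs_pow]
    calc |m₃| * |wt| ^ 2 * |ws| ≤ |m₃| * (E * r) ^ 2 * (E * r) := by gcongr
      _ = E ^ 3 * (r ^ 2 * |m₃|) * r := by ring
      _ ≤ E ^ 3 * Q * E := by gcongr
      _ = _ := by ring
  have t2 : ∀ p q : ℝ, |p| ≤ E → |q| ≤ E * r → |m₂ * p * q| ≤ E ^ 4 * Q := by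
    intro p q hp hq
    rw [abs_mul, abs_mul]
    calc |m₂| * |p| * |q| ≤ Q * E * (E * r) := by gcongr
      _ ≤ Q * E * (E * E) := by gcongr
      _ = E ^ 3 * Q := by ring
      _ ≤ E ^ 4 * Q := by gcongr; norm_num
  have t3 := t2 wtt ws htt hs
  have t4 := t2 wst wt hst ht
  have t5 : |m₁ * wstt| ≤ E ^ 4 * Q := by
    rw [abs_mul]
    calc |m₁| * |wstt| ≤ Q * E := by gcongr
      _ = E ^ 1 * Q := by ring
      _ ≤ E ^ 4 * Q := by gcongr; norm_num
  have : 0 ≤ E ^ 4 * Q := by positivity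
  rw [abs_le] at *
  constructor <;> nlinarith

/-- The coefficients `1 + 1 + 4 + 1 + 2 + 2 + 1 + 2 + 1 = 15` count the partitions of four
derivatives, omitting those whose blocks have three or more derivatives in total order beyond the
listed ones only through the symbols `wsst` and `wstt`. -/
lemma abs_mixed_four_le {m₁ m₂ m₃ m₄ r Q E ws wt wst wss wtt wsst wstt wsstt : ℝ} (hE : 1 ≤ E)
    (hQ : 0 ≤ Q) (hr0 : 0 ≤ r) (hr : r ≤ E)
    (h1 : |m₁| ≤ Q) (h2 : |m₂| ≤ Q) (h3 : r ^ 2 * |m₃| ≤ Q) (h4 : r ^ 4 * |m₄| ≤ Q)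
    (hs : |ws| ≤ E * r) (ht : |wt| ≤ E * r) (hst : |wst| ≤ E) (hss : |wss| ≤ E) (htt : |wtt| ≤ E)
    (hsst : |wsst| ≤ E) (hstt : |wstt| ≤ E) (hsstt : |wsstt| ≤ E) :
    |m₄ * wt ^ 2 * ws ^ 2 + m₃ * wtt * (ws * ws) + 4 * (m₃ * wst * (ws * wt)) + m₃ * wss * (wt * wt)
      + 2 * (m₂ * wst * wst) + 2 * (m₂ * wstt * ws) + m₂ * wtt * wss + 2 * (m₂ * wsst * wt)
      + m₁ * wsstt| ≤ 15 * E ^ 4 * Q := by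
  have hE0 : 0 ≤ E := by linarith
  have hEr : 0 ≤ E * r := by positivity
  have t1 : |m₄ * wt ^ 2 * ws ^ 2| ≤ E ^ 4 * Q := by
    rw [abs_mul, abs_mul, abs_pow, abs_pow]
    calc |m₄| * |wt| ^ 2 * |ws| ^ 2 ≤ |m₄| * (E * r) ^ 2 * (E * r) ^ 2 := by gcongr
      _ = E ^ 4 * (r ^ 4 * |m₄|) := by ring
      _ ≤ E ^ 4 * Q := by gcongr
  have t3 : ∀ p q q' : ℝ, |p| ≤ E → |q| ≤ E * r → |q'| ≤ E * r → |m₃ * p * (q * q')| ≤ E ^ 4 * Q := by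
    intro p q q' hp hq hq'
    rw [abs_mul, abs_mul, abs_mul]
    calc |m₃| * |p| * (|q| * |q'|) ≤ |m₃| * E * (E * r * (E * r)) := by gcongr
      _ = E ^ 3 * (r ^ 2 * |m₃|) := by ring
      _ ≤ E ^ 4 * Q := by gcongr; norm_num
  have t2 : ∀ p q : ℝ, |p| ≤ E → |q| ≤ E ^ 2 → |m₂ * p * q| ≤ E ^ 3 * Q := by
    intro p q hp hq
    rw [abs_mul, abs_mul]
    calc |m₂| * |p| * |q| ≤ Q * E * E ^ 2 := by gcongr
      _ = E ^ 3 * Q := by ring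
  have t2' : ∀ p q : ℝ, |p| ≤ E → |q| ≤ E → |m₂ * p * q| ≤ E ^ 2 * Q := by
    intro p q hp hq
    rw [abs_mul, abs_mul]
    calc |m₂| * |p| * |q| ≤ Q * E * E := by gcongr
      _ = E ^ 2 * Q := by ring
  have hErE : E * r ≤ E ^ 2 := by rw [sq]; gcongr
  have u1 := abs_le.1 (t3 wtt ws ws htt hs hs)
  have u2 := abs_le.1 (t3 wst ws wt hst hs ht)
  have u3 := abs_le.1 (t3 wss wt wt hss ht ht)
  have u4 := abs_le.1 (t2' wst wst hst hst)
  have u5 := abs_le.1 (t2 wstt ws hstt (hs.trans hErE))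
  have u6 := abs_le.1 (t2' wtt wss htt hss)
  have u7 := abs_le.1 (t2 wsst wt hsst (ht.trans hErE))
  have u8 : |m₁ * wsstt| ≤ E ^ 1 * Q := by
    rw [abs_mul]
    calc |m₁| * |wsstt| ≤ Q * E := by gcongr
      _ = E ^ 1 * Q := by ring
  have u8 := abs_le.1 u8
  have u0 := abs_le.1 t1
  have e1 : E ^ 1 * Q ≤ E ^ 4 * Q := by gcongr; norm_num
  have e2 : E ^ 2 * Q ≤ E ^ 4 * Q := by gcongr; norm_num
  have e3 : E ^ 3 * Q ≤ E ^ 4 * Q := by gcongr; norm_num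
  have e4 : 0 ≤ E ^ 4 * Q := by positivity
  rw [abs_le]
  constructor <;> linarith [u1.1, u1.2]

local notation "⟪" x ", " y "⟫" => inner ℝ x y

namespace RegularCurve

variable {c c₁ c₂ : ℝ → Plane} {L κ B : ℝ} {ℓ : ℕ}

lemma hasDerivAt_chord_right (h : RegularCurve c c₁ c₂ L κ B) (s : ℝ) {t : ℝ}
    (ht : t ∈ Set.Icc 0 L) : HasDerivAt (fun t => c s - c t) (-c₁ t) t :=
  ((hasDerivAt_const t (c s)).sub (h.hasDeriv t ht)).congr_deriv (by simp)

lemma hasDerivAt_chord_left (h : RegularCurve c c₁ c₂ L κ B) {s : ℝ} (t : ℝ)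
    (hs : s ∈ Set.Icc 0 L) : HasDerivAt (fun s => c s - c t) (c₁ s) s :=
  ((h.hasDeriv s hs).sub (hasDerivAt_const s (c t))).congr_deriv (by simp)

lemma hasDerivAt_inner_right (h : RegularCurve c c₁ c₂ L κ B) (s : ℝ) (v : Plane) {t : ℝ}
    (ht : t ∈ Set.Icc 0 L) : HasDerivAt (fun t => ⟪c s - c t, v⟫) (-⟪c₁ t, v⟫) t := by
  have := (h.hasDerivAt_chord_right s ht).inner ℝ (hasDerivAt_const t v)
  exact this.congr_deriv (by simp)

lemma hasDerivAt_speed_inner (h : RegularCurve c c₁ c₂ L κ B) (v : Plane) {t : ℝ}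
    (ht : t ∈ Set.Icc 0 L) : HasDerivAt (fun t => ⟪c₁ t, v⟫) ⟪c₂ t, v⟫ t := by
  have := (h.hasDeriv₁ t ht).inner ℝ (hasDerivAt_const t v)
  exact this.congr_deriv (by simp)

lemma hasDerivAt_normSq_right (h : RegularCurve c c₁ c₂ L κ B) (s : ℝ) {t : ℝ}
    (ht : t ∈ Set.Icc 0 L) :
    HasDerivAt (fun t => ‖c s - c t‖ ^ 2) (-(2 * ⟪c s - c t, c₁ t⟫)) t := by
  exact (h.hasDerivAt_chord_right s ht).norm_sq.congr_deriv (by simp)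

lemma hasDerivAt_normSq_left (h : RegularCurve c c₁ c₂ L κ B) {s : ℝ} (t : ℝ)
    (hs : s ∈ Set.Icc 0 L) :
    HasDerivAt (fun s => ‖c s - c t‖ ^ 2) (2 * ⟪c s - c t, c₁ s⟫) s :=
  (h.hasDerivAt_chord_left t hs).norm_sq

/-- The derivative of `⟪c s - c t, c₁ t⟫` in `t`. -/
lemma hasDerivAt_chord_inner_speed_right (h : RegularCurve c c₁ c₂ L κ B) (s : ℝ) {t : ℝ}
    (ht : t ∈ Set.Icc 0 L) :
    HasDerivAt (fun t => ⟪c s - c t, c₁ t⟫) (⟪c s - c t, c₂ t⟫ - ⟪c₁ t, c₁ t⟫) t := by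
  have := (h.hasDerivAt_chord_right s ht).inner ℝ (h.hasDeriv₁ t ht)
  exact this.congr_deriv (by simp; ring)

lemma hasDerivAt_chord_inner_speed_left (h : RegularCurve c c₁ c₂ L κ B) {s : ℝ} (t : ℝ)
    (hs : s ∈ Set.Icc 0 L) :
    HasDerivAt (fun s => ⟪c s - c t, c₁ s⟫) (⟪c s - c t, c₂ s⟫ + ⟪c₁ s, c₁ s⟫) s :=
  (h.hasDerivAt_chord_left t hs).inner ℝ (h.hasDeriv₁ s hs)

/-- Bound for the divided differences in both arguments of a radial function of the chord. -/
lemma abs_windowCov_radial_le (h : RegularCurve c c₁ c₂ L κ B) (hℓ : ℓ = 1 ∨ ℓ = 2)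
    {F : Plane → ℝ} {M : ℕ → ℝ → ℝ} {W : Set ℝ} (hF : RadialChain F M (2 * ℓ) W) {u u' δ : ℝ}
    (hw : Window L κ B ℓ u δ) (hw' : Window L κ B ℓ u' δ) {Q E : ℝ} (hQ : 0 ≤ Q) (hE : 1 ≤ E)
    (hE1 : 2 * B ≤ E) (hE2 : 2 * B ^ 2 + 2 * B * (B * L) ≤ E) (hE3 : B * L ≤ E)
    (hb : ∀ s ∈ Set.Icc u (u + ℓ * δ), ∀ t ∈ Set.Icc u' (u' + ℓ * δ),
      ‖c s - c t‖ ^ 2 ∈ W ∧ ProfileBound ℓ M ‖c s - c t‖ Q) :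
    |windowCov (fun x y => F (x - y)) c ℓ u u' δ|
      ≤ (4 / κ + 20 / κ ^ 2 + 12 * B / κ ^ 3) ^ 2 * (15 * E ^ 4 * Q) := by
  have hκ := h.pos
  have hB := h.nonneg hw
  set D : ℝ := 4 / κ + 20 / κ ^ 2 + 12 * B / κ ^ 3 with hD
  have hD0 : 0 ≤ D := by positivity
  have hI : Set.Icc u (u + ℓ * δ) ⊆ Set.Icc 0 L := Set.Icc_subset_Icc hw.nonneg hw.le
  have hI' : Set.Icc u' (u' + ℓ * δ) ⊆ Set.Icc 0 L := Set.Icc_subset_Icc hw'.nonneg hw'.le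
  have hℓ1 : 1 ≤ ℓ := by rcases hℓ with rfl | rfl <;> norm_num
  -- bounds for the scalar products
  have hip : ∀ {x y : Plane} {p q : ℝ}, ‖x‖ ≤ p → ‖y‖ ≤ q → |⟪x, y⟫| ≤ p * q := fun {x y p q} hx hy =>
    (abs_real_inner_le_norm x y).trans
      (mul_le_mul hx hy (norm_nonneg _) ((norm_nonneg _).trans hx))
  have hBB : 2 * B ^ 2 ≤ E := by
    have : 0 ≤ L := by
      have := hI ⟨le_rfl, by have := hw.pos; have : (0 : ℝ) ≤ ℓ * δ := by positivity
                             linarith⟩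
      exact this.1.trans this.2
    nlinarith [mul_nonneg hB (mul_nonneg hB this)]
  have hrle : ∀ s ∈ Set.Icc 0 L, ∀ t ∈ Set.Icc 0 L, ‖c s - c t‖ ≤ B * L := fun s hs t ht =>
    (h.dist_le hs ht).trans (mul_le_mul_of_nonneg_left
      (abs_le.2 ⟨by linarith [hs.1, ht.2], by linarith [hs.2, ht.1]⟩) hB)
  have b1 : ∀ (p : Plane) {s : ℝ}, s ∈ Set.Icc 0 L → |2 * ⟪p, c₁ s⟫| ≤ E * ‖p‖ := by
    intro p s hs
    rw [abs_mul, abs_two]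
    have := hip (le_refl ‖p‖) (h.speed_le s hs)
    nlinarith [norm_nonneg p]
  have b2 : ∀ {x y : Plane}, ‖x‖ ≤ B → ‖y‖ ≤ B → |2 * ⟪x, y⟫| ≤ E := by
    intro x y hx hy
    rw [abs_mul, abs_two]
    have := hip hx hy
    nlinarith
  have b3 : ∀ {p x y : Plane}, ‖p‖ ≤ B * L → ‖x‖ ≤ B → ‖y‖ ≤ B →
      |2 * (⟪p, x⟫ + ⟪y, y⟫)| ≤ E ∧ |2 * (⟪p, x⟫ - ⟪y, y⟫)| ≤ E := by
    intro p x y hp hx hy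
    have i1 := abs_le.1 (hip hp hx)
    have i2 := abs_le.1 (hip hy hy)
    constructor <;> rw [abs_le] <;> constructor <;> nlinarith
  -- the kernel and its derivatives
  set w : ℝ → ℝ → ℝ := fun s t => ‖c s - c t‖ ^ 2 with hw_def
  set Φ : ℝ → ℝ → ℝ := fun s t => M 0 (w s t) with hΦ
  set ws : ℝ → ℝ → ℝ := fun s t => 2 * ⟪c s - c t, c₁ s⟫ with hws
  set wt : ℝ → ℝ → ℝ := fun s t => -(2 * ⟪c s - c t, c₁ t⟫) with hwt
  set wss : ℝ → ℝ → ℝ := fun s t => 2 * (⟪c s - c t, c₂ s⟫ + ⟪c₁ s, c₁ s⟫) with hwss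
  set wtt : ℝ → ℝ → ℝ := fun s t => -(2 * (⟪c s - c t, c₂ t⟫ - ⟪c₁ t, c₁ t⟫)) with hwtt
  set wst : ℝ → ℝ → ℝ := fun s t => -(2 * ⟪c₁ t, c₁ s⟫) with hwst
  set wsst : ℝ → ℝ → ℝ := fun s t => -(2 * ⟪c₁ t, c₂ s⟫) with hwsst
  set wstt : ℝ → ℝ → ℝ := fun s t => -(2 * ⟪c₂ t, c₁ s⟫) with hwstt
  set wsstt : ℝ → ℝ → ℝ := fun s t => -(2 * ⟪c₂ t, c₂ s⟫) with hwsstt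
  have dw : ∀ s, ∀ t ∈ Set.Icc 0 L, HasDerivAt (w s) (wt s t) t := fun s t ht =>
    h.hasDerivAt_normSq_right s ht
  have dws : ∀ s, ∀ t ∈ Set.Icc 0 L, HasDerivAt (ws s) (wst s t) t := fun s t ht =>
    ((h.hasDerivAt_inner_right s (c₁ s) ht).const_mul 2).congr_deriv (by simp [hwst])
  have dwt : ∀ s, ∀ t ∈ Set.Icc 0 L, HasDerivAt (wt s) (wtt s t) t := fun s t ht =>
    ((h.hasDerivAt_chord_inner_speed_right s ht).const_mul 2).neg
  have dwss : ∀ s, ∀ t ∈ Set.Icc 0 L, HasDerivAt (wss s) (wsst s t) t := fun s t ht =>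
    (((h.hasDerivAt_inner_right s (c₂ s) ht).add_const _).const_mul 2).congr_deriv
      (by simp [hwsst])
  have dwst : ∀ s, ∀ t ∈ Set.Icc 0 L, HasDerivAt (wst s) (wstt s t) t := fun s t ht =>
    ((h.hasDerivAt_speed_inner (c₁ s) ht).const_mul 2).neg
  have dwsst : ∀ s, ∀ t ∈ Set.Icc 0 L, HasDerivAt (wsst s) (wsstt s t) t := fun s t ht =>
    ((h.hasDerivAt_speed_inner (c₂ s) ht).const_mul 2).neg
  have dM : ∀ k < 2 * ℓ, ∀ s ∈ Set.Icc u (u + ℓ * δ), ∀ t ∈ Set.Icc u' (u' + ℓ * δ),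
      HasDerivAt (fun t => M k (w s t)) (M (k + 1) (w s t) * wt s t) t := fun k hk s hs t ht =>
    (hF.hasDeriv k hk _ (hb s hs t ht).1).comp t (dw s t (hI' ht))
  have dMs : ∀ k < 2 * ℓ, ∀ s ∈ Set.Icc u (u + ℓ * δ), ∀ t ∈ Set.Icc u' (u' + ℓ * δ),
      HasDerivAt (fun s => M k (w s t)) (M (k + 1) (w s t) * ws s t) s := fun k hk s hs t ht =>
    (hF.hasDeriv k hk _ (hb s hs t ht).1).comp s (h.hasDerivAt_normSq_left t (hI hs))
  -- first argument derivative
  have hfirst : ∀ s ∈ Set.Icc u (u + ℓ * δ),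
      ‖∑ k ∈ Finset.range (ℓ + 1), nodeWeight c ℓ u' δ k •
        (fun t => M 1 (w s t) * ws s t) (u' + k * δ)‖ ≤ D * (15 * E ^ 4 * Q) := by
    intro s hs
    refine h.norm_sum_nodeWeight_smul_le hℓ hw' (E := ℝ) (M := 15 * E ^ 4 * Q)
      (g := fun t => M 1 (w s t) * ws s t)
      (g₁ := fun t => M 2 (w s t) * wt s t * ws s t + M 1 (w s t) * wst s t)
      (g₂ := fun t => M 3 (w s t) * wt s t ^ 2 * ws s t + M 2 (w s t) * wtt s t * ws s t
        + 2 * (M 2 (w s t) * wt s t * wst s t) + M 1 (w s t) * wstt s t) ?_ ?_ ?_ ?_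
    · intro t ht
      exact (dM 1 (by omega) s hs t ht).mul (dws s t (hI' ht))
    · intro t ht
      obtain ⟨-, hp⟩ := hb s hs t ht
      exact abs_mixed_two_le hE hQ hp.one hp.two (b1 _ (hI hs))
        (by rw [abs_neg]; exact b1 _ (hI' ht))
        (by rw [abs_neg]; exact b2 (h.speed_le _ (hI' ht)) (h.speed_le _ (hI hs)))
    · intro h2 t ht
      subst h2
      exact ((((dM 2 (by omega) s hs t ht).mul (dwt s t (hI' ht))).mul (dws s t (hI' ht))).add
        ((dM 1 (by omega) s hs t ht).mul (dwst s t (hI' ht)))).congr_deriv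
          (by simp only [Pi.mul_apply]; ring)
    · intro h2 t ht
      obtain ⟨-, hp⟩ := hb s hs t ht
      have hpr := hrle s (hI hs) t (hI' ht)
      exact abs_mixed_three_le hE hQ (norm_nonneg _) (hpr.trans hE3) hp.one (hp.two' h2) (hp.three h2)
        (b1 _ (hI hs)) (by rw [abs_neg]; exact b1 _ (hI' ht))
        (by rw [abs_neg]; exact b2 (h.speed_le _ (hI' ht)) (h.speed_le _ (hI hs)))
        (by rw [abs_neg]; exact (b3 hpr (h.norm_le _ (hI' ht)) (h.speed_le _ (hI' ht))).2)
        (by rw [abs_neg]; exact b2 (h.norm_le _ (hI' ht)) (h.speed_le _ (hI hs)))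
  -- For `ℓ = 2` the outer difference also needs the second derivative in `s`, so the kernel reaches
  -- order two in each variable.
  have hsecond : ℓ = 2 → ∀ s ∈ Set.Icc u (u + ℓ * δ),
      ‖∑ k ∈ Finset.range (ℓ + 1), nodeWeight c ℓ u' δ k •
        (fun t => M 2 (w s t) * ws s t ^ 2 + M 1 (w s t) * wss s t) (u' + k * δ)‖
        ≤ D * (15 * E ^ 4 * Q) := by
    intro h2 s hs
    refine h.norm_sum_nodeWeight_smul_le hℓ hw' (E := ℝ) (M := 15 * E ^ 4 * Q)
      (g := fun t => M 2 (w s t) * ws s t ^ 2 + M 1 (w s t) * wss s t)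
      (g₁ := fun t => M 3 (w s t) * ws s t ^ 2 * wt s t + M 2 (w s t) * wss s t * wt s t
        + 2 * (M 2 (w s t) * ws s t * wst s t) + M 1 (w s t) * wsst s t)
      (g₂ := fun t => M 4 (w s t) * wt s t ^ 2 * ws s t ^ 2 + M 3 (w s t) * wtt s t * (ws s t * ws s t)
        + 4 * (M 3 (w s t) * wst s t * (ws s t * wt s t)) + M 3 (w s t) * wss s t * (wt s t * wt s t)
        + 2 * (M 2 (w s t) * wst s t * wst s t) + 2 * (M 2 (w s t) * wstt s t * ws s t)
        + M 2 (w s t) * wtt s t * wss s t + 2 * (M 2 (w s t) * wsst s t * wt s t)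
        + M 1 (w s t) * wsstt s t) ?_ ?_ ?_ ?_
    · intro t ht
      exact (((dM 2 (by omega) s hs t ht).mul ((dws s t (hI' ht)).pow 2)).add
        ((dM 1 (by omega) s hs t ht).mul (dwss s t (hI' ht)))).congr_deriv
          (by simp only [Pi.pow_apply]; push_cast; ring)
    · intro t ht
      obtain ⟨-, hp⟩ := hb s hs t ht
      have hpr := hrle s (hI hs) t (hI' ht)
      exact abs_mixed_three_le hE hQ (norm_nonneg _) (hpr.trans hE3) hp.one (hp.two' h2) (hp.three h2)
        (by rw [abs_neg]; exact b1 _ (hI' ht)) (b1 _ (hI hs))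
        (by rw [abs_neg]; exact b2 (h.speed_le _ (hI' ht)) (h.speed_le _ (hI hs)))
        (b3 hpr (h.norm_le _ (hI hs)) (h.speed_le _ (hI hs))).1
        (by rw [abs_neg]; exact b2 (h.speed_le _ (hI' ht)) (h.norm_le _ (hI hs)))
    · intro _ t ht
      have e2 := dM 2 (by omega) s hs t ht
      have e1 := dM 1 (by omega) s hs t ht
      have e3 := dM 3 (by omega) s hs t ht
      have f1 := dws s t (hI' ht)
      have f2 := dwt s t (hI' ht)
      have f3 := dwss s t (hI' ht)
      have f4 := dwst s t (hI' ht)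
      have f5 := dwsst s t (hI' ht)
      exact ((((e3.mul (f1.pow 2)).mul f2).add ((e2.mul f3).mul f2)).add
        (((e2.mul f1).mul f4).const_mul 2) |>.add (e1.mul f5)).congr_deriv
          (by simp only [Pi.mul_apply, Pi.pow_apply]; push_cast; ring)
    · intro _ t ht
      obtain ⟨-, hp⟩ := hb s hs t ht
      have hpr := hrle s (hI hs) t (hI' ht)
      exact abs_mixed_four_le hE hQ (norm_nonneg _) (hpr.trans hE3) hp.one (hp.two' h2) (hp.three h2)
        (hp.four h2)
        (b1 _ (hI hs)) (by rw [abs_neg]; exact b1 _ (hI' ht))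
        (by rw [abs_neg]; exact b2 (h.speed_le _ (hI' ht)) (h.speed_le _ (hI hs)))
        (b3 hpr (h.norm_le _ (hI hs)) (h.speed_le _ (hI hs))).1
        (by rw [abs_neg]; exact (b3 hpr (h.norm_le _ (hI' ht)) (h.speed_le _ (hI' ht))).2)
        (by rw [abs_neg]; exact b2 (h.speed_le _ (hI' ht)) (h.norm_le _ (hI hs)))
        (by rw [abs_neg]; exact b2 (h.norm_le _ (hI' ht)) (h.speed_le _ (hI hs)))
        (by rw [abs_neg]; exact b2 (h.norm_le _ (hI' ht)) (h.norm_le _ (hI hs)))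
  have hnode : ∀ k ∈ Finset.range (ℓ + 1), u' + (k : ℝ) * δ ∈ Set.Icc u' (u' + ℓ * δ) := by
    intro k hk
    have hkℓ : (k : ℝ) ≤ ℓ := by exact_mod_cast Nat.lt_succ_iff.1 (Finset.mem_range.1 hk)
    have := hw.pos
    exact ⟨le_add_of_nonneg_right (by positivity), by gcongr⟩
  -- The divided difference bound is used a second time, now in `s`, for the function already
  -- differenced in `t`; differencing in `t` commutes with differentiating in `s`.
  have key := h.norm_sum_nodeWeight_smul_le hℓ hw (E := ℝ)
    (g := fun s => ∑ k ∈ Finset.range (ℓ + 1), nodeWeight c ℓ u' δ k * Φ s (u' + k * δ))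
    (g₁ := fun s => ∑ k ∈ Finset.range (ℓ + 1), nodeWeight c ℓ u' δ k *
      (M 1 (w s (u' + k * δ)) * ws s (u' + k * δ)))
    (g₂ := fun s => ∑ k ∈ Finset.range (ℓ + 1), nodeWeight c ℓ u' δ k *
      (M 2 (w s (u' + k * δ)) * ws s (u' + k * δ) ^ 2 + M 1 (w s (u' + k * δ)) * wss s (u' + k * δ)))
    (M := D * (15 * E ^ 4 * Q))
    (fun s hs => HasDerivAt.fun_sum fun k hk =>
      (dMs 0 (by omega) s hs _ (hnode k hk)).const_mul _)
    (fun s hs => hfirst s hs)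
    (fun h2 s hs => HasDerivAt.fun_sum fun k hk =>
      (((dMs 1 (by omega) s hs _ (hnode k hk)).mul
        ((h.hasDerivAt_chord_inner_speed_left (u' + k * δ) (hI hs)).const_mul 2)).congr_deriv
          (by simp only [hwss, hws]; ring)).const_mul _)
    (fun h2 s hs => hsecond h2 s hs)
  have e : windowCov (fun x y => F (x - y)) c ℓ u u' δ
      = ∑ k ∈ Finset.range (ℓ + 1), nodeWeight c ℓ u δ k •
        (fun s => ∑ k ∈ Finset.range (ℓ + 1), nodeWeight c ℓ u' δ k * Φ s (u' + k * δ)) (u + k * δ) := by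
    simp only [windowCov, smul_eq_mul, Finset.mul_sum]
    refine Finset.sum_congr rfl fun k _ => Finset.sum_congr rfl fun k' _ => ?_
    rw [hF.eq]; ring
  rw [e]
  calc _ ≤ D * (D * (15 * E ^ 4 * Q)) := key
    _ = _ := by ring

end RegularCurve

/-! ### The sampled curve -/

lemma exists_pos_le_deriv {φ : ℝ → ℝ} (hφ : ContDiff ℝ 2 φ) {L : ℝ} (hL : 0 < L)
    (hpos : ∀ s ∈ Set.Icc 0 L, 0 < deriv φ s) : ∃ p > 0, ∀ s ∈ Set.Icc 0 L, p ≤ deriv φ s := by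
  have hc : ContinuousOn (deriv φ) (Set.Icc 0 L) := (hφ.continuous_deriv (by norm_num)).continuousOn
  obtain ⟨s, hs, hmin⟩ := isCompact_Icc.exists_isMinOn (Set.nonempty_Icc.2 hL.le) hc
  exact ⟨_, hpos s hs, fun t ht => hmin ht⟩

lemma mul_abs_sub_le_of_le_deriv {φ : ℝ → ℝ} (hφ : ContDiff ℝ 2 φ) {L p : ℝ}
    (hp : ∀ s ∈ Set.Icc 0 L, p ≤ deriv φ s) (u : ℝ) (hu : u ∈ Set.Icc 0 L) (w : ℝ)
    (hw : w ∈ Set.Icc 0 L) (huw : u ≤ w) : p * (w - u) ≤ φ w - φ u :=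
  (convex_Icc 0 L).mul_sub_le_image_sub_of_le_deriv hφ.continuous.continuousOn
    (hφ.differentiable (by norm_num)).differentiableOn
    (fun x hx => hp x (interior_subset hx)) u hu w hw huw

/-- The curve `γ ∘ φ` of the theorem is regular. -/
lemma exists_regularCurve {ε L : ℝ} (hε : 0 < ε) (hL : 0 < L) {γ : ℝ → Plane}
    (hγ : ContDiffOn ℝ 2 γ (Set.Ioo (-ε) (L + ε)))
    (hγ_arc : ∀ t ∈ Set.Ioo (-ε) (L + ε), ‖deriv γ t‖ = 1) {C₃ : ℝ} (hC₃ : 0 < C₃)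
    (hγ_lower : ∀ s ∈ Set.Icc 0 L, ∀ t ∈ Set.Icc 0 L, C₃ * |s - t| ≤ ‖γ s - γ t‖)
    {φ : ℝ → ℝ} (hφ : ContDiff ℝ 2 φ) (hφ0 : φ 0 = 0) (hφL : φ L = L)
    (hφ_pos : ∀ s ∈ Set.Icc 0 L, 0 < deriv φ s) :
    (∀ s ∈ Set.Icc 0 L, φ s ∈ Set.Icc 0 L) ∧
    ∃ c₁ c₂ κ B, 0 < B ∧ RegularCurve (fun u => γ (φ u)) c₁ c₂ L κ B := by
  obtain ⟨p, hp0, hp⟩ := exists_pos_le_deriv hφ hL hφ_pos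
  have hmvt := mul_abs_sub_le_of_le_deriv hφ hp
  have h0mem : (0 : ℝ) ∈ Set.Icc 0 L := ⟨le_rfl, hL.le⟩
  have hLmem : L ∈ Set.Icc 0 L := ⟨hL.le, le_rfl⟩
  have hmaps : ∀ s ∈ Set.Icc 0 L, φ s ∈ Set.Icc 0 L := by
    intro s hs
    have h1 := hmvt 0 h0mem s hs hs.1
    have h2 := hmvt s hs L hLmem hs.2
    rw [hφ0] at h1; rw [hφL] at h2
    constructor
    · nlinarith [hs.1]
    · nlinarith [hs.2]
  refine ⟨hmaps, ?_⟩
  set c : ℝ → Plane := fun u => γ (φ u) with hc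
  set O : Set ℝ := φ ⁻¹' Set.Ioo (-ε) (L + ε) with hO
  have hOo : IsOpen O := isOpen_Ioo.preimage hφ.continuous
  have hsub : Set.Icc 0 L ⊆ O := fun s hs =>
    ⟨by linarith [(hmaps s hs).1], by linarith [(hmaps s hs).2]⟩
  have hcO : ContDiffOn ℝ 2 c O := hγ.comp hφ.contDiffOn fun s hs => hs
  have hd0 : DifferentiableOn ℝ c O := hcO.differentiableOn (by norm_num)
  have hc1 : ContDiffOn ℝ 1 (deriv c) O := hcO.deriv_of_isOpen hOo (by norm_num)
  have hd1 : DifferentiableOn ℝ (deriv c) O := hc1.differentiableOn (by norm_num)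
  have hc2 : ContDiffOn ℝ 0 (deriv (deriv c)) O := hc1.deriv_of_isOpen hOo (by norm_num)
  obtain ⟨B₁, hB₁⟩ := isCompact_Icc.exists_bound_of_continuousOn (hc1.continuousOn.mono hsub)
  obtain ⟨B₂, hB₂⟩ := isCompact_Icc.exists_bound_of_continuousOn (hc2.continuousOn.mono hsub)
  have hspeed : ∀ u ∈ Set.Icc 0 L, ‖deriv c u‖ = deriv φ u := by
    intro u hu
    have hγd : HasDerivAt γ (deriv γ (φ u)) (φ u) :=
      ((hγ.differentiableOn (by norm_num)).differentiableAt
        (isOpen_Ioo.mem_nhds (hsub hu))).hasDerivAt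
    have hφd : HasDerivAt φ (deriv φ u) u := (hφ.differentiable (by norm_num) u).hasDerivAt
    have : deriv c u = deriv φ u • deriv γ (φ u) := (hγd.scomp u hφd).deriv
    rw [this, norm_smul, hγ_arc _ (hsub hu), mul_one, Real.norm_of_nonneg (hφ_pos u hu).le]
  -- By arc length the speed of `c` is `φ'`, at least `p`, and chords are at least `C₃ |φ u - φ w| ≥
  -- C₃ p |u - w|`. The maximum with `1` only makes `B` positive.
  refine ⟨deriv c, deriv (deriv c), min p (C₃ * p), max (max B₁ B₂) 1, by positivity, ?_⟩
  constructor
  · positivity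
  · exact fun u hu => (hd0.differentiableAt (hOo.mem_nhds (hsub hu))).hasDerivAt
  · exact fun u hu => (hd1.differentiableAt (hOo.mem_nhds (hsub hu))).hasDerivAt
  · intro u hu
    rw [hspeed u hu]
    exact (min_le_left _ _).trans (hp u hu)
  · exact fun u hu => (hB₁ u hu).trans ((le_max_left _ _).trans (le_max_left _ _))
  · exact fun u hu => (hB₂ u hu).trans ((le_max_right _ _).trans (le_max_left _ _))
  · intro u hu w hw
    refine le_trans ?_ (hγ_lower _ (hmaps u hu) _ (hmaps w hw))
    have : p * |u - w| ≤ |φ u - φ w| := by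
      rcases le_total u w with h | h
      · rw [abs_sub_comm, abs_of_nonneg (sub_nonneg.2 h), abs_sub_comm]
        exact (hmvt u hu w hw h).trans (le_abs_self _)
      · rw [abs_of_nonneg (sub_nonneg.2 h)]
        exact (hmvt w hw u hu h).trans (le_abs_self _)
    calc min p (C₃ * p) * |u - w| ≤ C₃ * p * |u - w| := by gcongr; exact min_le_right _ _
      _ = C₃ * (p * |u - w|) := by ring
      _ ≤ _ := by gcongr

/-- The parameter of the `i`-th sampling point before applying the design function. -/
def baseNode (L : ℝ) (n i : ℕ) : ℝ := L * ((i : ℝ) - 1) / ((n : ℝ) - 1)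

/-- The spacing of the parameters entering a difference of lag `θ`. -/
def spacing (L : ℝ) (θ n : ℕ) : ℝ := θ * L / ((n : ℝ) - 1)

/-- With `φ` absorbed into the curve, the nodes of a lag-`θ` difference are equally spaced in the
parameter. -/
lemma samplePt_add_mul (φ : ℝ → ℝ) (L : ℝ) (n i θ k : ℕ) :
    samplePt φ L n (i + θ * k) = φ (baseNode L n i + k * spacing L θ n) := by
  rw [samplePt, baseNode, spacing]
  congr 1
  push_cast
  ring

lemma coeffB_eq (γ : ℝ → Plane) (φ : ℝ → ℝ) (L : ℝ) (θ ℓ n i k : ℕ) :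
    coeffB γ φ L θ ℓ n i k
      = nodeWeight (fun u => γ (φ u)) ℓ (baseNode L n i) (spacing L θ n) k := by
  simp only [coeffB, nodeWeight, dist2, nodeDist, samplePt_add_mul]
  rfl

lemma nablaTilde_eq {Ω : Type*} (X : Plane → Ω → ℝ) (γ : ℝ → Plane) (φ : ℝ → ℝ) (L : ℝ)
    (θ ℓ n i : ℕ) (ω : Ω) : nablaTilde X γ φ L θ ℓ n i ω = ∑ k ∈ Finset.range (ℓ + 1),
      nodeWeight (fun u => γ (φ u)) ℓ (baseNode L n i) (spacing L θ n) k *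
        X (γ (φ (baseNode L n i + k * spacing L θ n))) ω := by
  simp only [nablaTilde, coeffB_eq, samplePt_add_mul]

lemma fTilde_eq (βstar : ℝ) (γ : ℝ → Plane) (φ : ℝ → ℝ) (L : ℝ) (θ ℓ : ℕ) (ν : ℝ) (n : ℕ) :
    fTilde βstar γ φ L θ ℓ ν n = ∑ i ∈ Finset.Icc 1 (n - θ * ℓ),
      2 * βstar * irregularSum (fun u => γ (φ u)) ν ℓ (baseNode L n i) (spacing L θ n) := by
  simp only [fTilde, irregularSum, coeffB_eq, dist2, samplePt_add_mul, Finset.mul_sum]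

lemma VTilde_eq_sum_subtype {Ω : Type*} (X : Plane → Ω → ℝ) (γ : ℝ → Plane) (φ : ℝ → ℝ) (L : ℝ) (θ ℓ n : ℕ) :
    VTilde X γ φ L θ ℓ n
      = fun ω => ∑ i : Finset.Icc 1 (n - θ * ℓ), nablaTilde X γ φ L θ ℓ n i ω ^ 2 := by
  ext ω
  rw [VTilde, ← Finset.sum_coe_sort]

lemma spacing_bounds {L : ℝ} (hL : 0 < L) {θ : ℕ} (hθ : θ = 1 ∨ θ = 2) {n : ℕ} (hn : 2 ≤ n) :
    L ≤ spacing L θ n * n ∧ spacing L θ n * n ≤ 4 * L := by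
  have hn' : (2 : ℝ) ≤ n := by exact_mod_cast hn
  have h1 : 0 < (n : ℝ) - 1 := by linarith
  rw [spacing, div_mul_eq_mul_div, le_div_iff₀ h1, div_le_iff₀ h1]
  rcases hθ with rfl | rfl <;> push_cast <;> constructor <;> nlinarith

lemma window_of_mem {L κ B : ℝ} (hL : 0 < L) {θ ℓ : ℕ} (hθ : θ = 1 ∨ θ = 2)
    {n i : ℕ} (hn : 2 ≤ n) (hnθ : θ * ℓ ≤ n) (hi : i ∈ Finset.Icc 1 (n - θ * ℓ))
    (hs : 10 * B * spacing L θ n ≤ κ) : Window L κ B ℓ (baseNode L n i) (spacing L θ n) := by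
  have hn' : (2 : ℝ) ≤ n := by exact_mod_cast hn
  have h1 : 0 < (n : ℝ) - 1 := by linarith
  obtain ⟨i1, i2⟩ := Finset.mem_Icc.1 hi
  have i1' : (1 : ℝ) ≤ i := by exact_mod_cast i1
  have i2' : (i : ℝ) + θ * ℓ ≤ n := by
    have : i + θ * ℓ ≤ n := by omega
    exact_mod_cast this
  have hθ0 : (0 : ℝ) < θ := by rcases hθ with rfl | rfl <;> norm_num
  refine ⟨by rw [spacing]; positivity, hs, ?_, ?_⟩
  · rw [baseNode]
    exact div_nonneg (mul_nonneg hL.le (by linarith)) h1.le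
  · rw [baseNode, spacing, mul_div_assoc', ← add_div, div_le_iff₀ h1]
    nlinarith

/-! ### The generalized differences form a centred Gaussian process -/

section Gaussian

variable {Ω : Type*} [MeasurableSpace Ω] {P : Measure Ω} {X : Plane → Ω → ℝ}

lemma isGaussianProcess_nablaTilde (hX : IsGaussianProcess X P) (γ : ℝ → Plane) (φ : ℝ → ℝ) (L : ℝ)
    (θ ℓ n : ℕ) : IsGaussianProcess (nablaTilde X γ φ L θ ℓ n) P := by
  classical
  refine hX.of_isGaussianProcess fun i => ?_
  let p : ℕ → Plane := fun k => γ (samplePt φ L n (i + θ * k))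
  -- Sampled points may coincide, so the linear map sums over the indices `k` and not over the
  -- points of the image.
  refine ⟨(Finset.range (ℓ + 1)).image p, ∑ k ∈ (Finset.range (ℓ + 1)).attach,
    coeffB γ φ L θ ℓ n i k • ContinuousLinearMap.proj (R := ℝ)
      (φ := fun _ : ((Finset.range (ℓ + 1)).image p : Finset Plane) => ℝ)
      ⟨p k, Finset.mem_image_of_mem p k.2⟩, fun ω => ?_⟩
  rw [sum_apply, nablaTilde, ← Finset.sum_attach]
  rfl

lemma hasGaussianLaw_nablaTilde (hX : IsGaussianProcess X P) (γ : ℝ → Plane) (φ : ℝ → ℝ) (L : ℝ)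
    (θ ℓ n : ℕ) : HasGaussianLaw
      (fun ω (i : Finset.Icc 1 (n - θ * ℓ)) => nablaTilde X γ φ L θ ℓ n i ω) P :=
  (isGaussianProcess_nablaTilde hX γ φ L θ ℓ n).hasGaussianLaw _

lemma memLp_VTilde (hX : IsGaussianProcess X P) (γ : ℝ → Plane) (φ : ℝ → ℝ) (L : ℝ) (θ ℓ n : ℕ) :
    MemLp (VTilde X γ φ L θ ℓ n) 2 P :=
  memLp_finsetSum _ fun i _ =>
    memLp_sq ((isGaussianProcess_nablaTilde hX γ φ L θ ℓ n).hasGaussianLaw_eval i)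

lemma integral_nablaTilde (hX : IsStationaryIsotropicGaussianField P X) {γ : ℝ → Plane} {φ : ℝ → ℝ}
    {L : ℝ} {θ ℓ n i : ℕ} (h0 : ∑ k ∈ Finset.range (ℓ + 1),
      nodeWeight (fun u => γ (φ u)) ℓ (baseNode L n i) (spacing L θ n) k = 0) :
    ∫ ω, nablaTilde X γ φ L θ ℓ n i ω ∂P = 0 := by
  obtain ⟨μ, hμ⟩ := hX.mean_const
  simp only [nablaTilde_eq]
  rw [integral_finsetSum _ fun k _ => ((hX.gaussian.hasGaussianLaw_eval _).integrable.const_mul _)]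
  simp only [integral_const_mul, hμ, ← Finset.sum_mul, h0, zero_mul]

variable [IsProbabilityMeasure P]

lemma covariance_nablaTilde (hX : IsGaussianProcess X P) (γ : ℝ → Plane) (φ : ℝ → ℝ) (L : ℝ)
    (θ ℓ n i j : ℕ) : covariance (nablaTilde X γ φ L θ ℓ n i) (nablaTilde X γ φ L θ ℓ n j) P
      = windowCov (covFun P X) (fun u => γ (φ u)) ℓ (baseNode L n i) (baseNode L n j)
        (spacing L θ n) := by
  have hLp : ∀ x, MemLp (X x) 2 P := fun x => (hX.hasGaussianLaw_eval x).memLp_two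
  rw [funext (nablaTilde_eq X γ φ L θ ℓ n i), funext (nablaTilde_eq X γ φ L θ ℓ n j),
    covariance_fun_sum_fun_sum' (fun k _ => (hLp _).const_mul _) (fun k _ => (hLp _).const_mul _)]
  simp only [covariance_const_mul_left, covariance_const_mul_right, windowCov, covFun]
  refine Finset.sum_congr rfl fun k _ => Finset.sum_congr rfl fun k' _ => by ring

end Gaussian

/-! ### Asymptotics of the expected quadratic variation -/

/-- Only `βstar ≠ 0` is known, so the sign of the leading term has to come from `hpos`: a negative
principal term would dominate the error and make a variance negative. -/
lemma RegularCurve.windowCov_diag_asymp {c c₁ c₂ : ℝ → Plane} {L κ B : ℝ} {ℓ : ℕ} {ν : ℝ}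
    {K : Plane → Plane → ℝ} {β : ℕ → ℝ} {βstar : ℝ}
    (h : RegularCurve c c₁ c₂ L κ B) (hB : 0 < B) (hℓ : ℓ = 1 ∨ ℓ = 2) (hν0 : 0 < ν) (hν : ν < ℓ)
    (hβ : βstar ≠ 0) (hK : HasCovarianceExpansion K ν β βstar)
    (hpos : ∀ u δ, 0 ≤ windowCov K c ℓ u u δ) :
    ∃ a b : ℝ, 0 < a ∧ 0 < b ∧ ∀ η > 0, ∃ δ₀ > 0, ∀ u δ, Window L κ B ℓ u δ → δ < δ₀ →
      a * δ ^ (2 * ν - 2 * ℓ) ≤ 2 * βstar * irregularSum c ν ℓ u δ ∧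
      2 * βstar * irregularSum c ν ℓ u δ ≤ b * δ ^ (2 * ν - 2 * ℓ) ∧
      |windowCov K c ℓ u u δ - 2 * βstar * irregularSum c ν ℓ u δ|
        ≤ η * δ ^ (2 * ν - 2 * ℓ) := by
  obtain ⟨q, hq, hirr⟩ := h.irregularSum_asymp hB hℓ hν0 hν
  obtain ⟨τ, hτ, A, hA, δ₁, hδ₁, hcov⟩ := h.abs_windowCov_sub_le hℓ hν0 hν hK
  have hκ := h.pos
  set p : ℝ := 2 * ν - 2 * ℓ with hp
  have hp0 : p < 0 := by rw [hp]; linarith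
  have hQ : 0 < |βstar * q| := abs_pos.2 (mul_ne_zero hβ hq)
  have hBp : 0 < B ^ p := Real.rpow_pos_of_pos hB _
  have hκp : 0 < κ ^ p := Real.rpow_pos_of_pos hκ _
  set a : ℝ := |βstar * q| * B ^ p with ha
  have ha0 : 0 < a := by positivity
  refine ⟨a, 3 * |βstar * q| * κ ^ p, ha0, by positivity, fun η hη => ?_⟩
  -- A relative error of one half confines the principal term between one and three times `βstar * q
  -- * d ^ p`.
  obtain ⟨δ₂, hδ₂, hirr⟩ := hirr (|q| / 2) (by positivity)
  -- This is the bound of `abs_windowCov_sub_le` divided by `δ ^ p`.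
  have hlim : Tendsto (fun δ : ℝ => A * (δ ^ (-p) + δ ^ τ)) (𝓝 0) (𝓝 0) := by
    have h1 : ContinuousAt (fun δ : ℝ => A * (δ ^ (-p) + δ ^ τ)) 0 :=
      ((Real.continuousAt_rpow_const 0 _ (Or.inr (by linarith))).add
        (Real.continuousAt_rpow_const 0 _ (Or.inr hτ.le))).const_mul A
    have := h1.tendsto
    simpa [Real.zero_rpow hτ.ne', Real.zero_rpow (neg_pos.2 hp0).ne'] using this
  obtain ⟨δ₃, hδ₃, hsmall⟩ := Metric.eventually_nhds_iff.1
    (hlim.eventually_le_const (show (0 : ℝ) < min η (a / 2) by positivity))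
  refine ⟨min δ₁ (min δ₂ δ₃), by positivity, fun u δ hw hδ => ?_⟩
  obtain ⟨hd1, hd2, hd3⟩ : δ < δ₁ ∧ δ < δ₂ ∧ δ < δ₃ := by
    simpa only [lt_min_iff] using hδ
  have hδ0 := hw.pos
  have hδp : 0 < δ ^ p := Real.rpow_pos_of_pos hδ0 _
  have hbd : |windowCov K c ℓ u u δ - 2 * βstar * irregularSum c ν ℓ u δ|
      ≤ min η (a / 2) * δ ^ p := by
    refine (hcov u δ hw hd1).trans ?_
    have := hsmall (y := δ) (by rw [Real.dist_eq, sub_zero, abs_of_pos hδ0]; exact hd3)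
    refine le_trans (le_of_eq ?_) (mul_le_mul_of_nonneg_right this hδp.le)
    rw [mul_assoc, add_mul, ← Real.rpow_add hδ0, ← Real.rpow_add hδ0, neg_add_cancel,
      Real.rpow_zero, show τ + p = 2 * ν + τ - 2 * ℓ by rw [hp]; ring]
  set d : ℝ := nodeDist c u δ 1 with hd
  have hl1 : 1 ≤ ℓ := by rcases hℓ with rfl | rfl <;> norm_num
  have hdl : κ * δ ≤ d := by
    have := h.le_nodeDist hw (k := 1) hl1
    rwa [Nat.cast_one, one_mul] at this
  have hdu : d ≤ B * δ := by
    have h0 := hw.mem (t := 0) le_rfl (Nat.cast_nonneg _)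
    have h1 := hw.mem (t := (1 : ℕ)) (Nat.cast_nonneg _) (by exact_mod_cast hl1)
    rw [zero_mul, add_zero] at h0
    refine (h.dist_le h0 h1).trans (le_of_eq ?_)
    rw [Nat.cast_one, one_mul, sub_add_cancel_left, abs_neg, abs_of_pos hδ0]
  have hd0 : 0 < d := (mul_pos hκ hδ0).trans_le hdl
  have hup : d ^ p ≤ κ ^ p * δ ^ p := by
    rw [← Real.mul_rpow hκ.le hδ0.le]
    exact Real.rpow_le_rpow_of_nonpos (mul_pos hκ hδ0) hdl hp0.le
  have hlo : B ^ p * δ ^ p ≤ d ^ p := by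
    rw [← Real.mul_rpow hB.le hδ0.le]
    exact Real.rpow_le_rpow_of_nonpos hd0 hdu hp0.le
  have hT : |2 * βstar * irregularSum c ν ℓ u δ - 2 * (βstar * q) * d ^ p|
      ≤ |βstar * q| * d ^ p := by
    have := mul_le_mul_of_nonneg_left (hirr u δ hw hd2) (abs_nonneg (2 * βstar))
    rw [← abs_mul] at this
    calc _ = |2 * βstar * (irregularSum c ν ℓ u δ - q * d ^ p)| := by congr 1; ring
      _ ≤ _ := this
      _ = _ := by rw [abs_mul, abs_mul, abs_two]; ring
  have hlo' : a * δ ^ p ≤ |βstar * q| * d ^ p := by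
    calc a * δ ^ p = |βstar * q| * (B ^ p * δ ^ p) := by rw [ha]; ring
      _ ≤ _ := mul_le_mul_of_nonneg_left hlo hQ.le
  have hup' : |βstar * q| * d ^ p ≤ |βstar * q| * (κ ^ p * δ ^ p) :=
    mul_le_mul_of_nonneg_left hup hQ.le
  have haδ : 0 < a * δ ^ p := by positivity
  have hbd2 : |windowCov K c ℓ u u δ - 2 * βstar * irregularSum c ν ℓ u δ| ≤ a * δ ^ p / 2 := by
    calc _ ≤ min η (a / 2) * δ ^ p := hbd
      _ ≤ a / 2 * δ ^ p := mul_le_mul_of_nonneg_right (min_le_right _ _) hδp.le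
      _ = _ := by ring
  have hv := hpos u δ
  rw [abs_le] at hT hbd2
  -- Otherwise the principal term is at most `-a * δ ^ p`, while the error is at most half of that
  -- in size, contradicting `hv`.
  have hsign : 0 < βstar * q := by
    by_contra hneg
    rw [abs_of_nonpos (not_lt.1 hneg)] at hT hlo'
    linarith [hT.2, hbd2.2]
  rw [abs_of_pos hsign] at hT hlo' hup' ⊢
  refine ⟨by linarith [hT.1], by linarith [hT.2], 
    hbd.trans (mul_le_mul_of_nonneg_right (min_le_left _ _) hδp.le)⟩

/-- Consequences for sums of uniformly comparable terms. -/
lemma sum_asymp_of_uniform {v T : ℕ → ℕ → ℝ} {N : ℕ → ℕ} {s a b : ℝ} (ha : 0 < a)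
    (hN : ∀ᶠ n : ℕ in atTop, (n : ℝ) ≤ 2 * N n ∧ N n ≤ n)
    (h : ∀ η > 0, ∀ᶠ n : ℕ in atTop, ∀ i ∈ Finset.Icc 1 (N n),
      a * (n : ℝ) ^ s ≤ T n i ∧ T n i ≤ b * (n : ℝ) ^ s ∧ |v n i - T n i| ≤ η * (n : ℝ) ^ s) :
    Tendsto (fun n => (∑ i ∈ Finset.Icc 1 (N n), v n i) / ∑ i ∈ Finset.Icc 1 (N n), T n i)
      atTop (𝓝 1) ∧
    SameOrder (fun n => ∑ i ∈ Finset.Icc 1 (N n), T n i) (fun n => (n : ℝ) ^ (s + 1)) ∧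
    (∃ C : ℝ, 0 < C ∧ ∀ᶠ n : ℕ in atTop, ∀ i ∈ Finset.Icc 1 (N n), v n i ≤ C * (n : ℝ) ^ s) ∧
    ∃ c : ℝ, 0 < c ∧ ∀ᶠ n : ℕ in atTop,
      c * (n : ℝ) ^ (s + 1) ≤ ∑ i ∈ Finset.Icc 1 (N n), v n i := by
  have hsum : ∀ η > 0, ∀ᶠ n : ℕ in atTop,
      a / 2 * (n : ℝ) ^ (s + 1) ≤ ∑ i ∈ Finset.Icc 1 (N n), T n i ∧
      ∑ i ∈ Finset.Icc 1 (N n), T n i ≤ |b| * (n : ℝ) ^ (s + 1) ∧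
      |∑ i ∈ Finset.Icc 1 (N n), v n i - ∑ i ∈ Finset.Icc 1 (N n), T n i|
        ≤ η * (n : ℝ) ^ (s + 1) := by
    intro η hη
    filter_upwards [hN, h η hη, eventually_gt_atTop 0] with n hn h' hn0
    have hn0' : (0 : ℝ) < n := by exact_mod_cast hn0
    have hNn : (N n : ℝ) ≤ n := by exact_mod_cast hn.2
    have hns : 0 < (n : ℝ) ^ s := Real.rpow_pos_of_pos hn0' _
    have hcard : ∀ x : ℝ, ∑ _i ∈ Finset.Icc 1 (N n), x = N n * x := by
      intro x; simp
    rw [Real.rpow_add_one hn0'.ne']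
    refine ⟨?_, ?_, ?_⟩
    -- At least `n / 2` terms are summed, which halves the lower constant.
    · calc a / 2 * ((n : ℝ) ^ s * n) ≤ a / 2 * ((n : ℝ) ^ s * (2 * N n)) := by gcongr; exact hn.1
        _ = ∑ _i ∈ Finset.Icc 1 (N n), a * (n : ℝ) ^ s := by rw [hcard]; ring
        _ ≤ _ := Finset.sum_le_sum fun i hi => (h' i hi).1
    · calc _ ≤ ∑ _i ∈ Finset.Icc 1 (N n), |b| * (n : ℝ) ^ s :=
            Finset.sum_le_sum fun i hi => (h' i hi).2.1.trans (by gcongr; exact le_abs_self b)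
        _ = |b| * ((n : ℝ) ^ s * N n) := by rw [hcard]; ring
        _ ≤ _ := by gcongr
    · rw [← Finset.sum_sub_distrib]
      calc _ ≤ ∑ i ∈ Finset.Icc 1 (N n), |v n i - T n i| := Finset.abs_sum_le_sum_abs _ _
        _ ≤ ∑ _i ∈ Finset.Icc 1 (N n), η * (n : ℝ) ^ s := Finset.sum_le_sum fun i hi => (h' i hi).2.2
        _ = η * ((n : ℝ) ^ s * N n) := by rw [hcard]; ring
        _ ≤ _ := by gcongr
  have hpow : ∀ᶠ n : ℕ in atTop, 0 < (n : ℝ) ^ (s + 1) := by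
    filter_upwards [eventually_gt_atTop 0] with n hn
    exact Real.rpow_pos_of_pos (by exact_mod_cast hn) _
  refine ⟨?_, ⟨a / 2, |b|, by positivity, ?_⟩, ⟨|b| + 1, by positivity, ?_⟩, a / 4, by positivity, ?_⟩
  · rw [Metric.tendsto_nhds]
    intro ε hε
    filter_upwards [hsum (a / 4 * ε) (by positivity), hpow] with n hn hn0
    have hT : 0 < ∑ i ∈ Finset.Icc 1 (N n), T n i := lt_of_lt_of_le (by positivity) hn.1
    rw [Real.dist_eq, div_sub_one hT.ne', abs_div, abs_of_pos hT, div_lt_iff₀ hT]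
    refine hn.2.2.trans_lt ?_
    nlinarith [mul_le_mul_of_nonneg_left hn.1 hε.le, mul_pos (mul_pos ha hε) hn0]
  · filter_upwards [hsum 1 one_pos, hpow] with n hn hn0
    exact ⟨(le_div_iff₀ hn0).2 hn.1, (div_le_iff₀ hn0).2 hn.2.1⟩
  · filter_upwards [h 1 one_pos, eventually_gt_atTop 0] with n hn hn0 i hi
    have hns : 0 < (n : ℝ) ^ s := Real.rpow_pos_of_pos (by exact_mod_cast hn0) _
    obtain ⟨-, h2, h3⟩ := hn i hi
    have h4 := (abs_le.1 h3).2
    have : b * (n : ℝ) ^ s ≤ |b| * (n : ℝ) ^ s := by gcongr; exact le_abs_self b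
    linarith
  · filter_upwards [hsum (a / 4) (by positivity)] with n hn
    have := (abs_le.1 hn.2.2).1
    linarith [hn.1]

lemma tendsto_spacing (L : ℝ) (θ : ℕ) : Tendsto (spacing L θ) atTop (𝓝 0) :=
  (tendsto_atTop_add_const_right _ (-1) tendsto_natCast_atTop_atTop).const_div_atTop _

lemma eventually_window {L κ B : ℝ} (hL : 0 < L) (hκ : 0 < κ) {θ : ℕ} (hθ : θ = 1 ∨ θ = 2) (ℓ : ℕ) :
    ∀ᶠ n : ℕ in atTop, ∀ i ∈ Finset.Icc 1 (n - θ * ℓ),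
      Window L κ B ℓ (baseNode L n i) (spacing L θ n) := by
  have h1 : Tendsto (fun n => 10 * B * spacing L θ n) atTop (𝓝 0) := by
    simpa using (tendsto_spacing L θ).const_mul (10 * B)
  filter_upwards [eventually_ge_atTop 2, eventually_ge_atTop (θ * ℓ),
    h1.eventually_le_const hκ] with n h2 h3 h4 i hi
  exact window_of_mem hL hθ h2 h3 hi h4

section

variable {Ω : Type*} [MeasurableSpace Ω] {P : Measure Ω} {X : Plane → Ω → ℝ}

variable {γ : ℝ → Plane} {φ : ℝ → ℝ} {L κ B ν βstar : ℝ} {θ ℓ : ℕ} {c₁ c₂ : ℝ → Plane} {β : ℕ → ℝ}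

lemma eventually_integral_nablaTilde (hX : IsStationaryIsotropicGaussianField P X)
    (h : RegularCurve (fun u => γ (φ u)) c₁ c₂ L κ B) (hL : 0 < L) (hθ : θ = 1 ∨ θ = 2)
    (hℓ : ℓ = 1 ∨ ℓ = 2) : ∀ᶠ n : ℕ in atTop, ∀ i ∈ Finset.Icc 1 (n - θ * ℓ),
      ∫ ω, nablaTilde X γ φ L θ ℓ n i ω ∂P = 0 := by
  filter_upwards [eventually_window hL h.pos hθ ℓ] with n hn i hi
  exact integral_nablaTilde hX (h.sum_nodeWeight hℓ (hn i hi))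

variable [IsProbabilityMeasure P]

lemma windowCov_self_nonneg (hX : IsGaussianProcess X P) (c : ℝ → Plane) (ℓ : ℕ) (u δ : ℝ) :
    0 ≤ windowCov (covFun P X) c ℓ u u δ := by
  have hLp : ∀ x, MemLp (X x) 2 P := fun x => (hX.hasGaussianLaw_eval x).memLp_two
  let Y : Ω → ℝ := fun ω => ∑ k ∈ Finset.range (ℓ + 1), nodeWeight c ℓ u δ k * X (c (u + k * δ)) ω
  have hY : AEMeasurable Y P :=
    Finset.aemeasurable_fun_sum _ fun k _ => ((hLp _).aestronglyMeasurable.aemeasurable.const_mul _)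
  have : windowCov (covFun P X) c ℓ u u δ = variance Y P := by
    rw [← covariance_self hY, covariance_fun_sum_fun_sum' (fun k _ => (hLp _).const_mul _)
      (fun k _ => (hLp _).const_mul _)]
    simp only [covariance_const_mul_left, covariance_const_mul_right, windowCov, covFun]
    exact Finset.sum_congr rfl fun k _ => Finset.sum_congr rfl fun k' _ => by ring
  rw [this]
  exact variance_nonneg _ _

lemma integral_VTilde (hX : IsStationaryIsotropicGaussianField P X) {n : ℕ}
    (h0 : ∀ i ∈ Finset.Icc 1 (n - θ * ℓ),
      ∫ ω, nablaTilde X γ φ L θ ℓ n i ω ∂P = 0) :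
    ∫ ω, VTilde X γ φ L θ ℓ n ω ∂P = ∑ i ∈ Finset.Icc 1 (n - θ * ℓ),
      windowCov (covFun P X) (fun u => γ (φ u)) ℓ (baseNode L n i) (baseNode L n i)
        (spacing L θ n) := by
  rw [VTilde_eq_sum_subtype, integral_sum_sq (hasGaussianLaw_nablaTilde hX.gaussian γ φ L θ ℓ n)
    fun i => h0 i i.2, ← Finset.sum_coe_sort (Finset.Icc 1 (n - θ * ℓ))]
  refine Finset.sum_congr rfl fun i _ => ?_
  rw [← covariance_nablaTilde hX.gaussian γ φ L θ, covariance_self]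
  exact ((isGaussianProcess_nablaTilde hX.gaussian γ φ L θ ℓ n).hasGaussianLaw_eval i).aemeasurable

/-- The first two conclusions of the theorem, together with the bounds on the variances of the
differences which the law of large numbers needs. -/
lemma VTilde_expectation (hX : IsStationaryIsotropicGaussianField P X)
    (h : RegularCurve (fun u => γ (φ u)) c₁ c₂ L κ B) (hB : 0 < B) (hL : 0 < L)
    (hθ : θ = 1 ∨ θ = 2) (hℓ : ℓ = 1 ∨ ℓ = 2) (hν0 : 0 < ν) (hν : ν < ℓ) (hβ : βstar ≠ 0)
    (hK : HasCovarianceExpansion (covFun P X) ν β βstar) :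
    Tendsto (fun n : ℕ => (∫ ω, VTilde X γ φ L θ ℓ n ω ∂P) / fTilde βstar γ φ L θ ℓ ν n)
      atTop (𝓝 1) ∧
    SameOrder (fun n : ℕ => fTilde βstar γ φ L θ ℓ ν n)
      (fun n : ℕ => (n : ℝ) ^ (2 * (ℓ : ℝ) + 1 - 2 * ν)) ∧
    (∃ C : ℝ, 0 < C ∧ ∀ᶠ n : ℕ in atTop, ∀ i ∈ Finset.Icc 1 (n - θ * ℓ),
      variance (nablaTilde X γ φ L θ ℓ n i) P ≤ C * (n : ℝ) ^ (2 * (ℓ : ℝ) - 2 * ν)) ∧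
    ∃ c : ℝ, 0 < c ∧ ∀ᶠ n : ℕ in atTop,
      c * (n : ℝ) ^ (2 * (ℓ : ℝ) + 1 - 2 * ν) ≤ ∫ ω, VTilde X γ φ L θ ℓ n ω ∂P := by
  obtain ⟨a, b, ha, hb, hab⟩ := h.windowCov_diag_asymp hB hℓ hν0 hν hβ hK
    fun u δ => windowCov_self_nonneg hX.gaussian _ ℓ u δ
  set s : ℝ := 2 * ℓ - 2 * ν with hs
  have hs0 : 0 < s := by rw [hs]; linarith
  have he : 2 * (ℓ : ℝ) + 1 - 2 * ν = s + 1 := by rw [hs]; ring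
  have hp : 2 * ν - 2 * ℓ = -s := by rw [hs]; ring
  rw [he]
  rw [hp] at hab
  have hLs : 0 < L ^ (-s) := Real.rpow_pos_of_pos hL _
  have h4s : 0 < (4 * L) ^ (-s) := Real.rpow_pos_of_pos (by positivity) _
  have hN : ∀ᶠ n : ℕ in atTop, (n : ℝ) ≤ 2 * ((n - θ * ℓ : ℕ) : ℝ) ∧ n - θ * ℓ ≤ n := by
    filter_upwards [eventually_ge_atTop (2 * (θ * ℓ))] with n hn
    refine ⟨?_, Nat.sub_le _ _⟩
    have : n ≤ 2 * (n - θ * ℓ) := by omega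
    exact_mod_cast this
  have key := sum_asymp_of_uniform (s := s) (a := a * (4 * L) ^ (-s)) (b := b * L ^ (-s))
    (v := fun n i => windowCov (covFun P X) (fun u => γ (φ u)) ℓ (baseNode L n i)
      (baseNode L n i) (spacing L θ n))
    (T := fun n i => 2 * βstar * irregularSum (fun u => γ (φ u)) ν ℓ (baseNode L n i)
      (spacing L θ n)) (by positivity) hN ?_
  · have hE : ∀ᶠ n : ℕ in atTop, ∫ ω, VTilde X γ φ L θ ℓ n ω ∂P = ∑ i ∈ Finset.Icc 1 (n - θ * ℓ),
        windowCov (covFun P X) (fun u => γ (φ u)) ℓ (baseNode L n i) (baseNode L n i)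
          (spacing L θ n) := by
      filter_upwards [eventually_integral_nablaTilde hX h hL hθ hℓ] with n hn
      exact integral_VTilde hX hn
    obtain ⟨k1, k2, ⟨C, hC, k3⟩, c, hc, k4⟩ := key
    refine ⟨?_, ?_, ⟨C, hC, ?_⟩, c, hc, ?_⟩
    · refine k1.congr' ?_
      filter_upwards [hE] with n hn
      rw [hn, fTilde_eq]
    · simp only [fTilde_eq]
      exact k2
    · filter_upwards [k3] with n hn i hi
      rw [← covariance_self, covariance_nablaTilde hX.gaussian]
      · exact hn i hi
      · exact ((isGaussianProcess_nablaTilde hX.gaussian γ φ L θ ℓ n).hasGaussianLaw_eval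
          i).aemeasurable
    · filter_upwards [k4, hE] with n hn hn'
      rw [hn']
      exact hn
  · intro η hη
    -- Dividing by `L ^ (-s)` compensates the passage from powers of the spacing to powers of `n`.
    obtain ⟨δ₀, hδ₀, hab⟩ := hab (η / L ^ (-s)) (by positivity)
    filter_upwards [eventually_window (B := B) hL h.pos hθ ℓ, eventually_ge_atTop 2,
      (tendsto_spacing L θ).eventually_lt_const hδ₀] with n hw hn2 hδ i hi
    obtain ⟨b1, b2, b3⟩ := hab _ _ (hw i hi) hδ
    obtain ⟨s1, s2⟩ := spacing_bounds hL hθ hn2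
    have hn0 : (0 : ℝ) < n := by exact_mod_cast (by omega : 0 < n)
    have hδ0 := (hw i hi).pos
    have e : spacing L θ n ^ (-s) = (spacing L θ n * n) ^ (-s) * (n : ℝ) ^ s := by
      rw [Real.mul_rpow hδ0.le hn0.le, mul_assoc, ← Real.rpow_add hn0, neg_add_cancel,
        Real.rpow_zero, mul_one]
    have hns : 0 < (n : ℝ) ^ s := Real.rpow_pos_of_pos hn0 _
    have u1 : (4 * L) ^ (-s) * (n : ℝ) ^ s ≤ spacing L θ n ^ (-s) := by
      rw [e]
      exact mul_le_mul_of_nonneg_right (Real.rpow_le_rpow_of_nonpos (by positivity) s2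
        (by linarith)) hns.le
    have u2 : spacing L θ n ^ (-s) ≤ L ^ (-s) * (n : ℝ) ^ s := by
      rw [e]
      exact mul_le_mul_of_nonneg_right (Real.rpow_le_rpow_of_nonpos hL s1 (by linarith)) hns.le
    refine ⟨?_, ?_, ?_⟩
    · rw [mul_assoc]
      exact (mul_le_mul_of_nonneg_left u1 ha.le).trans b1
    · exact b2.trans ((mul_le_mul_of_nonneg_left u2 hb.le).trans_eq (mul_assoc _ _ _).symm)
    · refine b3.trans ((mul_le_mul_of_nonneg_left u2 (by positivity)).trans (le_of_eq ?_))
      rw [← mul_assoc, div_mul_cancel₀ _ hLs.ne']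

end

/-! ### Decay of the covariances of the differences -/

/-- `W` is the set of points where the profile is `C^N`. It is open because `N` is finite, and it
contains the squared norms of the nonzero points of `U`. -/
lemma exists_radialChain {F : Plane → ℝ} (hF : ∀ x y, ‖x‖ = ‖y‖ → F x = F y) {U : Set Plane}
    (hU : IsOpen U) {N : ℕ} (h : ∀ a₁ a₂ : ℕ, a₁ + a₂ = N →
      MixedPartialExistsOn a₁ a₂ F U ∧ ContinuousOn (mixedPartial a₁ a₂ F) U) :
    ∃ M W, RadialChain F M N W ∧ ∀ z ∈ U, z ≠ 0 → ‖z‖ ^ 2 ∈ W := by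
  have hO : IsOpen {w | ContDiffAt ℝ N (radialProfile F) w} := isOpen_iff_mem_nhds.2 fun w hw =>
    ContDiffAt.eventually hw (by simp)
  refine ⟨fun k => iteratedDeriv k (radialProfile F), {w | ContDiffAt ℝ N (radialProfile F) w},
    ⟨hO, fun k hk w hw => ?_, fun z => ?_⟩, fun z hz hz0 => ?_⟩
  · exact hasDerivAt_iteratedDeriv hO (fun w hw => ContDiffAt.contDiffWithinAt hw) hk hw
  · rw [iteratedDeriv_zero]
    exact radialProfile_norm_sq hF z
  · exact contDiffAt_radialProfile hF hU (h 0 N (zero_add N)).1 (h 0 N (zero_add N)).2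
      (h N 0 (add_zero N)).1 (h N 0 (add_zero N)).2 hz hz0

/-- The factor `12` is the largest of the constants in the second and fourth order estimates. -/
lemma RadialChain.profileBound {F : Plane → ℝ} {M : ℕ → ℝ → ℝ} {ℓ : ℕ} {W : Set ℝ}
    (h : RadialChain F M (2 * ℓ) W) (hℓ : ℓ = 1 ∨ ℓ = 2) {z : Plane} (hz0 : z ≠ 0)
    (hz : ‖z‖ ^ 2 ∈ W) {Q : ℝ}
    (hQ : ∀ a₁ a₂ : ℕ, 2 ≤ a₁ + a₂ → a₁ + a₂ ≤ 2 * ℓ → |mixedPartial a₁ a₂ F z| ≤ Q) :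
    ProfileBound ℓ M ‖z‖ (12 * Q) := by
  have hℓ1 : 1 ≤ ℓ := by rcases hℓ with rfl | rfl <;> norm_num
  have hQ0 : 0 ≤ Q := (abs_nonneg _).trans (hQ 2 0 le_rfl (by omega))
  obtain ⟨b1, b2⟩ := h.abs_deriv_le_of_partials (by omega) hz0 hz
    fun a₁ a₂ ha => hQ a₁ a₂ ha.ge (by omega)
  refine ⟨by linarith, by linarith, fun h2 => ?_, fun h2 => ?_, fun h2 => ?_⟩ <;>
  · obtain ⟨b3, b4, b5⟩ := h.abs_deriv_four_le_of_partials (by omega) hz0 hz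
      fun a₁ a₂ ha => hQ a₁ a₂ (by omega) (by omega)
    linarith

/-- Divided differences over windows at parameter distance at least `ρ`. -/
lemma RegularCurve.exists_abs_windowCov_le {c c₁ c₂ : ℝ → Plane} {L κ B : ℝ} {ℓ : ℕ} {ν : ℝ}
    (h : RegularCurve c c₁ c₂ L κ B) (hℓ : ℓ = 1 ∨ ℓ = 2) (hν : ν < ℓ)
    {F : Plane → ℝ} (hF : ∀ x y, ‖x‖ = ‖y‖ → F x = F y) {Γ U : Set Plane}
    (hΓ : ∀ s ∈ Set.Icc 0 L, c s ∈ Γ) (hU : IsOpen U)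
    (hΓU : ∀ x ∈ Γ, ∀ y ∈ Γ, x ≠ y → x - y ∈ U)
    (hd : ∀ a₁ a₂ : ℕ, a₁ + a₂ = 2 * ℓ →
      MixedPartialExistsOn a₁ a₂ F U ∧ ContinuousOn (mixedPartial a₁ a₂ F) U)
    {C₄ : ℝ} (hC : ∀ a₁ a₂ : ℕ, 2 ≤ a₁ + a₂ → a₁ + a₂ ≤ 2 * ℓ → ∀ x ∈ Γ, ∀ y ∈ Γ, x ≠ y →
      |mixedPartial a₁ a₂ F (x - y)| ≤ C₄ * ‖x - y‖ ^ (2 * ν - 2 * (ℓ : ℝ))) :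
    ∃ C : ℝ, 0 ≤ C ∧ ∀ u u' δ ρ : ℝ, 0 < ρ → Window L κ B ℓ u δ → Window L κ B ℓ u' δ →
      (∀ s ∈ Set.Icc u (u + ℓ * δ), ∀ t ∈ Set.Icc u' (u' + ℓ * δ), ρ ≤ |s - t|) →
      |windowCov (fun x y => F (x - y)) c ℓ u u' δ| ≤ C * ρ ^ (2 * ν - 2 * (ℓ : ℝ)) := by
  obtain ⟨M, W, hM, hW⟩ := exists_radialChain hF hU hd
  have hκ := h.pos
  set E : ℝ := max 1 (max (2 * B) (max (2 * B ^ 2 + 2 * B * (B * L)) (B * L)))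
  have hE : 1 ≤ E := le_max_left _ _
  have hE1 : 2 * B ≤ E := (le_max_left _ _).trans (le_max_right _ _)
  have hE2 : 2 * B ^ 2 + 2 * B * (B * L) ≤ E :=
    (le_max_left _ _).trans ((le_max_right _ _).trans (le_max_right _ _))
  have hE3 : B * L ≤ E :=
    (le_max_right _ _).trans ((le_max_right _ _).trans (le_max_right _ _))
  set D : ℝ := (4 / κ + 20 / κ ^ 2 + 12 * B / κ ^ 3) ^ 2
  set p : ℝ := 2 * ν - 2 * (ℓ : ℝ) with hp
  have hp0 : p ≤ 0 := by rw [hp]; linarith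
  have hκp : 0 ≤ κ ^ p := Real.rpow_nonneg hκ.le _
  refine ⟨D * (15 * E ^ 4 * (12 * (|C₄| * κ ^ p))), by positivity,
    fun u u' δ ρ hρ hw hw' hsep => ?_⟩
  have hρp : 0 ≤ ρ ^ p := Real.rpow_nonneg hρ.le _
  refine (h.abs_windowCov_radial_le hℓ hM hw hw' (Q := 12 * (|C₄| * (κ ^ p * ρ ^ p)))
    (by positivity) hE hE1 hE2 hE3 fun s hs t ht => ?_).trans (le_of_eq (by ring))
  have hsL : s ∈ Set.Icc 0 L := Set.Icc_subset_Icc hw.nonneg hw.le hs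
  have htL : t ∈ Set.Icc 0 L := Set.Icc_subset_Icc hw'.nonneg hw'.le ht
  have hr : κ * ρ ≤ ‖c s - c t‖ :=
    (mul_le_mul_of_nonneg_left (hsep s hs t ht) hκ.le).trans (h.chord s hsL t htL)
  have hz0 : c s - c t ≠ 0 := norm_pos_iff.1 ((mul_pos hκ hρ).trans_le hr)
  have hne : c s ≠ c t := sub_ne_zero.1 hz0
  have hz := hW _ (hΓU _ (hΓ s hsL) _ (hΓ t htL) hne) hz0
  refine ⟨hz, hM.profileBound hℓ hz0 hz fun a₁ a₂ h2 h2ℓ =>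
    (hC a₁ a₂ h2 h2ℓ _ (hΓ s hsL) _ (hΓ t htL) hne).trans ?_⟩
  rw [← Real.mul_rpow hκ.le hρ.le]
  exact mul_le_mul (le_abs_self _) (Real.rpow_le_rpow_of_nonpos (mul_pos hκ hρ) hr hp0)
    (Real.rpow_nonneg (norm_nonneg _) _) (abs_nonneg _)

/-- With `a = |i - j|` the windows are at least `L (a - θℓ) / (n - 1)` apart, and `a ≥ 2θℓ + 1`
gives `1 + a ≤ 4 (a - θℓ)`. -/
lemma separated_of_mem {L : ℝ} (hL : 0 < L) {θ ℓ n i j : ℕ} (hn : 2 ≤ n)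
    (hij : 2 * (θ * ℓ : ℝ) + 1 ≤ |(i : ℝ) - j|) {s t : ℝ}
    (hs : s ∈ Set.Icc (baseNode L n i) (baseNode L n i + ℓ * spacing L θ n))
    (ht : t ∈ Set.Icc (baseNode L n j) (baseNode L n j + ℓ * spacing L θ n)) :
    L / 4 * ((n : ℝ) / (1 + |(i : ℝ) - j|))⁻¹ ≤ |s - t| := by
  have hn' : (2 : ℝ) ≤ n := by exact_mod_cast hn
  have h1 : 0 < (n : ℝ) - 1 := by linarith
  have hb : ∀ k : ℕ, baseNode L n k + ℓ * spacing L θ n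
      = L * (k - 1 + θ * ℓ) / ((n : ℝ) - 1) := by
    intro k; rw [baseNode, spacing]; ring
  rw [hb] at hs ht
  rw [baseNode] at hs ht
  set a : ℝ := |(i : ℝ) - j| with ha
  have key : L * (a - θ * ℓ) / ((n : ℝ) - 1) ≤ |s - t| := by
    rcases abs_cases ((i : ℝ) - j) with ⟨he, -⟩ | ⟨he, -⟩
    · refine le_trans ?_ (le_abs_self _)
      have := sub_le_sub hs.1 ht.2
      rw [← sub_div] at this
      refine le_trans (le_of_eq ?_) this
      rw [ha, he]; ring
    · refine le_trans ?_ (neg_le_abs _)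
      have := sub_le_sub ht.1 hs.2
      rw [← sub_div] at this
      rw [neg_sub]
      refine le_trans (le_of_eq ?_) this
      rw [ha, he]; ring
  refine le_trans ?_ key
  rw [inv_div, div_mul_div_comm, div_le_div_iff₀ (by linarith) h1]
  have hm : (0 : ℝ) ≤ θ * ℓ := by positivity
  have e1 : L * (1 + a) * (n - 1) ≤ L * (1 + a) * n := by
    have : 0 ≤ L * (1 + a) := by positivity
    exact mul_le_mul_of_nonneg_left (by linarith) this
  have e2 : L * n * (1 + a) ≤ L * n * (4 * (a - θ * ℓ)) := by
    have : 0 ≤ L * n := by positivity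
    exact mul_le_mul_of_nonneg_left (by linarith) this
  linarith

/-- Nonnegativity of the variances of `Y + Z` and `Y - Z`. -/
lemma abs_covariance_le {Ω : Type*} [MeasurableSpace Ω] {P : Measure Ω} [IsProbabilityMeasure P]
    {Y Z : Ω → ℝ} (hY : MemLp Y 2 P) (hZ : MemLp Z 2 P) {V : ℝ} (hYV : variance Y P ≤ V)
    (hZV : variance Z P ≤ V) : |covariance Y Z P| ≤ V := by
  have h1 := variance_nonneg (Y + Z) P
  have h2 := variance_nonneg (Y - Z) P
  rw [variance_add hY hZ] at h1
  rw [variance_sub hY hZ] at h2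
  exact abs_le.2 ⟨by linarith, by linarith⟩

/-- The covariances of the differences decay polynomially. -/
lemma exists_abs_covariance_nablaTilde_le {Ω : Type*} [MeasurableSpace Ω] {P : Measure Ω}
    [IsProbabilityMeasure P] {X : Plane → Ω → ℝ} (hX : IsStationaryIsotropicGaussianField P X)
    {γ : ℝ → Plane} {φ : ℝ → ℝ} {L κ B ν : ℝ} {θ ℓ : ℕ} {c₁ c₂ : ℝ → Plane}
    (h : RegularCurve (fun u => γ (φ u)) c₁ c₂ L κ B) (hL : 0 < L)
    (hθ : θ = 1 ∨ θ = 2) (hℓ : ℓ = 1 ∨ ℓ = 2) (hν : ν < ℓ) {Γ U : Set Plane}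
    (hΓ : ∀ s ∈ Set.Icc 0 L, γ (φ s) ∈ Γ) (hU : IsOpen U)
    (hΓU : ∀ x ∈ Γ, ∀ y ∈ Γ, x ≠ y → x - y ∈ U)
    (hd : ∀ a₁ a₂ : ℕ, a₁ + a₂ = 2 * ℓ →
      MixedPartialExistsOn a₁ a₂ (covTilde P X) U ∧
      ContinuousOn (mixedPartial a₁ a₂ (covTilde P X)) U)
    {C₄ : ℝ} (hC : ∀ a₁ a₂ : ℕ, 2 ≤ a₁ + a₂ → a₁ + a₂ ≤ 2 * ℓ → ∀ x ∈ Γ, ∀ y ∈ Γ, x ≠ y →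
      |mixedPartial a₁ a₂ (covTilde P X) (x - y)| ≤ C₄ * ‖x - y‖ ^ (2 * ν - 2 * (ℓ : ℝ)))
    {V : ℝ} (hV0 : 0 < V) (hV : ∀ᶠ n : ℕ in atTop, ∀ i ∈ Finset.Icc 1 (n - θ * ℓ),
      variance (nablaTilde X γ φ L θ ℓ n i) P ≤ V * (n : ℝ) ^ (2 * (ℓ : ℝ) - 2 * ν)) :
    ∃ C : ℝ, 0 < C ∧ ∀ᶠ n : ℕ in atTop, ∀ i ∈ Finset.Icc 1 (n - θ * ℓ),
      ∀ j ∈ Finset.Icc 1 (n - θ * ℓ),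
      |covariance (nablaTilde X γ φ L θ ℓ n i) (nablaTilde X γ φ L θ ℓ n j) P|
        ≤ C * ((n : ℝ) / (1 + |(i : ℝ) - j|)) ^ (2 * (ℓ : ℝ) - 2 * ν) := by
  have hrad : ∀ x y : Plane, ‖x‖ = ‖y‖ → covTilde P X x = covTilde P X y := fun x y hxy =>
    hX.isotropic x 0 y 0 (by simpa using hxy)
  have hK : covFun P X = fun x y => covTilde P X (x - y) := by
    ext x y
    exact hX.isotropic x y (x - y) 0 (by simp)
  obtain ⟨A, hA, hdist⟩ := h.exists_abs_windowCov_le hℓ hν hrad hΓ hU hΓU hd hC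
  set s : ℝ := 2 * (ℓ : ℝ) - 2 * ν with hs
  have hs0 : 0 < s := by rw [hs]; linarith
  rw [show 2 * ν - 2 * (ℓ : ℝ) = -s by rw [hs]; ring] at hdist
  have hL4 : 0 ≤ (L / 4) ^ (-s) := Real.rpow_nonneg (by positivity) _
  refine ⟨A * (L / 4) ^ (-s) + V * (10 : ℝ) ^ s, by positivity, ?_⟩
  filter_upwards [hV, eventually_window (B := B) hL h.pos hθ ℓ, eventually_ge_atTop 2]
    with n hn hw hn2 i hi j hj
  have hn0 : (0 : ℝ) < n := by exact_mod_cast (by omega : 0 < n)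
  have hg : ∀ i, HasGaussianLaw (nablaTilde X γ φ L θ ℓ n i) P :=
    (isGaussianProcess_nablaTilde hX.gaussian γ φ L θ ℓ n).hasGaussianLaw_eval
  set a : ℝ := |(i : ℝ) - j| with ha
  have ha0 : 0 ≤ a := abs_nonneg _
  have hx0 : 0 < (n : ℝ) / (1 + a) := by positivity
  have hxs : 0 ≤ ((n : ℝ) / (1 + a)) ^ s := Real.rpow_nonneg hx0.le _
  have h10 : (0 : ℝ) ≤ (10 : ℝ) ^ s := Real.rpow_nonneg (by norm_num) _
  rw [add_mul]
  -- Separated windows are handled by derivatives of the covariance; for the remaining pairs `1 + a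
  -- ≤ 10`, as `θℓ ≤ 4`, and the bound by the variances is enough.
  by_cases hsep : 2 * (θ * ℓ : ℝ) + 1 ≤ a
  · rw [covariance_nablaTilde hX.gaussian, hK]
    refine (hdist _ _ _ (L / 4 * ((n : ℝ) / (1 + a))⁻¹) (by positivity) (hw i hi) (hw j hj)
      fun s hs t ht => separated_of_mem hL hn2 hsep hs ht).trans ?_
    rw [Real.mul_rpow (by positivity) (by positivity), Real.inv_rpow hx0.le,
      Real.rpow_neg hx0.le, inv_inv, ← mul_assoc]
    exact le_add_of_nonneg_right (by positivity)
  · refine (abs_covariance_le (hg i).memLp_two (hg j).memLp_two (hn i hi) (hn j hj)).trans ?_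
    refine le_trans ?_ (le_add_of_nonneg_left (by positivity))
    rw [mul_assoc, ← Real.mul_rpow (by norm_num) hx0.le]
    refine mul_le_mul_of_nonneg_left (Real.rpow_le_rpow hn0.le ?_ hs0.le) hV0.le
    rw [← mul_div_assoc, le_div_iff₀ (by positivity)]
    have : 1 + a ≤ 10 := by
      rcases hθ with rfl | rfl <;> rcases hℓ with rfl | rfl <;> norm_num at hsep <;> linarith
    nlinarith

/-! ### The law of large numbers -/

lemma cast_sub_add_sub (i j : ℕ) : (((i - j) + (j - i) : ℕ) : ℝ) = |(i : ℝ) - j| := by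
  rcases le_total i j with h | h
  · rw [Nat.sub_eq_zero_of_le h, zero_add, Nat.cast_sub h, abs_sub_comm,
      abs_of_nonneg (sub_nonneg.2 (by exact_mod_cast h))]
  · rw [Nat.sub_eq_zero_of_le h, add_zero, Nat.cast_sub h,
      abs_of_nonneg (sub_nonneg.2 (by exact_mod_cast h))]

/-- The double sum is organised by the lag `|i - j|`. -/
lemma sum_sum_sq_le {a : ℕ → ℕ → ℝ} {N n : ℕ} {C s : ℝ} (hNn : N ≤ n) (hn : 0 < n)
    (h : ∀ i ∈ Finset.Icc 1 N, ∀ j ∈ Finset.Icc 1 N,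
      |a i j| ≤ C * ((n : ℝ) / (1 + |(i : ℝ) - j|)) ^ s) :
    ∑ i ∈ Finset.Icc 1 N, ∑ j ∈ Finset.Icc 1 N, a i j ^ 2
      ≤ 2 * C ^ 2 * (n : ℝ) ^ (2 * s + 1) * ∑ k ∈ Finset.range n, ((k : ℝ) + 1) ^ (-(2 * s)) := by
  have hn0 : (0 : ℝ) < n := by exact_mod_cast hn
  have hpos : ∀ k : ℕ, 0 ≤ ((k : ℝ) + 1) ^ (-(2 * s)) := fun k =>
    Real.rpow_nonneg (by positivity) _
  have hterm : ∀ i ∈ Finset.Icc 1 N, ∀ j ∈ Finset.Icc 1 N,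
      a i j ^ 2 ≤ C ^ 2 * (n : ℝ) ^ (2 * s) * ((((i - j) + (j - i) : ℕ) : ℝ) + 1) ^ (-(2 * s)) := by
    intro i hi j hj
    rw [cast_sub_add_sub, ← sq_abs]
    have hb : (0 : ℝ) < 1 + |(i : ℝ) - j| := by positivity
    refine (pow_le_pow_left₀ (abs_nonneg _) (h i hi j hj) 2).trans (le_of_eq ?_)
    rw [mul_pow, ← Real.rpow_natCast _ 2, ← Real.rpow_natCast _ 2,
      ← Real.rpow_mul (by positivity), Nat.cast_two, mul_comm s 2, Real.div_rpow hn0.le hb.le,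
      Real.rpow_neg (by positivity), add_comm |(i : ℝ) - j| 1]
    ring
  have hn2 : 0 ≤ C ^ 2 * (n : ℝ) ^ (2 * s) := by positivity
  calc _ ≤ ∑ i ∈ Finset.Icc 1 N, ∑ j ∈ Finset.Icc 1 N,
        C ^ 2 * (n : ℝ) ^ (2 * s) * ((((i - j) + (j - i) : ℕ) : ℝ) + 1) ^ (-(2 * s)) :=
        Finset.sum_le_sum fun i hi => Finset.sum_le_sum fun j hj => hterm i hi j hj
    _ ≤ ∑ _i ∈ Finset.Icc 1 N, C ^ 2 * (n : ℝ) ^ (2 * s) *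
        (2 * ∑ k ∈ Finset.range N, ((k : ℝ) + 1) ^ (-(2 * s))) := by
        refine Finset.sum_le_sum fun i hi => ?_
        rw [← Finset.mul_sum]
        exact mul_le_mul_of_nonneg_left
          (sum_abs_sub_le (f := fun k => ((k : ℝ) + 1) ^ (-(2 * s))) hpos N i hi) hn2
    _ = N * (C ^ 2 * (n : ℝ) ^ (2 * s) *
        (2 * ∑ k ∈ Finset.range N, ((k : ℝ) + 1) ^ (-(2 * s)))) := by simp
    _ ≤ n * (C ^ 2 * (n : ℝ) ^ (2 * s) *
        (2 * ∑ k ∈ Finset.range n, ((k : ℝ) + 1) ^ (-(2 * s)))) := by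
        have : ∑ k ∈ Finset.range N, ((k : ℝ) + 1) ^ (-(2 * s))
            ≤ ∑ k ∈ Finset.range n, ((k : ℝ) + 1) ^ (-(2 * s)) :=
          Finset.sum_le_sum_of_subset_of_nonneg (Finset.range_mono hNn) fun k _ _ => hpos k
        have h0 : 0 ≤ ∑ k ∈ Finset.range N, ((k : ℝ) + 1) ^ (-(2 * s)) :=
          Finset.sum_nonneg fun k _ => hpos k
        gcongr
    _ = _ := by rw [Real.rpow_add_one hn0.ne']; ring

section

variable {Ω : Type*} [MeasurableSpace Ω] {P : Measure Ω} [IsProbabilityMeasure P]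
  {X : Plane → Ω → ℝ} {γ : ℝ → Plane} {φ : ℝ → ℝ} {L s c C : ℝ} {θ ℓ : ℕ}

/-- The relative variance of the quadratic variation. -/
lemma eventually_variance_VTilde_div_le (hX : IsGaussianProcess X P) (hc : 0 < c)
    (h0 : ∀ᶠ n : ℕ in atTop, ∀ i ∈ Finset.Icc 1 (n - θ * ℓ),
      ∫ ω, nablaTilde X γ φ L θ ℓ n i ω ∂P = 0)
    (hE : ∀ᶠ n : ℕ in atTop, c * (n : ℝ) ^ (s + 1) ≤ ∫ ω, VTilde X γ φ L θ ℓ n ω ∂P)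
    (hcov : ∀ᶠ n : ℕ in atTop, ∀ i ∈ Finset.Icc 1 (n - θ * ℓ), ∀ j ∈ Finset.Icc 1 (n - θ * ℓ),
      |covariance (nablaTilde X γ φ L θ ℓ n i) (nablaTilde X γ φ L θ ℓ n j) P|
        ≤ C * ((n : ℝ) / (1 + |(i : ℝ) - j|)) ^ s) :
    ∀ᶠ n : ℕ in atTop, variance (fun ω => VTilde X γ φ L θ ℓ n ω
        / ∫ ω', VTilde X γ φ L θ ℓ n ω' ∂P) P
      ≤ 4 * C ^ 2 / c ^ 2 * ((n : ℝ)⁻¹ * ∑ k ∈ Finset.range n, ((k : ℝ) + 1) ^ (-(2 * s))) := by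
  filter_upwards [h0, hE, hcov, eventually_gt_atTop 0] with n h0 hE hcov hn
  have hn0 : (0 : ℝ) < n := by exact_mod_cast hn
  have hns : 0 < (n : ℝ) ^ (s + 1) := Real.rpow_pos_of_pos hn0 _
  set m : ℝ := ∫ ω, VTilde X γ φ L θ ℓ n ω ∂P
  have hm : 0 < m := lt_of_lt_of_le (by positivity) hE
  have hS : 0 ≤ ∑ k ∈ Finset.range n, ((k : ℝ) + 1) ^ (-(2 * s)) :=
    Finset.sum_nonneg fun k _ => Real.rpow_nonneg (by positivity) _
  have hV : variance (VTilde X γ φ L θ ℓ n) P = 2 * ∑ i ∈ Finset.Icc 1 (n - θ * ℓ),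
      ∑ j ∈ Finset.Icc 1 (n - θ * ℓ),
        covariance (nablaTilde X γ φ L θ ℓ n i) (nablaTilde X γ φ L θ ℓ n j) P ^ 2 := by
    rw [VTilde_eq_sum_subtype, variance_sum_sq (hasGaussianLaw_nablaTilde hX γ φ L θ ℓ n)
      fun i => h0 i i.2, ← Finset.sum_coe_sort (Finset.Icc 1 (n - θ * ℓ))]
    congr 1
    refine Finset.sum_congr rfl fun i _ => ?_
    rw [← Finset.sum_coe_sort (Finset.Icc 1 (n - θ * ℓ))]
  have hsum := sum_sum_sq_le (Nat.sub_le n (θ * ℓ)) hn hcov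
  have e : (fun ω => VTilde X γ φ L θ ℓ n ω / m) = fun ω => m⁻¹ * VTilde X γ φ L θ ℓ n ω := by
    ext ω; rw [div_eq_inv_mul]
  rw [e, variance_const_mul, hV]
  have hpow : (n : ℝ) ^ (2 * s + 1) = ((n : ℝ) ^ (s + 1)) ^ 2 * (n : ℝ)⁻¹ := by
    rw [← Real.rpow_natCast _ 2, ← Real.rpow_mul hn0.le, ← Real.rpow_neg_one (n : ℝ),
      ← Real.rpow_add hn0]
    congr 1
    push_cast
    ring
  calc _ ≤ m⁻¹ ^ 2 * (2 * (2 * C ^ 2 * (n : ℝ) ^ (2 * s + 1)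
        * ∑ k ∈ Finset.range n, ((k : ℝ) + 1) ^ (-(2 * s)))) := by gcongr
    _ ≤ (c * (n : ℝ) ^ (s + 1))⁻¹ ^ 2 * (2 * (2 * C ^ 2 * (n : ℝ) ^ (2 * s + 1)
        * ∑ k ∈ Finset.range n, ((k : ℝ) + 1) ^ (-(2 * s)))) := by gcongr
    _ = _ := by
        rw [hpow]
        field_simp
        ring

/-- Strong law for the quadratic variation. -/
lemma ae_tendsto_VTilde_div (hX : IsGaussianProcess X P) (hc : 0 < c) (hs : 0 < s) (hC : 0 < C)
    (h0 : ∀ᶠ n : ℕ in atTop, ∀ i ∈ Finset.Icc 1 (n - θ * ℓ),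
      ∫ ω, nablaTilde X γ φ L θ ℓ n i ω ∂P = 0)
    (hE : ∀ᶠ n : ℕ in atTop, c * (n : ℝ) ^ (s + 1) ≤ ∫ ω, VTilde X γ φ L θ ℓ n ω ∂P)
    (hcov : ∀ᶠ n : ℕ in atTop, ∀ i ∈ Finset.Icc 1 (n - θ * ℓ), ∀ j ∈ Finset.Icc 1 (n - θ * ℓ),
      |covariance (nablaTilde X γ φ L θ ℓ n i) (nablaTilde X γ φ L θ ℓ n j) P|
        ≤ C * ((n : ℝ) / (1 + |(i : ℝ) - j|)) ^ s) :
    ∀ᵐ ω ∂P, Tendsto (fun n : ℕ => VTilde X γ φ L θ ℓ n ω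
      / ∫ ω', VTilde X γ φ L θ ℓ n ω' ∂P) atTop (𝓝 1) := by
  -- Lowering the exponent below `1` allows one power-sum estimate for all regimes. The Frobenius
  -- norm is then smaller than the mean by a factor of order `n ^ (-q / 2)`, which is all the tail
  -- bound needs.
  set q : ℝ := min (2 * s) (1 / 2) with hq
  have hq0 : 0 < q := by positivity
  have hq1 : q < 1 := (min_le_right _ _).trans_lt (by norm_num)
  have h1q : 0 < 1 - q := by linarith
  set A : ℝ := √(2 * C ^ 2 / (1 - q)) with hA
  have hA0 : 0 < A := by positivity
  refine ae_tendsto_div_one_of_exp_tail (c := c / (4 * A)) (δ := q / 2) (by positivity)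
    (by positivity) ?_
  filter_upwards [h0, hE, hcov, eventually_gt_atTop 0] with n h0 hE hcov hn
  have hn0 : (0 : ℝ) < n := by exact_mod_cast hn
  have hns : 0 < (n : ℝ) ^ (s + 1) := Real.rpow_pos_of_pos hn0 _
  set m : ℝ := ∫ ω, VTilde X γ φ L θ ℓ n ω ∂P with hm
  have hm0 : 0 < m := lt_of_lt_of_le (by positivity) hE
  have hF0 : 0 < (n : ℝ) ^ (s + 1 - q / 2) := Real.rpow_pos_of_pos hn0 _
  have hF : ∑ i : Finset.Icc 1 (n - θ * ℓ), ∑ j : Finset.Icc 1 (n - θ * ℓ),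
      covariance (nablaTilde X γ φ L θ ℓ n i) (nablaTilde X γ φ L θ ℓ n j) P ^ 2
        ≤ (A * (n : ℝ) ^ (s + 1 - q / 2)) ^ 2 := by
    have e : ∑ i : Finset.Icc 1 (n - θ * ℓ), ∑ j : Finset.Icc 1 (n - θ * ℓ),
        covariance (nablaTilde X γ φ L θ ℓ n i) (nablaTilde X γ φ L θ ℓ n j) P ^ 2
        = ∑ i ∈ Finset.Icc 1 (n - θ * ℓ), ∑ j ∈ Finset.Icc 1 (n - θ * ℓ),
        covariance (nablaTilde X γ φ L θ ℓ n i) (nablaTilde X γ φ L θ ℓ n j) P ^ 2 := by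
      rw [← Finset.sum_coe_sort (Finset.Icc 1 (n - θ * ℓ))]
      refine Finset.sum_congr rfl fun i _ => ?_
      rw [← Finset.sum_coe_sort (Finset.Icc 1 (n - θ * ℓ))]
    rw [e]
    refine (sum_sum_sq_le (Nat.sub_le n (θ * ℓ)) hn hcov).trans ?_
    have hS : ∑ k ∈ Finset.range n, ((k : ℝ) + 1) ^ (-(2 * s)) ≤ (n : ℝ) ^ (1 - q) / (1 - q) := by
      refine le_trans (Finset.sum_le_sum fun k _ => ?_) (sum_rpow_neg_le hq0.le hq1 n)
      exact Real.rpow_le_rpow_of_exponent_le (by linarith [(Nat.cast_nonneg k : (0 : ℝ) ≤ k)])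
        (neg_le_neg (min_le_left _ _))
    calc _ ≤ 2 * C ^ 2 * (n : ℝ) ^ (2 * s + 1) * ((n : ℝ) ^ (1 - q) / (1 - q)) := by gcongr
      _ = 2 * C ^ 2 / (1 - q) * ((n : ℝ) ^ (2 * s + 1) * (n : ℝ) ^ (1 - q)) := by ring
      _ = _ := by
          rw [mul_pow, hA, Real.sq_sqrt (by positivity),
            ← Real.rpow_natCast ((n : ℝ) ^ (s + 1 - q / 2)) 2,
            ← Real.rpow_mul hn0.le, ← Real.rpow_add hn0]
          congr 2
          push_cast
          ring
  refine ⟨hm0, fun t => ?_⟩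
  -- For negative `t` the claimed bound exceeds `1`.
  rcases lt_or_ge t 0 with ht | ht
  · refine (measureReal_le_one).trans ?_
    have : 1 ≤ Real.exp (1 - c / (4 * A) * (n : ℝ) ^ (q / 2) * (t / m)) := by
      rw [Real.one_le_exp_iff]
      have : c / (4 * A) * (n : ℝ) ^ (q / 2) * (t / m) ≤ 0 :=
        mul_nonpos_of_nonneg_of_nonpos (by positivity) (div_nonpos_of_nonpos_of_nonneg ht.le hm0.le)
      linarith
    linarith
  have htail := measure_abs_sum_sq_sub_integral_ge_le (hasGaussianLaw_nablaTilde hX γ φ L θ ℓ n)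
    (fun i => h0 i i.2) (mul_pos hA0 hF0) hF t
  have e : ∀ ω, ∑ i : Finset.Icc 1 (n - θ * ℓ), nablaTilde X γ φ L θ ℓ n i ω ^ 2
      = VTilde X γ φ L θ ℓ n ω := fun ω => (congrFun (VTilde_eq_sum_subtype X γ φ L θ ℓ n) ω).symm
  simp only [e] at htail
  refine htail.trans ?_
  gcongr
  have hsplit : (n : ℝ) ^ (s + 1) = (n : ℝ) ^ (q / 2) * (n : ℝ) ^ (s + 1 - q / 2) := by
    rw [← Real.rpow_add hn0]; congr 1; ring
  have : t / m ≤ t / (c * (n : ℝ) ^ (s + 1)) := by gcongr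
  have hnq : 0 < (n : ℝ) ^ (q / 2) := Real.rpow_pos_of_pos hn0 _
  calc c / (4 * A) * (n : ℝ) ^ (q / 2) * (t / m)
      ≤ c / (4 * A) * (n : ℝ) ^ (q / 2) * (t / (c * (n : ℝ) ^ (s + 1))) := by gcongr
    _ = _ := by
        rw [hsplit]
        field_simp

end

/-- The three regimes of the rate. -/
lemma isBigO_of_le_sum_rpow {f : ℕ → ℝ} {p A : ℝ} (hp : 0 < p) (hA : 0 ≤ A) (hf : ∀ n, 0 ≤ f n)
    (h : ∀ᶠ n : ℕ in atTop,
      f n ≤ A * ((n : ℝ)⁻¹ * ∑ k ∈ Finset.range n, ((k : ℝ) + 1) ^ (-p))) :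
    (1 < p → f =O[atTop] fun n : ℕ => (n : ℝ)⁻¹) ∧
    (p = 1 → f =O[atTop] fun n : ℕ => (n : ℝ)⁻¹ * Real.log n) ∧
    (p < 1 → f =O[atTop] fun n : ℕ => (n : ℝ) ^ (-p)) := by
  refine ⟨fun h1 => ?_, fun h1 => ?_, fun h1 => ?_⟩
  · obtain ⟨C, hC⟩ := sum_rpow_neg_bounded h1
    refine IsBigO.of_bound (A * C) ?_
    filter_upwards [h] with n hn
    rw [Real.norm_of_nonneg (hf n), Real.norm_of_nonneg (by positivity)]
    calc f n ≤ _ := hn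
      _ ≤ A * ((n : ℝ)⁻¹ * C) := by gcongr; exact hC n
      _ = _ := by ring
  · refine IsBigO.of_bound (A * 2) ?_
    filter_upwards [h, eventually_gt_atTop 0,
      (Real.tendsto_log_atTop.comp tendsto_natCast_atTop_atTop).eventually_ge_atTop 1]
      with n hn hn0 hlog
    have hlog' : 1 ≤ Real.log n := hlog
    rw [Real.norm_of_nonneg (hf n), Real.norm_of_nonneg (by positivity)]
    calc f n ≤ _ := hn
      _ ≤ A * ((n : ℝ)⁻¹ * (2 * Real.log n)) := by
          rw [h1]
          gcongr
          linarith [sum_inv_le_log n]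
      _ = _ := by ring
  · refine IsBigO.of_bound (A / (1 - p)) ?_
    filter_upwards [h, eventually_gt_atTop 0] with n hn hn0
    have hn0' : (0 : ℝ) < n := by exact_mod_cast hn0
    rw [Real.norm_of_nonneg (hf n), Real.norm_of_nonneg (by positivity)]
    calc f n ≤ _ := hn
      _ ≤ A * ((n : ℝ)⁻¹ * ((n : ℝ) ^ (1 - p) / (1 - p))) := by
          gcongr
          exact sum_rpow_neg_le hp.le h1 n
      _ = _ := by
          rw [show 1 - p = -p + 1 by ring, Real.rpow_add_one hn0'.ne']
          field_simp

end CurveVariation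

end

/-! ### The main theorem -/

open CurveVariation

theorem theorem3p1
    {Ω : Type*} [MeasurableSpace Ω] (P : Measure Ω) [IsProbabilityMeasure P]
    (X : CurveVariation.Plane → Ω → ℝ)
    (hX : CurveVariation.IsStationaryIsotropicGaussianField P X)
    (θ ℓ : ℕ) (hθ : θ = 1 ∨ θ = 2) (hℓ : ℓ = 1 ∨ ℓ = 2)
    (ν : ℝ) (hν0 : 0 < ν) (hνℓ : ν < ℓ)
    (β : ℕ → ℝ) (βstar : ℝ) (hβstar : βstar ≠ 0)
    (hK : CurveVariation.HasCovarianceExpansion (CurveVariation.covFun P X) ν β βstar)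
    -- `γ` is a `C²` curve parametrised by arc length
    (ε L : ℝ) (hε : 0 < ε) (hL : 0 < L) (γ : ℝ → CurveVariation.Plane)
    (hγ : ContDiffOn ℝ 2 γ (Set.Ioo (-ε) (L + ε)))
    (hγ_arc : ∀ t ∈ Set.Ioo (-ε) (L + ε), ‖deriv γ t‖ = 1)
    (C₃ : ℝ) (hC₃ : 0 < C₃)
    (hγ_lower : ∀ s ∈ Set.Icc 0 L, ∀ t ∈ Set.Icc 0 L, C₃ * |s - t| ≤ ‖γ s - γ t‖)
    -- the design function
    (φ : ℝ → ℝ) (hφ : ContDiff ℝ 2 φ) (hφ0 : φ 0 = 0) (hφL : φ L = L)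
    (hφ_pos : ∀ s ∈ Set.Icc 0 L, 0 < deriv φ s) :
    -- all expectations and variances below are genuine
    (∀ n : ℕ, MemLp (CurveVariation.VTilde X γ φ L θ ℓ n) 2 P) ∧
    Tendsto (fun n : ℕ => (∫ ω, CurveVariation.VTilde X γ φ L θ ℓ n ω ∂P)
      / CurveVariation.fTilde βstar γ φ L θ ℓ ν n) atTop (𝓝 1) ∧
    CurveVariation.SameOrder (fun n : ℕ => CurveVariation.fTilde βstar γ φ L θ ℓ ν n)
      (fun n : ℕ => (n : ℝ) ^ (2 * (ℓ : ℝ) + 1 - 2 * ν)) ∧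
    (∀ Γ : Set CurveVariation.Plane, IsCompact Γ → Convex ℝ Γ →
      γ '' Set.Icc 0 L ⊆ Γ →
      ∀ U : Set CurveVariation.Plane, IsOpen U →
      (∀ x ∈ Γ, ∀ y ∈ Γ, x ≠ y → x - y ∈ U) →
      (∀ a₁ a₂ : ℕ, a₁ + a₂ = 2 * ℓ →
        CurveVariation.MixedPartialExistsOn a₁ a₂ (CurveVariation.covTilde P X) U ∧
        ContinuousOn (CurveVariation.mixedPartial a₁ a₂ (CurveVariation.covTilde P X)) U) →
      ∀ C₄ : ℝ,
      (∀ a₁ a₂ : ℕ, 2 ≤ a₁ + a₂ → a₁ + a₂ ≤ 2 * ℓ → ∀ x ∈ Γ, ∀ y ∈ Γ, x ≠ y →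
        |CurveVariation.mixedPartial a₁ a₂ (CurveVariation.covTilde P X) (x - y)|
          ≤ C₄ * ‖x - y‖ ^ (2 * ν - 2 * (ℓ : ℝ))) →
      (∀ᵐ ω ∂P, Tendsto (fun n : ℕ => CurveVariation.VTilde X γ φ L θ ℓ n ω
        / ∫ ω', CurveVariation.VTilde X γ φ L θ ℓ n ω' ∂P) atTop (𝓝 1)) ∧
      (ν < (4 * (ℓ : ℝ) - 1) / 4 →
        (fun n : ℕ => variance (fun ω => CurveVariation.VTilde X γ φ L θ ℓ n ω
          / ∫ ω', CurveVariation.VTilde X γ φ L θ ℓ n ω' ∂P) P)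
        =O[atTop] (fun n : ℕ => ((n : ℝ))⁻¹)) ∧
      (ν = (4 * (ℓ : ℝ) - 1) / 4 →
        (fun n : ℕ => variance (fun ω => CurveVariation.VTilde X γ φ L θ ℓ n ω
          / ∫ ω', CurveVariation.VTilde X γ φ L θ ℓ n ω' ∂P) P)
        =O[atTop] (fun n : ℕ => ((n : ℝ))⁻¹ * Real.log n)) ∧
      ((4 * (ℓ : ℝ) - 1) / 4 < ν →
        (fun n : ℕ => variance (fun ω => CurveVariation.VTilde X γ φ L θ ℓ n ω
          / ∫ ω', CurveVariation.VTilde X γ φ L θ ℓ n ω' ∂P) P)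
        =O[atTop] (fun n : ℕ => (n : ℝ) ^ (-4 * (ℓ : ℝ) + 4 * ν)))) := by
  obtain ⟨hmaps, c₁, c₂, κ, B, hB, hreg⟩ :=
    exists_regularCurve hε hL hγ hγ_arc hC₃ hγ_lower hφ hφ0 hφL hφ_pos
  obtain ⟨hlim, hord, ⟨V, hV, hVar⟩, c, hc, hE⟩ :=
    VTilde_expectation hX hreg hB hL hθ hℓ hν0 hνℓ hβstar hK
  refine ⟨fun n => memLp_VTilde hX.gaussian γ φ L θ ℓ n, hlim, hord, ?_⟩
  intro Γ _ _ hΓ U hU hΓU hd C₄ hC₄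
  have h0 := eventually_integral_nablaTilde hX hreg hL hθ hℓ
  obtain ⟨C, hC, hcov⟩ := exists_abs_covariance_nablaTilde_le hX hreg hL hθ hℓ hνℓ
    (fun s hs => hΓ ⟨φ s, hmaps s hs, rfl⟩) hU hΓU hd hC₄ hV hVar
  have hs0 : 0 < 2 * (ℓ : ℝ) - 2 * ν := by linarith
  rw [show 2 * (ℓ : ℝ) + 1 - 2 * ν = 2 * (ℓ : ℝ) - 2 * ν + 1 by ring] at hE
  -- The exponent is `p = 2 * (2ℓ - 2ν)`, so `p = 1` is exactly `ν = (4ℓ - 1) / 4`.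
  obtain ⟨r1, r2, r3⟩ := isBigO_of_le_sum_rpow (by positivity) (by positivity)
    (fun n => variance_nonneg _ _) (eventually_variance_VTilde_div_le hX.gaussian hc h0 hE hcov)
  refine ⟨ae_tendsto_VTilde_div hX.gaussian hc hs0 hC h0 hE hcov, fun h => r1 (by linarith),
    fun h => r2 (by linarith), fun h => ?_⟩
  have := r3 (by linarith)
  rwa [show -(2 * (2 * (ℓ : ℝ) - 2 * ν)) = -4 * (ℓ : ℝ) + 4 * ν by ring] at this
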